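/- Throughout, $H^q(X;\mathbb{Q})$ denotes singular cohomology and $H^\bullet(X;\mathbb{Q})=\bigoplus_{q\ge 0}H^q(X;\mathbb{Q})$. A space $X$ is called locally contractible if for every $x\in X$ every neighbourhood $N$ of $x$ contains a neighbourhood $N'$ of $x$ such that the inclusion $N'\hookrightarrow N$ is null-homotopic. Definition. Let $p:M\to B$ be a continuous map between locally contractible spaces and let $F$ be a locally contractible Hausdorff space. The map $p$ is a locally trivial fibration with fibre $F$ in the orbifold sense if for every $b\in B$ there are a neighbourhood $V_b$ of $b$, a locally contractible Hausdorff space $U_b$, a finite group $G_b$ acting by homeomorphisms on $U_b$ and on $F$, a point $u_b\in U_b$ fixed by $G_b$, and homeomorphisms $$\varphi_b: U_b/G_b\to V_b,\qquad \psi_b:(U_b\times F)/G_b\to p^{-1}(V_b)$$ (the second quotient being taken for the product action) such that every $g\in G_b$ acts on $F$ by a homeomorphism homotopic to the identity, $p(\psi_b[u,x])=\varphi_b[u]$ for all $u\in U_b$, $x\in F$, and $\varphi_b[u_b]=b$. The orbifold fibre inclusion $r_b:F\to M$, $r_b(x)=\psi_b[u_b,x]$, is then the composition of the quotient map $F\to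 F/G_b$, the identification of $F/G_b$ with $p^{-1}(b)$, and the inclusion $p^{-1}(b)\hookrightarrow M$. Theorem (LH). Let $p:M\to B$ be a locally trivial fibration with fibre $F$ in the orbifold sense, with a choice of the data above for every $b\in B$. Suppose that for all $q\ge 0$ there exist finitely many classes $e^{(q)}_1,\dots,e^{(q)}_{n(q)}\in H^q(M;\mathbb{Q})$ such that, for every $b\in B$, the classes $r_b^*e^{(q)}_1,\dots,r_b^*e^{(q)}_{n(q)}$ form a basis of $H^q(F;\mathbb{Q})$. Then, for every $b\in B$, the assignment $$a\otimes r_b^*\bigl(e^{(q)}_i\bigr)\longmapsto p^*a\cup e^{(q)}_i,\qquad a\in H^\bullet(B;\mathbb{Q}),\ q\ge 0,\ 1\le i\le n(q),$$ extends linearly to a graded linear isomorphism $$H^\bullet(B;\mathbb{Q})\otimes_{\mathbb{Q}} H^\bullet(F;\mathbb{Q})\stackrel{\sim}{\longrightarrow} H^\bullet(M;\mathbb{Q}).$$ -/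

import Mathlib

open scoped TensorProduct DirectSum Topology

universe uM uB uF uU uG

noncomputable section

/-! ### Singular cohomology with rational coefficients -/

namespace SingularCohomology

universe u v

/-- Singular `n`-simplices of `X`. -/
abbrev Simplex (X : Type u) [TopologicalSpace X] (n : ℕ) : Type u :=
  C(stdSimplex ℝ (Fin (n + 1)), X)

/-- The singular simplex `σ ∘ |f|`, where `|f|` is the affine map of standard simplices that is
given on vertices by `f`. -/
def Simplex.pull {X : Type u} [TopologicalSpace X] {m n : ℕ} (σ : Simplex X n)
    (f : Fin (m + 1) → Fin (n + 1)) : Simplex X m :=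
  σ.comp ⟨stdSimplex.map f, stdSimplex.continuous_map f⟩

theorem Simplex.pull_pull {X : Type u} [TopologicalSpace X] {k m n : ℕ} (σ : Simplex X n)
    (f : Fin (m + 1) → Fin (n + 1)) (g : Fin (k + 1) → Fin (m + 1)) :
    (σ.pull f).pull g = σ.pull (f ∘ g) := by
  ext x
  simp only [Simplex.pull, ContinuousMap.comp_apply, ContinuousMap.coe_mk]
  rw [stdSimplex.map_comp_apply]

/-- Rational singular `n`-cochains of `X`. -/
abbrev Cochain (X : Type u) [TopologicalSpace X] (n : ℕ) : Type u := Simplex X n → ℚ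

/-- The coboundary `(δ c)(σ) = ∑ i, (-1) ^ i * c (i-th face of σ)`. -/
def coboundary (X : Type u) [TopologicalSpace X] (n : ℕ) :
    Cochain X n →ₗ[ℚ] Cochain X (n + 1) where
  toFun c σ := ∑ i : Fin (n + 2), (-1) ^ (i : ℕ) * c (σ.pull i.succAbove)
  map_add' c c' := by
    ext σ
    simp [mul_add, Finset.sum_add_distrib]
  map_smul' r c := by
    ext σ
    simp only [Pi.smul_apply, smul_eq_mul, RingHom.id_apply, Finset.mul_sum]
    exact Finset.sum_congr rfl fun _ _ => by ring

/-- The cocycles of degree `n`. -/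
def cocycles (X : Type u) [TopologicalSpace X] (n : ℕ) : Submodule ℚ (Cochain X n) :=
  LinearMap.ker (coboundary X n)

/-- The coboundaries of degree `n`. -/
def coboundaries (X : Type u) [TopologicalSpace X] : (n : ℕ) → Submodule ℚ (Cochain X n)
  | 0 => ⊥
  | n + 1 => LinearMap.range (coboundary X n)

/-- The singular cohomology group `H^n(X; ℚ)`. -/
abbrev H (X : Type u) [TopologicalSpace X] (n : ℕ) : Type u :=
  cocycles X n ⧸ (coboundaries X n).submoduleOf (cocycles X n)

/-! Functoriality -/

/-- The map of cochains induced by a continuous map. -/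
def cochainMap {X : Type u} {Y : Type v} [TopologicalSpace X] [TopologicalSpace Y]
    (f : C(X, Y)) (n : ℕ) : Cochain Y n →ₗ[ℚ] Cochain X n where
  toFun c σ := c (f.comp σ)
  map_add' _ _ := rfl
  map_smul' _ _ := rfl

theorem cochainMap_coboundary {X : Type u} {Y : Type v} [TopologicalSpace X] [TopologicalSpace Y]
    (f : C(X, Y)) (n : ℕ) (c : Cochain Y n) :
    cochainMap f (n + 1) (coboundary Y n c) = coboundary X n (cochainMap f n c) := rfl

theorem cochainMap_mem_cocycles {X : Type u} {Y : Type v} [TopologicalSpace X]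
    [TopologicalSpace Y] (f : C(X, Y)) (n : ℕ) (c : Cochain Y n) (hc : c ∈ cocycles Y n) :
    cochainMap f n c ∈ cocycles X n := by
  have h : coboundary Y n c = 0 := hc
  change coboundary X n (cochainMap f n c) = 0
  rw [← cochainMap_coboundary, h, map_zero]

theorem cochainMap_mem_coboundaries {X : Type u} {Y : Type v} [TopologicalSpace X]
    [TopologicalSpace Y] (f : C(X, Y)) (n : ℕ) (c : Cochain Y n) (hc : c ∈ coboundaries Y n) :
    cochainMap f n c ∈ coboundaries X n := by
  cases n with
  | zero =>
    have h : c = 0 := hc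
    rw [h, map_zero]
    exact Submodule.zero_mem _
  | succ n =>
    obtain ⟨w, rfl⟩ := hc
    exact ⟨cochainMap f n w, rfl⟩

/-- The map `f^* : H^n(Y; ℚ) → H^n(X; ℚ)` induced by a continuous map `f : X → Y`. -/
def pullback {X : Type u} {Y : Type v} [TopologicalSpace X] [TopologicalSpace Y]
    (f : C(X, Y)) (n : ℕ) : H Y n →ₗ[ℚ] H X n :=
  Submodule.mapQ _ _
    ((cochainMap f n).restrict (p := cocycles Y n) (q := cocycles X n)
      (cochainMap_mem_cocycles f n))
    (fun c hc => cochainMap_mem_coboundaries f n c hc)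

/-! Cup product -/

/-- The front `m`-face: the vertices `0, …, m` among `0, …, N`. -/
def front {m N : ℕ} (h : m ≤ N) (i : Fin (m + 1)) : Fin (N + 1) := ⟨i, by omega⟩

/-- The back `n`-face: the vertices `m, …, m + n` where `m + n = N`. -/
def back {m n N : ℕ} (h : m + n = N) (i : Fin (n + 1)) : Fin (N + 1) := ⟨m + i, by omega⟩

/-- The cup product of cochains,
`(a ∪ b)(σ) = a (σ restricted to [0, …, m]) * b (σ restricted to [m, …, m + n])`. -/
def cochainCup {X : Type u} [TopologicalSpace X] {m n : ℕ} (a : Cochain X m) (b : Cochain X n) :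
    Cochain X (m + n) :=
  fun σ => a (σ.pull (front (Nat.le_add_right m n))) * b (σ.pull (back rfl))

theorem coboundary_cochainCup {X : Type u} [TopologicalSpace X] {m n : ℕ} (a : Cochain X m)
    (b : Cochain X n) (σ : Simplex X (m + n + 1)) :
    coboundary X (m + n) (cochainCup a b) σ =
      coboundary X m a (σ.pull (front (by omega))) *
          b (σ.pull (back (m := m + 1) (n := n) (by omega))) +
        (-1) ^ m * (a (σ.pull (front (by omega))) *
          coboundary X n b (σ.pull (back (m := m) (n := n + 1) (by omega)))) := by
  have hN : m + 1 + (n + 1) = m + n + 1 + 1 := by omega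
  simp only [coboundary, cochainCup, LinearMap.coe_mk, AddHom.coe_mk, Simplex.pull_pull]
  rw [← (finCongr hN).sum_comp, Fin.sum_univ_add, Fin.sum_univ_castSucc (n := m + 1),
    Fin.sum_univ_succ (n := n + 1), add_mul, Finset.sum_mul, mul_add, mul_add, Finset.mul_sum,
    Finset.mul_sum]
  have h1 : ∀ i : Fin (m + 1),
      (finCongr hN (Fin.castAdd (n + 1) i)).succAbove ∘ front (Nat.le_add_right m n) =
        front (by omega) ∘ (Fin.castSucc i).succAbove := by
    intro i
    ext k
    simp only [Function.comp_apply, front, Fin.succAbove, Fin.lt_def, finCongr_apply,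
      Fin.val_castSucc, Fin.val_cast, Fin.val_castAdd]
    split_ifs <;> simp
  have h2 : ∀ i : Fin (m + 1),
      (finCongr hN (Fin.castAdd (n + 1) i)).succAbove ∘ back (m := m) (n := n) rfl =
        back (m := m + 1) (n := n) (by omega) := by
    intro i
    ext k
    simp only [Function.comp_apply, back, Fin.succAbove, Fin.lt_def, finCongr_apply,
      Fin.val_castSucc, Fin.val_cast, Fin.val_castAdd]
    split_ifs <;> simp <;> omega
  have h3 : ∀ j : Fin (n + 1),
      (finCongr hN (Fin.natAdd (m + 1) j)).succAbove ∘ front (Nat.le_add_right m n) =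
        front (by omega) := by
    intro j
    ext k
    simp only [Function.comp_apply, front, Fin.succAbove, Fin.lt_def, finCongr_apply,
      Fin.val_castSucc, Fin.val_cast, Fin.val_natAdd]
    split_ifs <;> simp <;> omega
  have h4 : ∀ j : Fin (n + 1),
      (finCongr hN (Fin.natAdd (m + 1) j)).succAbove ∘ back (m := m) (n := n) rfl =
        back (m := m) (n := n + 1) (by omega) ∘ j.succ.succAbove := by
    intro j
    ext k
    simp only [Function.comp_apply, back, Fin.succAbove, Fin.lt_def, finCongr_apply,
      Fin.val_castSucc, Fin.val_cast, Fin.val_natAdd, Fin.val_succ]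
    split_ifs <;> simp <;> omega
  have h5 : front (m := m + 1) (N := m + n + 1) (by omega) ∘ (Fin.last (m + 1)).succAbove =
      front (by omega) := by
    ext k
    simp [front]
  have h6 : back (m := m) (n := n + 1) (N := m + n + 1) (by omega) ∘
      (0 : Fin (n + 2)).succAbove = back (m := m + 1) (n := n) (by omega) := by
    ext k
    simp [back]
    omega
  simp only [h1, h2, h3, h4, h5, h6]
  simp only [finCongr_apply, Fin.val_cast, Fin.val_castAdd, Fin.val_natAdd, Fin.val_castSucc,
    Fin.val_last, Fin.val_succ, Fin.val_zero]
  have e1 : ∀ x y z : ℚ, x * (y * z) = x * y * z := fun x y z => (mul_assoc x y z).symm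
  have e2 : ∀ (j : ℕ) (x y : ℚ),
      (-1) ^ (m + 1 + j) * (x * y) = (-1) ^ m * (x * ((-1) ^ (j + 1) * y)) := by
    intro j x y
    ring
  simp only [e2]
  simp only [e1]
  ring

/-- A criterion for a cochain to be a coboundary, for degrees that agree only propositionally. -/
theorem mem_coboundaries_of_eq {X : Type u} [TopologicalSpace X] {k N : ℕ} (h : k + 1 = N)
    (c : Cochain X N) (w : Cochain X k)
    (hc : ∀ σ : Simplex X N, c σ = coboundary X k w (σ.pull (Fin.cast (by omega)))) :
    c ∈ coboundaries X N := by
  subst h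
  refine ⟨w, ?_⟩
  ext σ
  rw [hc]
  have h : σ.pull (Fin.cast rfl) = σ :=
    ContinuousMap.ext fun x => congrArg σ (stdSimplex.map_id_apply x)
  rw [h]

theorem cochainCup_mem_cocycles {X : Type u} [TopologicalSpace X] {m n : ℕ} {a : Cochain X m}
    {b : Cochain X n} (ha : a ∈ cocycles X m) (hb : b ∈ cocycles X n) :
    cochainCup a b ∈ cocycles X (m + n) := by
  have ha' : coboundary X m a = 0 := ha
  have hb' : coboundary X n b = 0 := hb
  change coboundary X (m + n) (cochainCup a b) = 0
  ext σ
  rw [coboundary_cochainCup, ha', hb']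
  simp

theorem cochainCup_mem_coboundaries_left {X : Type u} [TopologicalSpace X] {m n : ℕ}
    {a : Cochain X m} {b : Cochain X n} (ha : a ∈ coboundaries X m) (hb : b ∈ cocycles X n) :
    cochainCup a b ∈ coboundaries X (m + n) := by
  have hb' : coboundary X n b = 0 := hb
  cases m with
  | zero =>
    have ha' : a = 0 := ha
    have h0 : cochainCup a b = 0 := by
      ext σ
      simp [cochainCup, ha']
    rw [h0]
    exact Submodule.zero_mem _
  | succ k =>
    obtain ⟨w, rfl⟩ := ha
    refine mem_coboundaries_of_eq (k := k + n) (by omega) _ (cochainCup w b) fun σ => ?_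
    rw [coboundary_cochainCup, hb']
    simp only [cochainCup, Simplex.pull_pull, Pi.zero_apply, mul_zero, add_zero]
    rfl

theorem cochainCup_mem_coboundaries_right {X : Type u} [TopologicalSpace X] {m n : ℕ}
    {a : Cochain X m} {b : Cochain X n} (ha : a ∈ cocycles X m) (hb : b ∈ coboundaries X n) :
    cochainCup a b ∈ coboundaries X (m + n) := by
  have ha' : coboundary X m a = 0 := ha
  cases n with
  | zero =>
    have hb' : b = 0 := hb
    have h0 : cochainCup a b = 0 := by
      ext σ
      simp [cochainCup, hb']
    rw [h0]
    exact Submodule.zero_mem _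
  | succ k =>
    obtain ⟨w, rfl⟩ := hb
    refine ⟨((-1 : ℚ) ^ m) • (cochainCup a w : Cochain X (m + k)), ?_⟩
    change coboundary X (m + k) (((-1 : ℚ) ^ m) • cochainCup a w) = _
    ext σ
    rw [map_smul, Pi.smul_apply, coboundary_cochainCup, ha', smul_eq_mul, Pi.zero_apply, zero_mul,
      zero_add, ← mul_assoc, ← mul_pow]
    simp only [mul_neg, mul_one, neg_neg, one_pow, one_mul]
    rfl

/-- The cup product of cocycles, as a bilinear map to cohomology. -/
def cocycleCup (X : Type u) [TopologicalSpace X] (m n : ℕ) :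
    cocycles X m →ₗ[ℚ] cocycles X n →ₗ[ℚ] H X (m + n) :=
  LinearMap.mk₂ ℚ
    (fun a b => Submodule.Quotient.mk
      ⟨cochainCup a.1 b.1, cochainCup_mem_cocycles a.2 b.2⟩)
    (fun a a' b => by
      rw [← Submodule.Quotient.mk_add]
      congr 1
      ext σ
      exact add_mul _ _ _)
    (fun r a b => by
      rw [← Submodule.Quotient.mk_smul]
      congr 1
      ext σ
      exact mul_assoc _ _ _)
    (fun a b b' => by
      rw [← Submodule.Quotient.mk_add]
      congr 1
      ext σ
      exact mul_add _ _ _)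
    (fun r a b => by
      rw [← Submodule.Quotient.mk_smul]
      congr 1
      ext σ
      exact mul_left_comm _ _ _)

theorem cocycleCup_left_eq_zero {X : Type u} [TopologicalSpace X] (m n : ℕ) (a : cocycles X m)
    (ha : a.1 ∈ coboundaries X m) (b : cocycles X n) : cocycleCup X m n a b = 0 :=
  (Submodule.Quotient.mk_eq_zero _).mpr (cochainCup_mem_coboundaries_left ha b.2)

theorem cocycleCup_right_eq_zero {X : Type u} [TopologicalSpace X] (m n : ℕ) (a : cocycles X m)
    (b : cocycles X n) (hb : b.1 ∈ coboundaries X n) : cocycleCup X m n a b = 0 :=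
  (Submodule.Quotient.mk_eq_zero _).mpr (cochainCup_mem_coboundaries_right a.2 hb)

/-- The cup product `H^m(X; ℚ) × H^n(X; ℚ) → H^{m+n}(X; ℚ)`. -/
def cup (X : Type u) [TopologicalSpace X] (m n : ℕ) : H X m →ₗ[ℚ] H X n →ₗ[ℚ] H X (m + n) :=
  Submodule.liftQ _
    (Submodule.liftQ _ (cocycleCup X m n).flip (fun b hb => by
      refine LinearMap.mem_ker.mpr (LinearMap.ext fun a => ?_)
      exact cocycleCup_right_eq_zero m n a b hb)).flip
    (fun a ha => by
      refine LinearMap.mem_ker.mpr (LinearMap.ext fun β => ?_)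
      obtain ⟨b, rfl⟩ := Submodule.Quotient.mk_surjective _ β
      exact cocycleCup_left_eq_zero m n a ha b)

theorem cup_mk (X : Type u) [TopologicalSpace X] (m n : ℕ) (a : cocycles X m)
    (b : cocycles X n) :
    cup X m n (Submodule.Quotient.mk a) (Submodule.Quotient.mk b) =
      Submodule.Quotient.mk ⟨cochainCup a.1 b.1, cochainCup_mem_cocycles a.2 b.2⟩ := rfl

/-- The total cohomology `H^*(X; ℚ)`. -/
abbrev HTotal (X : Type u) [TopologicalSpace X] : Type u := ⨁ n : ℕ, H X n

end SingularCohomology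

/-! ### Maps that are locally trivial in the orbifold sense -/

/-- A local trivialization at `b`, in the orbifold sense and with fibre `F`, of a map `p : M → B`:
a neighbourhood `V` of `b`, a Hausdorff and locally contractible space `U` and a finite group `G`
acting on `U` and on `F`, the latter by homeomorphisms homotopic to the identity, with compatible
homeomorphisms `U / G ≃ V` and `(U × F) / G ≃ p⁻¹ V`, and a point `center` of `U` over `b` that is
fixed by `G` (so that `F / G` is the fibre of `p` over `b`). -/
structure OrbifoldTrivialization {M : Type uM} {B : Type uB}
    [TopologicalSpace M] [TopologicalSpace B] (p : C(M, B)) (F : Type uF) [TopologicalSpace F]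
    (b : B) where
  /-- The neighbourhood of `b`. -/
  V : Set B
  V_mem_nhds : V ∈ 𝓝 b
  /-- The space that uniformizes `V`. -/
  U : Type uU
  [topU : TopologicalSpace U]
  [t2U : T2Space U]
  locallyContractible : LocallyContractibleSpace U
  /-- The local group. -/
  G : Type uG
  [groupG : Group G]
  [finiteG : Finite G]
  [actionU : MulAction G U]
  [continuousU : ContinuousConstSMul G U]
  [actionF : MulAction G F]
  [continuousF : ContinuousConstSMul G F]
  homotopic_id : ∀ g : G,
    ContinuousMap.Homotopic ⟨fun x : F => g • x, continuous_const_smul g⟩ (ContinuousMap.id F)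
  /-- The homeomorphism `U / G ≃ V`. -/
  baseHomeo : MulAction.orbitRel.Quotient G U ≃ₜ V
  /-- The homeomorphism `(U × F) / G ≃ p⁻¹ V`, for the product action. -/
  totalHomeo : MulAction.orbitRel.Quotient G (U × F) ≃ₜ (p ⁻¹' V : Set M)
  compatible : ∀ (u : U) (x : F),
    p (totalHomeo (Quotient.mk _ (u, x))).1 = (baseHomeo (Quotient.mk _ u)).1
  /-- The point of `U` over `b`. -/
  center : U
  smul_center : ∀ g : G, g • center = center
  baseHomeo_center : (baseHomeo (Quotient.mk _ center)).1 = b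

namespace OrbifoldTrivialization

variable {M : Type uM} {B : Type uB} {F : Type uF} [TopologicalSpace M] [TopologicalSpace B]
  [TopologicalSpace F] {p : C(M, B)} {b : B}

attribute [instance] topU t2U groupG finiteG actionU continuousU actionF continuousF

/-- The orbifold fibre inclusion `r_b : F → F / G ≃ p⁻¹ b ⊆ M`. -/
def fibreInclusion (T : OrbifoldTrivialization.{uM, uB, uF, uU, uG} p F b) : C(F, M) where
  toFun x := (T.totalHomeo (Quotient.mk _ (T.center, x))).1
  continuous_toFun := continuous_subtype_val.comp (T.totalHomeo.continuous.comp
    (continuous_quotient_mk'.comp (Continuous.prodMk_right T.center)))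

theorem range_fibreInclusion (T : OrbifoldTrivialization.{uM, uB, uF, uU, uG} p F b) :
    Set.range T.fibreInclusion = p ⁻¹' {b} := by
  ext y
  constructor
  · rintro ⟨x, rfl⟩
    exact (T.compatible T.center x).trans T.baseHomeo_center
  · intro hy
    have hyb : p y = b := hy
    have hV : y ∈ p ⁻¹' T.V := by
      change p y ∈ T.V
      rw [hyb]
      exact mem_of_mem_nhds T.V_mem_nhds
    obtain ⟨q, hq⟩ := T.totalHomeo.surjective ⟨y, hV⟩
    induction q using Quotient.inductionOn with
    | h z =>
      obtain ⟨u, x⟩ := z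
      have h1 : (T.baseHomeo (Quotient.mk _ u)).1 = (T.baseHomeo (Quotient.mk _ T.center)).1 := by
        rw [← T.compatible u x, hq, T.baseHomeo_center]
        exact hyb
      have h2 := T.baseHomeo.injective (Subtype.ext h1)
      obtain ⟨g, hg⟩ : ∃ g : T.G, g • T.center = u := Quotient.exact h2
      rw [T.smul_center] at hg
      subst hg
      exact ⟨x, congrArg Subtype.val hq⟩

/-- Two points of `F` have the same image under `r_b` if and only if they are in the same orbit. -/
theorem fibreInclusion_eq_iff (T : OrbifoldTrivialization.{uM, uB, uF, uU, uG} p F b) (x y : F) :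
    T.fibreInclusion x = T.fibreInclusion y ↔ ∃ g : T.G, g • y = x := by
  constructor
  · intro h
    have h2 := T.totalHomeo.injective (Subtype.ext h)
    obtain ⟨g, hg⟩ : ∃ g : T.G, g • (T.center, y) = (T.center, x) := Quotient.exact h2
    exact ⟨g, congrArg Prod.snd hg⟩
  · rintro ⟨g, rfl⟩
    have h : (Quotient.mk _ (T.center, g • y) : MulAction.orbitRel.Quotient T.G (T.U × F)) =
        Quotient.mk _ (T.center, y) :=
      Quotient.sound ⟨g, Prod.ext (T.smul_center g) rfl⟩
    exact congrArg (fun q => (T.totalHomeo q).1) h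

end OrbifoldTrivialization

end

/-!
The proof compares chains rather than cochains, over open subsets `W` of the base.

Choose cocycles `e i` that represent the given classes. The map `theta` sends a singular chain `x`
of `M` to the family of the chains `p_* (x ∩ e i)` of `B`, in degrees shifted by the degrees of the
`e i`. It is a chain map, compatible with the restriction of supports to open subsets of `B`, and
it is the transpose of the map `lerayHirsch` that sends the family `a i` to
`∑ i, p^* (a i) ∪ [e i]`. As the coefficients form a field, a cohomology class is determined by its
values on cycles, and `lerayHirsch` is bijective if the mapping cone of `theta` is acyclic
(`lerayHirsch_bijective`).

The acyclicity of the cone is a local question. A `LocalComplex` is a family of complexes of chains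
supported in open sets that is compatible with intersections, satisfies Mayer–Vietoris (`small`, for
singular chains by iterated barycentric subdivision) and has compact supports. If near every point
each cycle becomes a boundary in a given larger neighbourhood, then the complex is acyclic
(`LocalComplex.acyclic`). This is proved by induction on the degree: a cycle in the union of two
open sets is a sum of chains in the two, up to a boundary, and the common boundary of these chains
bounds in the intersection, because there it is a cycle of lower degree. So the cycle is a sum of
cycles in the two open sets, and finitely many open sets suffice by compactness. The intersections
are arbitrary open sets, for which the induction hypothesis holds as well; hence no good covers and
no paracompactness are needed.

It remains to compare `M` and `B` near a point `b`. The base is locally contractible, so that near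
`b` cycles of positive degree bound. Cycles of `M` near the fibre over `b` come from cycles of `F`
up to homology (`exists_nhds_cycle_from_fibre`). Indeed `p⁻¹ V_b` is the quotient of `U_b × F` by a
finite group `G`. Every cycle in an open set of the quotient lifts, up to boundaries, to a cycle
upstairs (`exists_cycle_lift`): by the local acyclicity criterion on the quotient, the singular
chains of the quotient are compared with the `G`-invariant singular chains upstairs, locally around
the orbit of a point, and averaging over `G` makes chains invariant. Upstairs, the contraction of
`U_b` to the fixed point moves the cycle to the fibre. As the classes `e i` restrict to a basis of
the cohomology of `F`, a cycle of `F` bounds if the `e i` vanish on it, and there are cycles on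
which the `e i` have prescribed values, which gives injectivity and surjectivity of `theta` near
`b`.
-/


/-! ### Chains on tuples -/

/-- Rational chains on the tuples (of arbitrary length, the empty tuple included) of elements of
`V`: the augmented ordered chain complex of the full simplex on the vertex set `V`, all degrees
together. -/
abbrev TupleChain (V : Type*) : Type _ := (Σ m : ℕ, Fin m → V) →₀ ℚ

namespace TupleChain

variable {V V' : Type*}

/-- The tuple `t`, as a chain. -/
noncomputable abbrev of {m : ℕ} (t : Fin m → V) : TupleChain V := Finsupp.single ⟨m, t⟩ 1

/-- Linear extension of a function on tuples. -/
noncomputable abbrev lift {A : Type*} [AddCommGroup A] [Module ℚ A]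
    (φ : ∀ m : ℕ, (Fin m → V) → A) : TupleChain V →ₗ[ℚ] A :=
  Finsupp.linearCombination ℚ fun s : Σ m : ℕ, Fin m → V => φ s.1 s.2

theorem lift_of {A : Type*} [AddCommGroup A] [Module ℚ A]
    (φ : ∀ m : ℕ, (Fin m → V) → A) {m : ℕ} (t : Fin m → V) : lift φ (of t) = φ m t := by
  simp [lift, of]

theorem hom_ext {A : Type*} [AddCommGroup A] [Module ℚ A] {f g : TupleChain V →ₗ[ℚ] A}
    (h : ∀ (m : ℕ) (t : Fin m → V), f (of t) = g (of t)) : f = g := by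
  refine Finsupp.lhom_ext' fun ⟨m, t⟩ => LinearMap.ext_ring ?_
  exact h m t

/-- The boundary of a tuple. -/
noncomputable def boundaryAux : (m : ℕ) → (Fin m → V) → TupleChain V
  | 0, _ => 0
  | m + 1, t => ∑ i : Fin (m + 1), (-1 : ℚ) ^ (i : ℕ) • of (t ∘ i.succAbove)

/-- The boundary operator; the boundary of a tuple of length one is the empty tuple, and that of
the empty tuple is zero. -/
noncomputable def d : TupleChain V →ₗ[ℚ] TupleChain V := lift boundaryAux

theorem d_of_succ {m : ℕ} (t : Fin (m + 1) → V) :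
    d (of t) = ∑ i : Fin (m + 1), (-1 : ℚ) ^ (i : ℕ) • of (t ∘ i.succAbove) := lift_of _ _

theorem d_of_zero (t : Fin 0 → V) : d (of t) = 0 := lift_of _ _

/-- The cone operator, which prepends the vertex `v`. -/
noncomputable def cone (v : V) : TupleChain V →ₗ[ℚ] TupleChain V :=
  lift fun m t => of (Fin.cons v t : Fin (m + 1) → V)

theorem cone_of (v : V) {m : ℕ} (t : Fin m → V) :
    cone v (of t) = of (Fin.cons v t : Fin (m + 1) → V) :=
  lift_of (fun m t => of (Fin.cons v t : Fin (m + 1) → V)) t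

theorem d_cone_of (v : V) {m : ℕ} (t : Fin m → V) :
    d (cone v (of t)) = of t - cone v (d (of t)) := by
  rw [cone_of, d_of_succ, Fin.sum_univ_succ]
  have h0 : (Fin.cons v t : Fin (m + 1) → V) ∘ (0 : Fin (m + 1)).succAbove = t := by
    ext i; simp
  rw [h0]
  cases m with
  | zero => simp [d_of_zero]
  | succ m =>
    rw [d_of_succ, map_sum, sub_eq_add_neg, ← Finset.sum_neg_distrib]
    simp only [Fin.val_zero, pow_zero, one_smul]
    congr 1
    refine Finset.sum_congr rfl fun i _ => ?_
    rw [map_smul, cone_of, ← neg_smul, Fin.val_succ, pow_succ, mul_neg_one]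
    congr 2
    have : (Fin.cons v t : Fin (m + 2) → V) ∘ i.succ.succAbove = Fin.cons v (t ∘ i.succAbove) := by
      ext j
      refine Fin.cases ?_ (fun k => ?_) j <;> simp
    rw [this]

theorem d_cone (v : V) (c : TupleChain V) : d (cone v c) = c - cone v (d c) := by
  have : d ∘ₗ cone v = LinearMap.id - cone v ∘ₗ d := hom_ext fun m t => d_cone_of v t
  exact LinearMap.congr_fun this c

theorem of_succ_eq_cone {m : ℕ} (t : Fin (m + 1) → V) :
    of t = cone (t 0) (of (Fin.tail t)) := by
  rw [cone_of, Fin.cons_self_tail]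

theorem d_of_cons {m : ℕ} (t : Fin (m + 1) → V) :
    d (of t) = of (Fin.tail t) - cone (t 0) (d (of (Fin.tail t))) := by
  rw [of_succ_eq_cone, d_cone]

theorem d_d (c : TupleChain V) : d (d c) = 0 := by
  suffices h : d ∘ₗ d = (0 : TupleChain V →ₗ[ℚ] TupleChain V) from LinearMap.congr_fun h c
  refine hom_ext fun m t => ?_
  simp only [LinearMap.comp_apply, LinearMap.zero_apply]
  induction m with
  | zero => rw [d_of_zero, map_zero]
  | succ m ih => rw [d_of_cons, map_sub, d_cone, ih, map_zero, sub_zero, sub_self]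

/-- The map of chains induced by a map of vertices. -/
noncomputable def map (f : V → V') : TupleChain V →ₗ[ℚ] TupleChain V' :=
  lift fun _ t => of (f ∘ t)

theorem map_of (f : V → V') {m : ℕ} (t : Fin m → V) : map f (of t) = of (f ∘ t) :=
  lift_of (fun _ t => of (f ∘ t)) t

theorem map_cone (f : V → V') (v : V) (c : TupleChain V) :
    map f (cone v c) = cone (f v) (map f c) := by
  suffices h : map f ∘ₗ cone v = cone (f v) ∘ₗ map f from LinearMap.congr_fun h c
  refine hom_ext fun m t => ?_
  simp only [LinearMap.comp_apply, cone_of, map_of]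
  rw [Fin.comp_cons]

theorem map_d (f : V → V') (c : TupleChain V) : map f (d c) = d (map f c) := by
  suffices h : map f ∘ₗ d = d ∘ₗ map f from LinearMap.congr_fun h c
  refine hom_ext fun m t => ?_
  cases m with
  | zero => simp only [LinearMap.comp_apply, map_of, d_of_zero, map_zero]
  | succ m => simp only [LinearMap.comp_apply, map_of, d_of_succ, map_sum, map_smul]; rfl

/-- The chains on tuples of length `m`. -/
noncomputable abbrev ofLength (V : Type*) (m : ℕ) : Submodule ℚ (TupleChain V) :=
  Finsupp.supported ℚ ℚ {s | s.1 = m}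

theorem of_mem_ofLength {m : ℕ} (t : Fin m → V) : of t ∈ ofLength V m :=
  Finsupp.single_mem_supported _ _ rfl

theorem supported_induction {α : Type*} {A : Type*} [AddCommGroup A] [Module ℚ A] {s : Set α}
    (f : (α →₀ ℚ) →ₗ[ℚ] A) (N : Submodule ℚ A)
    (h : ∀ a ∈ s, f (Finsupp.single a 1) ∈ N) {c : α →₀ ℚ}
    (hc : c ∈ Finsupp.supported ℚ ℚ s) : f c ∈ N := by
  rw [Finsupp.supported_eq_span_single] at hc
  have : Submodule.span ℚ ((fun i => Finsupp.single i (1 : ℚ)) '' s) ≤ N.comap f := by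
    rw [Submodule.span_le]
    rintro _ ⟨a, ha, rfl⟩
    exact h a ha
  exact this hc

theorem cone_mem_ofLength (v : V) {m : ℕ} {c : TupleChain V} (hc : c ∈ ofLength V m) :
    cone v c ∈ ofLength V (m + 1) := by
  refine supported_induction _ _ ?_ hc
  rintro ⟨k, t⟩ rfl
  change cone v (of t) ∈ _
  rw [cone_of]
  exact of_mem_ofLength _

/-! ### The prism operator -/

/-- The value of the prism operator on a tuple. -/
noncomputable def prismAux (a b : V → V') : (m : ℕ) → (Fin m → V) → TupleChain V'
  | 0, _ => 0
  | m + 1, t => cone (a (t 0)) (of (b ∘ t) - prismAux a b m (Fin.tail t))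

/-- The prism operator, a chain homotopy between the maps of chains induced by two maps of
vertices. -/
noncomputable def prism (a b : V → V') : TupleChain V →ₗ[ℚ] TupleChain V' := lift (prismAux a b)

theorem prism_of_zero (a b : V → V') (t : Fin 0 → V) : prism a b (of t) = 0 := lift_of _ _

theorem prism_of_succ (a b : V → V') {m : ℕ} (t : Fin (m + 1) → V) :
    prism a b (of t) = cone (a (t 0)) (map b (of t) - prism a b (of (Fin.tail t))) := by
  simp only [prism, lift_of, map_of]
  rfl

theorem prism_cone (a b : V → V') (v : V) (c : TupleChain V) :
    prism a b (cone v c) = cone (a v) (map b (cone v c) - prism a b c) := by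
  suffices h : prism a b ∘ₗ cone v = cone (a v) ∘ₗ (map b ∘ₗ cone v - prism a b) from
    LinearMap.congr_fun h c
  refine hom_ext fun m t => ?_
  simp only [LinearMap.comp_apply, LinearMap.sub_apply]
  rw [cone_of, prism_of_succ, Fin.tail_cons, Fin.cons_zero]

theorem d_prism (a b : V → V') (c : TupleChain V) :
    d (prism a b c) + prism a b (d c) = map b c - map a c := by
  suffices h : d ∘ₗ prism a b + prism a b ∘ₗ d = map b - map a from LinearMap.congr_fun h c
  refine hom_ext fun m t => ?_
  simp only [LinearMap.comp_apply, LinearMap.add_apply, LinearMap.sub_apply]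
  induction m with
  | zero =>
    rw [prism_of_zero, d_of_zero, map_zero, map_zero, map_of, map_of, add_zero, eq_comm,
      sub_eq_zero, Subsingleton.elim (b ∘ t) (a ∘ t)]
  | succ m ih =>
    specialize ih (Fin.tail t)
    set s := Fin.tail t
    have hb : map b (d (of t)) = map b (of s) - cone (b (t 0)) (map b (d (of s))) := by
      rw [d_of_cons, map_sub, map_cone]
    rw [prism_of_succ, d_cone, d_of_cons, map_sub (prism a b), prism_cone, map_sub d, ← map_d, hb]
    rw [eq_sub_iff_add_eq] at ih
    have ha : map a (of t) = cone (a (t 0)) (map a (of s)) := by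
      rw [of_succ_eq_cone, map_cone]
    have ih' : map a (of s) = map b (of s) - (d (prism a b (of s)) + prism a b (d (of s))) := by
      rw [← ih]; abel
    rw [ha, ih', map_cone]
    simp only [map_sub, map_add]
    abel

theorem prism_map {U : Type*} (a b : V → V') (f : U → V) (c : TupleChain U) :
    prism a b (map f c) = prism (a ∘ f) (b ∘ f) c := by
  suffices h : prism a b ∘ₗ map f = prism (a ∘ f) (b ∘ f) from LinearMap.congr_fun h c
  refine hom_ext fun m t => ?_
  simp only [LinearMap.comp_apply, map_of]
  induction m with
  | zero => simp only [prism_of_zero]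
  | succ m ih =>
    rw [prism_of_succ, prism_of_succ, map_of, map_of, ← ih (Fin.tail t)]
    rfl

theorem map_prism {U : Type*} (a b : V → V') (f : V' → U) (c : TupleChain V) :
    map f (prism a b c) = prism (f ∘ a) (f ∘ b) c := by
  suffices h : map f ∘ₗ prism a b = prism (f ∘ a) (f ∘ b) from LinearMap.congr_fun h c
  refine hom_ext fun m t => ?_
  simp only [LinearMap.comp_apply]
  induction m with
  | zero => simp only [prism_of_zero, map_zero]
  | succ m ih =>
    rw [prism_of_succ, prism_of_succ, map_cone, map_sub, ih (Fin.tail t), map_of, map_of, map_of]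
    rfl

theorem prism_of_mem_ofLength (a b : V → V') {m : ℕ} (t : Fin m → V) :
    prism a b (of t) ∈ ofLength V' (m + 1) := by
  induction m with
  | zero => rw [prism_of_zero]; exact Submodule.zero_mem _
  | succ m ih =>
    rw [prism_of_succ, map_of]
    exact cone_mem_ofLength _ (Submodule.sub_mem _ (of_mem_ofLength _) (ih _))

/-! ### Barycentric subdivision of tuples -/

/-- The barycentric subdivision of a tuple, for a choice `β` of a barycenter of every tuple. -/
noncomputable def sdAux (β : ∀ m : ℕ, (Fin (m + 1) → V) → V) :
    (m : ℕ) → (Fin m → V) → TupleChain V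
  | 0, t => of t
  | m + 1, t => cone (β m t) (∑ i : Fin (m + 1), (-1 : ℚ) ^ (i : ℕ) • sdAux β m (t ∘ i.succAbove))

/-- The barycentric subdivision operator, for a choice `β` of a barycenter of every tuple. -/
noncomputable def sd (β : ∀ m : ℕ, (Fin (m + 1) → V) → V) : TupleChain V →ₗ[ℚ] TupleChain V :=
  lift (sdAux β)

variable (β : ∀ m : ℕ, (Fin (m + 1) → V) → V)

theorem sd_of_zero (t : Fin 0 → V) : sd β (of t) = of t := lift_of _ _

theorem sd_of_succ {m : ℕ} (t : Fin (m + 1) → V) :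
    sd β (of t) = cone (β m t) (sd β (d (of t))) := by
  rw [d_of_succ, map_sum]
  simp only [map_smul, sd, lift_of]
  rfl

theorem d_sd (c : TupleChain V) : d (sd β c) = sd β (d c) := by
  suffices h : d ∘ₗ sd β = sd β ∘ₗ d from LinearMap.congr_fun h c
  refine hom_ext fun m t => ?_
  simp only [LinearMap.comp_apply]
  induction m with
  | zero => rw [sd_of_zero, d_of_zero, map_zero]
  | succ m ih =>
    have h : d (sd β (d (of t))) = sd β (d (d (of t))) := by
      rw [d_of_succ]; simp only [map_sum, map_smul, ih]
    rw [sd_of_succ, d_cone, h, d_d, map_zero, map_zero, sub_zero]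

/-- The value on a tuple of the homotopy from the subdivision operator to the identity. -/
noncomputable def sdHomotopyAux (β : ∀ m : ℕ, (Fin (m + 1) → V) → V) :
    (m : ℕ) → (Fin m → V) → TupleChain V
  | 0, _ => 0
  | m + 1, t => cone (β m t) (of t -
      ∑ i : Fin (m + 1), (-1 : ℚ) ^ (i : ℕ) • sdHomotopyAux β m (t ∘ i.succAbove))

/-- The chain homotopy from the subdivision operator to the identity. -/
noncomputable def sdHomotopy : TupleChain V →ₗ[ℚ] TupleChain V := lift (sdHomotopyAux β)

theorem sdHomotopy_of_zero (t : Fin 0 → V) : sdHomotopy β (of t) = 0 := lift_of _ _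

theorem sdHomotopy_of_succ {m : ℕ} (t : Fin (m + 1) → V) :
    sdHomotopy β (of t) = cone (β m t) (of t - sdHomotopy β (d (of t))) := by
  rw [d_of_succ, map_sum]
  simp only [map_smul, sdHomotopy, lift_of]
  rfl

theorem d_sdHomotopy (c : TupleChain V) :
    d (sdHomotopy β c) + sdHomotopy β (d c) = c - sd β c := by
  suffices h : d ∘ₗ sdHomotopy β + sdHomotopy β ∘ₗ d = LinearMap.id - sd β from
    LinearMap.congr_fun h c
  refine hom_ext fun m t => ?_
  simp only [LinearMap.comp_apply, LinearMap.add_apply, LinearMap.sub_apply, LinearMap.id_apply]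
  induction m with
  | zero => rw [sdHomotopy_of_zero, d_of_zero, map_zero, map_zero, sd_of_zero, sub_self, add_zero]
  | succ m ih =>
    have h : d (sdHomotopy β (d (of t))) = d (of t) - sd β (d (of t)) := by
      have h' : d (sdHomotopy β (d (of t))) + sdHomotopy β (d (d (of t))) =
          d (of t) - sd β (d (of t)) := by
        rw [d_of_succ]
        simp only [map_sum, map_smul, ← Finset.sum_add_distrib, ← Finset.sum_sub_distrib,
          ← smul_add, ← smul_sub, ih]
      rwa [d_d, map_zero, add_zero] at h'
    rw [sdHomotopy_of_succ, d_cone, map_sub d, h, sub_sub_cancel, sd_of_succ]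
    abel

section Natural

variable {β} {β' : ∀ m : ℕ, (Fin (m + 1) → V') → V'} {f : V → V'}

theorem map_sd (hf : ∀ m t, f (β m t) = β' m (f ∘ t)) (c : TupleChain V) :
    map f (sd β c) = sd β' (map f c) := by
  suffices h : map f ∘ₗ sd β = sd β' ∘ₗ map f from LinearMap.congr_fun h c
  refine hom_ext fun m t => ?_
  simp only [LinearMap.comp_apply]
  induction m with
  | zero => rw [sd_of_zero, map_of, sd_of_zero]
  | succ m ih =>
    have h : map f (sd β (d (of t))) = sd β' (map f (d (of t))) := by
      rw [d_of_succ]; simp only [map_sum, map_smul, ih]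
    rw [sd_of_succ, map_cone, h, hf, map_d, map_of, ← sd_of_succ]

theorem map_sdHomotopy (hf : ∀ m t, f (β m t) = β' m (f ∘ t)) (c : TupleChain V) :
    map f (sdHomotopy β c) = sdHomotopy β' (map f c) := by
  suffices h : map f ∘ₗ sdHomotopy β = sdHomotopy β' ∘ₗ map f from LinearMap.congr_fun h c
  refine hom_ext fun m t => ?_
  simp only [LinearMap.comp_apply]
  induction m with
  | zero => rw [sdHomotopy_of_zero, map_of, sdHomotopy_of_zero, map_zero]
  | succ m ih =>
    have h : map f (sdHomotopy β (d (of t))) = sdHomotopy β' (map f (d (of t))) := by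
      rw [d_of_succ]; simp only [map_sum, map_smul, ih]
    rw [sdHomotopy_of_succ, map_cone, map_sub, h, hf, map_d, map_of, ← sdHomotopy_of_succ]

end Natural

theorem sdHomotopy_of_mem_ofLength {m : ℕ} (t : Fin m → V) :
    sdHomotopy β (of t) ∈ ofLength V (m + 1) := by
  induction m with
  | zero => rw [sdHomotopy_of_zero]; exact Submodule.zero_mem _
  | succ m ih =>
    rw [sdHomotopy_of_succ, d_of_succ, map_sum]
    refine cone_mem_ofLength _ (Submodule.sub_mem _ (of_mem_ofLength _) (Submodule.sum_mem _ ?_))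
    intro i _
    rw [map_smul]
    exact Submodule.smul_mem _ _ (ih _)

end TupleChain

namespace SingularCohomology

universe u v w

/-! ### Singular chains -/

/-- Rational singular chains of `X`, all degrees together. -/
abbrev SingularChain (X : Type u) [TopologicalSpace X] : Type u := (Σ n : ℕ, Simplex X n) →₀ ℚ

namespace SingularChain

variable {X : Type u} {Y : Type v} {Z : Type w} [TopologicalSpace X] [TopologicalSpace Y]
  [TopologicalSpace Z]

/-- The simplex `σ`, as a chain. -/
noncomputable abbrev of {n : ℕ} (σ : Simplex X n) : SingularChain X := Finsupp.single ⟨n, σ⟩ 1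

/-- Linear extension of a function on simplices. -/
noncomputable abbrev lift {A : Type*} [AddCommGroup A] [Module ℚ A]
    (φ : ∀ n : ℕ, Simplex X n → A) : SingularChain X →ₗ[ℚ] A :=
  Finsupp.linearCombination ℚ fun s : Σ n : ℕ, Simplex X n => φ s.1 s.2

theorem lift_of {A : Type*} [AddCommGroup A] [Module ℚ A]
    (φ : ∀ n : ℕ, Simplex X n → A) {n : ℕ} (σ : Simplex X n) : lift φ (of σ) = φ n σ := by
  simp [lift, of]

theorem hom_ext {A : Type*} [AddCommGroup A] [Module ℚ A] {f g : SingularChain X →ₗ[ℚ] A}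
    (h : ∀ (n : ℕ) (σ : Simplex X n), f (of σ) = g (of σ)) : f = g := by
  refine Finsupp.lhom_ext' fun ⟨m, t⟩ => LinearMap.ext_ring ?_
  exact h m t

/-- The boundary of a simplex. -/
noncomputable def boundaryAux : (n : ℕ) → Simplex X n → SingularChain X
  | 0, _ => 0
  | n + 1, σ => ∑ i : Fin (n + 2), (-1 : ℚ) ^ (i : ℕ) • of (σ.pull i.succAbove)

/-- The boundary operator. -/
noncomputable def d : SingularChain X →ₗ[ℚ] SingularChain X := lift boundaryAux

theorem d_of_succ {n : ℕ} (σ : Simplex X (n + 1)) :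
    d (of σ) = ∑ i : Fin (n + 2), (-1 : ℚ) ^ (i : ℕ) • of (σ.pull i.succAbove) := lift_of _ _

theorem d_of_zero (σ : Simplex X 0) : d (of σ) = 0 := lift_of _ _

/-- The map of chains induced by a continuous map. -/
noncomputable def map (f : C(X, Y)) : SingularChain X →ₗ[ℚ] SingularChain Y :=
  lift fun n σ => of (f.comp σ : Simplex Y n)

theorem map_of (f : C(X, Y)) {n : ℕ} (σ : Simplex X n) :
    map f (of σ) = of (f.comp σ : Simplex Y n) :=
  lift_of (fun n σ => of (f.comp σ : Simplex Y n)) σ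

theorem map_d (f : C(X, Y)) (c : SingularChain X) : map f (d c) = d (map f c) := by
  suffices h : map f ∘ₗ d = d ∘ₗ map f from LinearMap.congr_fun h c
  refine hom_ext fun m t => ?_
  cases m with
  | zero => simp only [LinearMap.comp_apply, map_of, d_of_zero, map_zero]
  | succ m => simp only [LinearMap.comp_apply, map_of, d_of_succ, map_sum, map_smul]; rfl

theorem map_map (g : C(Y, Z)) (f : C(X, Y)) (c : SingularChain X) :
    map g (map f c) = map (g.comp f) c := by
  suffices h : map g ∘ₗ map f = map (g.comp f) from LinearMap.congr_fun h c
  refine hom_ext fun m t => ?_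
  simp only [LinearMap.comp_apply, map_of]
  rfl

theorem map_id (c : SingularChain X) : map (ContinuousMap.id X) c = c := by
  suffices h : map (ContinuousMap.id X) = LinearMap.id from LinearMap.congr_fun h c
  refine hom_ext fun m t => ?_
  simp only [LinearMap.id_apply, map_of]
  rfl

/-- The singular chains of degree `n` all of whose simplices lie in `W`. -/
noncomputable abbrev chainsIn (W : Set X) (n : ℤ) : Submodule ℚ (SingularChain X) :=
  Finsupp.supported ℚ ℚ {s | (s.1 : ℤ) = n ∧ Set.range s.2 ⊆ W}

theorem of_mem_chainsIn {W : Set X} {n : ℕ} {σ : Simplex X n} (h : Set.range σ ⊆ W) :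
    of σ ∈ chainsIn W n :=
  Finsupp.single_mem_supported _ _ ⟨rfl, h⟩

theorem chainsIn_induction {A : Type*} [AddCommGroup A] [Module ℚ A] {W : Set X} {n : ℤ}
    (f : SingularChain X →ₗ[ℚ] A) (N : Submodule ℚ A)
    (h : ∀ (k : ℕ) (σ : Simplex X k), (k : ℤ) = n → Set.range σ ⊆ W → f (of σ) ∈ N)
    {c : SingularChain X} (hc : c ∈ chainsIn W n) : f c ∈ N := by
  refine TupleChain.supported_induction f N ?_ hc
  rintro ⟨k, σ⟩ ⟨h1, h2⟩
  exact h k σ h1 h2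

theorem chainsIn_mono {W W' : Set X} (h : W ⊆ W') (n : ℤ) : chainsIn W n ≤ chainsIn W' n :=
  Finsupp.supported_mono fun _ hs => ⟨hs.1, hs.2.trans h⟩

theorem range_pull_subset {m n : ℕ} (σ : Simplex X n) (f : Fin (m + 1) → Fin (n + 1)) :
    Set.range (σ.pull f) ⊆ Set.range σ := by
  rintro _ ⟨x, rfl⟩
  exact ⟨_, rfl⟩

theorem d_mem_chainsIn {W : Set X} {n : ℤ} {c : SingularChain X} (hc : c ∈ chainsIn W n) :
    d c ∈ chainsIn W (n - 1) := by
  refine chainsIn_induction d _ ?_ hc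
  rintro k σ rfl hσ
  cases k with
  | zero => rw [d_of_zero]; exact Submodule.zero_mem _
  | succ k =>
    rw [d_of_succ]
    refine Submodule.sum_mem _ fun i _ => Submodule.smul_mem _ _ ?_
    have := of_mem_chainsIn ((range_pull_subset σ i.succAbove).trans hσ)
    convert this using 2
    push_cast; ring

theorem map_mem_chainsIn {f : C(X, Y)} {W : Set X} {W' : Set Y} (h : Set.MapsTo f W W') {n : ℤ}
    {c : SingularChain X} (hc : c ∈ chainsIn W n) : map f c ∈ chainsIn W' n := by
  refine chainsIn_induction (map f) _ ?_ hc
  rintro k σ rfl hσ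
  rw [map_of]
  refine of_mem_chainsIn ?_
  rintro _ ⟨x, rfl⟩
  exact h (hσ ⟨x, rfl⟩)

end SingularChain

/-! ### Realizations of tuples as singular simplices -/

/-- A rule that makes tuples of elements of `V` into singular simplices of `Y`, compatibly with
passage to subtuples. -/
structure Realization (V : Type*) (Y : Type v) [TopologicalSpace Y] where
  /-- The simplex with vertices `t`. -/
  simplex : ∀ {m : ℕ}, (Fin (m + 1) → V) → Simplex Y m
  simplex_comp : ∀ {m k : ℕ} (t : Fin (m + 1) → V) (f : Fin (k + 1) → Fin (m + 1)),
    simplex (t ∘ f) = (simplex t).pull f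

namespace Realization

variable {V V' : Type*} {Y : Type v} [TopologicalSpace Y] (R : Realization V Y)

/-- The singular chain of a tuple. -/
noncomputable def chainAux : (m : ℕ) → (Fin m → V) → SingularChain Y
  | 0, _ => 0
  | _ + 1, t => SingularChain.of (R.simplex t)

/-- The map from chains on tuples to singular chains; the empty tuple goes to zero. -/
noncomputable def chain : TupleChain V →ₗ[ℚ] SingularChain Y := TupleChain.lift R.chainAux

theorem chain_of_zero (t : Fin 0 → V) : R.chain (TupleChain.of t) = 0 := TupleChain.lift_of _ _

theorem chain_of_succ {m : ℕ} (t : Fin (m + 1) → V) :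
    R.chain (TupleChain.of t) = SingularChain.of (R.simplex t) := TupleChain.lift_of _ _

theorem chain_d (c : TupleChain V) : R.chain (TupleChain.d c) = SingularChain.d (R.chain c) := by
  suffices h : R.chain ∘ₗ TupleChain.d = SingularChain.d ∘ₗ R.chain from LinearMap.congr_fun h c
  refine TupleChain.hom_ext fun m t => ?_
  simp only [LinearMap.comp_apply]
  match m, t with
  | 0, t => rw [TupleChain.d_of_zero, R.chain_of_zero, map_zero, map_zero]
  | 1, t =>
    rw [TupleChain.d_of_succ, R.chain_of_succ, SingularChain.d_of_zero, map_sum]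
    exact Finset.sum_eq_zero fun i _ => by rw [map_smul, R.chain_of_zero, smul_zero]
  | m + 2, t =>
    rw [TupleChain.d_of_succ, R.chain_of_succ, SingularChain.d_of_succ, map_sum]
    exact Finset.sum_congr rfl fun i _ => by rw [map_smul, R.chain_of_succ, R.simplex_comp]

/-- Reindexing of vertices. -/
def comap (f : V' → V) : Realization V' Y where
  simplex t := R.simplex (f ∘ t)
  simplex_comp t g := R.simplex_comp (f ∘ t) g

theorem chain_map (f : V' → V) (c : TupleChain V') :
    R.chain (TupleChain.map f c) = (R.comap f).chain c := by
  suffices h : R.chain ∘ₗ TupleChain.map f = (R.comap f).chain from LinearMap.congr_fun h c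
  refine TupleChain.hom_ext fun m t => ?_
  simp only [LinearMap.comp_apply, TupleChain.map_of]
  cases m with
  | zero => rw [chain_of_zero, chain_of_zero]
  | succ m => rw [chain_of_succ, chain_of_succ]; rfl

theorem chain_mem_chainsIn {W : Set Y} (hW : ∀ (m : ℕ) (t : Fin (m + 1) → V),
    Set.range (R.simplex t) ⊆ W) {m : ℕ} {c : TupleChain V}
    (hc : c ∈ TupleChain.ofLength V (m + 1)) : R.chain c ∈ SingularChain.chainsIn W m := by
  refine TupleChain.supported_induction _ _ ?_ hc
  rintro ⟨k, t⟩ (rfl : k = m + 1)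
  change R.chain (TupleChain.of t) ∈ _
  rw [chain_of_succ]
  exact SingularChain.of_mem_chainsIn (hW _ _)

/-- The realization of tuples of vertices of a standard simplex by faces (possibly degenerate) of
the singular simplex `σ`. -/
noncomputable def ofSimplex {n : ℕ} (σ : Simplex Y n) : Realization (Fin (n + 1)) Y where
  simplex t := σ.pull t
  simplex_comp t f := (Simplex.pull_pull σ t f).symm

theorem pull_id {n : ℕ} (σ : Simplex Y n) : σ.pull id = σ :=
  ContinuousMap.ext fun x => congrArg σ (stdSimplex.map_id_apply x)

theorem ofSimplex_chain_id {n : ℕ} (σ : Simplex Y n) :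
    (ofSimplex σ).chain (TupleChain.of id) = SingularChain.of σ := by
  rw [chain_of_succ]
  exact congrArg SingularChain.of (pull_id σ)

end Realization

namespace SingularChain

variable {X : Type u} {Y : Type v} {Z : Type w} [TopologicalSpace X] [TopologicalSpace Y]
  [TopologicalSpace Z]

theorem d_d (c : SingularChain X) : d (d c) = 0 := by
  suffices h : d ∘ₗ d = (0 : SingularChain X →ₗ[ℚ] SingularChain X) from LinearMap.congr_fun h c
  refine hom_ext fun m t => ?_
  simp only [LinearMap.comp_apply, LinearMap.zero_apply]
  rw [← Realization.ofSimplex_chain_id, ← Realization.chain_d, ← Realization.chain_d,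
    TupleChain.d_d, map_zero]

end SingularChain

/-! ### Homotopy invariance -/

theorem stdSimplex_map_const_apply_self {α β : Type*} [Fintype α] [Fintype β] (b : β)
    (x : stdSimplex ℝ α) : (stdSimplex.map (S := ℝ) (fun _ : α => b) x) b = 1 := by
  change (FunOnFinite.linearMap ℝ ℝ (fun _ : α => b) x.1) b = 1
  classical
  rw [FunOnFinite.linearMap_apply_apply]
  simpa using x.2.2

theorem stdSimplex_map_const_apply_of_ne {α β : Type*} [Fintype α] [Fintype β] {b b' : β}
    (h : b ≠ b') (x : stdSimplex ℝ α) : (stdSimplex.map (S := ℝ) (fun _ : α => b) x) b' = 0 := by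
  change (FunOnFinite.linearMap ℝ ℝ (fun _ : α => b) x.1) b' = 0
  classical
  rw [FunOnFinite.linearMap_apply_apply]
  simp [h]

section Homotopy

variable {X : Type u} {Y : Type v} [TopologicalSpace X] [TopologicalSpace Y] {f₀ f₁ : C(X, Y)}

/-- The realization, by means of a homotopy, of tuples of vertices of the prism over a standard
simplex; `true` marks the vertices at the end of the homotopy. -/
noncomputable def prismRealization (H : ContinuousMap.Homotopy f₀ f₁) {n : ℕ} (σ : Simplex X n) :
    Realization (Fin (n + 1) × Bool) Y where
  simplex {m} t :=
    { toFun := fun x => H (⟨(stdSimplex.map (Prod.snd ∘ t) x) true,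
          (stdSimplex.map (S := ℝ) (Prod.snd ∘ t) x).2.1 true, stdSimplex.le_one _ _⟩,
        σ (stdSimplex.map (Prod.fst ∘ t) x))
      continuous_toFun := by
        refine H.continuous.comp (Continuous.prodMk (Continuous.subtype_mk ?_ _)
          (σ.continuous.comp (stdSimplex.continuous_map _)))
        exact (continuous_apply true).comp
          (continuous_subtype_val.comp (stdSimplex.continuous_map (S := ℝ) (Prod.snd ∘ t))) }
  simplex_comp t f := by
    ext x
    simp only [Simplex.pull, ContinuousMap.comp_apply, ContinuousMap.coe_mk,
      stdSimplex.map_comp_apply]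
    rfl

/-- The chain homotopy induced by a homotopy. -/
noncomputable def chainHomotopy (H : ContinuousMap.Homotopy f₀ f₁) :
    SingularChain X →ₗ[ℚ] SingularChain Y :=
  SingularChain.lift fun n σ => (prismRealization H σ).chain
    (TupleChain.prism (fun i : Fin (n + 1) => (i, false)) (fun i => (i, true)) (TupleChain.of id))

theorem chainHomotopy_of (H : ContinuousMap.Homotopy f₀ f₁) {n : ℕ} (σ : Simplex X n) :
    chainHomotopy H (SingularChain.of σ) = (prismRealization H σ).chain
      (TupleChain.prism (fun i : Fin (n + 1) => (i, false)) (fun i => (i, true))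
        (TupleChain.of id)) :=
  SingularChain.lift_of (fun n σ => (prismRealization H σ).chain (TupleChain.prism
    (fun i : Fin (n + 1) => (i, false)) (fun i => (i, true)) (TupleChain.of id))) σ

theorem prismRealization_pull (H : ContinuousMap.Homotopy f₀ f₁) {m n : ℕ} (σ : Simplex X n)
    (f : Fin (m + 1) → Fin (n + 1)) :
    prismRealization H (σ.pull f) = (prismRealization H σ).comap (Prod.map f id) := by
  simp only [prismRealization, Realization.comap]
  congr 1
  funext k t
  ext x
  simp only [Simplex.pull, ContinuousMap.comp_apply, ContinuousMap.coe_mk,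
    stdSimplex.map_comp_apply]
  rfl

theorem chainHomotopy_ofSimplex (H : ContinuousMap.Homotopy f₀ f₁) {n : ℕ} (σ : Simplex X n)
    (c : TupleChain (Fin (n + 1))) :
    chainHomotopy H ((Realization.ofSimplex σ).chain c) = (prismRealization H σ).chain
      (TupleChain.prism (fun i => (i, false)) (fun i => (i, true)) c) := by
  suffices h : chainHomotopy H ∘ₗ (Realization.ofSimplex σ).chain =
      (prismRealization H σ).chain ∘ₗ TupleChain.prism (fun i => (i, false)) (fun i => (i, true))
    from LinearMap.congr_fun h c
  refine TupleChain.hom_ext fun m t => ?_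
  simp only [LinearMap.comp_apply]
  cases m with
  | zero => rw [Realization.chain_of_zero, TupleChain.prism_of_zero, map_zero, map_zero]
  | succ m =>
    rw [Realization.chain_of_succ, chainHomotopy_of]
    change (prismRealization H (σ.pull t)).chain _ = _
    rw [prismRealization_pull, ← Realization.chain_map, TupleChain.map_prism]
    have : TupleChain.of t = TupleChain.map t (TupleChain.of id) := by
      rw [TupleChain.map_of]; rfl
    rw [this, TupleChain.prism_map]
    rfl

theorem d_chainHomotopy (H : ContinuousMap.Homotopy f₀ f₁) (c : SingularChain X) :
    SingularChain.d (chainHomotopy H c) + chainHomotopy H (SingularChain.d c) =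
      SingularChain.map f₁ c - SingularChain.map f₀ c := by
  suffices h : SingularChain.d ∘ₗ chainHomotopy H + chainHomotopy H ∘ₗ SingularChain.d =
      SingularChain.map f₁ - SingularChain.map f₀ from LinearMap.congr_fun h c
  refine SingularChain.hom_ext fun n σ => ?_
  simp only [LinearMap.comp_apply, LinearMap.add_apply, LinearMap.sub_apply]
  have h0 : (prismRealization H σ).chain (TupleChain.map (fun i => (i, false))
      (TupleChain.of id)) = SingularChain.map f₀ (SingularChain.of σ) := by
    rw [TupleChain.map_of, Realization.chain_of_succ, SingularChain.map_of]
    refine congrArg SingularChain.of (ContinuousMap.ext fun x => ?_)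
    exact (congrArg H (Prod.ext (Subtype.ext (stdSimplex_map_const_apply_of_ne (by simp) x))
      (congrArg σ (stdSimplex.map_id_apply x)))).trans (H.apply_zero _)
  have h1 : (prismRealization H σ).chain (TupleChain.map (fun i => (i, true))
      (TupleChain.of id)) = SingularChain.map f₁ (SingularChain.of σ) := by
    rw [TupleChain.map_of, Realization.chain_of_succ, SingularChain.map_of]
    refine congrArg SingularChain.of (ContinuousMap.ext fun x => ?_)
    exact (congrArg H (Prod.ext (Subtype.ext (stdSimplex_map_const_apply_self true x))
      (congrArg σ (stdSimplex.map_id_apply x)))).trans (H.apply_one _)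
  rw [← h0, ← h1, ← Realization.ofSimplex_chain_id σ, ← Realization.chain_d,
    chainHomotopy_ofSimplex, chainHomotopy_ofSimplex, ← Realization.chain_d, ← map_add,
    TupleChain.d_prism, map_sub]

theorem chainHomotopy_mem_chainsIn (H : ContinuousMap.Homotopy f₀ f₁) {W : Set Y} {n : ℤ}
    (hW : ∀ s x, H (s, x) ∈ W) {c : SingularChain X}
    (hc : c ∈ SingularChain.chainsIn Set.univ n) :
    chainHomotopy H c ∈ SingularChain.chainsIn W (n + 1) := by
  refine SingularChain.chainsIn_induction _ _ ?_ hc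
  rintro k σ rfl -
  rw [chainHomotopy_of]
  refine Realization.chain_mem_chainsIn _ ?_ (TupleChain.prism_of_mem_ofLength _ _ _)
  rintro m t _ ⟨x, rfl⟩
  exact hW _ _

end Homotopy

/-! ### Barycentric subdivision and small simplices -/

/-- The convex combination with weights `w` of the points `t` of a standard simplex. -/
noncomputable def combo {m n : ℕ} (t : Fin (m + 1) → stdSimplex ℝ (Fin (n + 1)))
    (w : stdSimplex ℝ (Fin (m + 1))) : stdSimplex ℝ (Fin (n + 1)) :=
  ⟨∑ j, w.1 j • (t j).1, (convex_stdSimplex ℝ _).sum_mem (fun j _ => w.2.1 j) w.2.2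
    fun j _ => (t j).2⟩

theorem continuous_combo {m n : ℕ} (t : Fin (m + 1) → stdSimplex ℝ (Fin (n + 1))) :
    Continuous (combo t) := by
  refine Continuous.subtype_mk (continuous_finsetSum _ fun j _ => ?_) _
  exact ((continuous_apply j).comp continuous_subtype_val).smul continuous_const

theorem sum_stdSimplex_map_smul {α β E : Type*} [Fintype α] [Fintype β] [AddCommGroup E]
    [Module ℝ E] (f : α → β) (x : stdSimplex ℝ α) (g : β → E) :
    ∑ b, (stdSimplex.map (S := ℝ) f x).1 b • g b = ∑ a, x.1 a • g (f a) := by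
  classical
  have h : ∀ b, (stdSimplex.map (S := ℝ) f x).1 b • g b =
      ∑ a with f a = b, x.1 a • g (f a) := by
    intro b
    change (FunOnFinite.linearMap ℝ ℝ f x.1) b • g b = _
    rw [FunOnFinite.linearMap_apply_apply, Finset.sum_smul]
    refine Finset.sum_congr rfl fun a ha => ?_
    rw [(Finset.mem_filter.mp ha).2]
  simp only [h]
  exact Finset.sum_fiberwise Finset.univ f fun a => x.1 a • g (f a)

theorem combo_comp {m n k : ℕ} (t : Fin (m + 1) → stdSimplex ℝ (Fin (n + 1)))
    (f : Fin (k + 1) → Fin (m + 1)) (w : stdSimplex ℝ (Fin (k + 1))) :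
    combo (t ∘ f) w = combo t (stdSimplex.map f w) :=
  Subtype.ext (sum_stdSimplex_map_smul f w fun j => (t j).1).symm

theorem combo_combo {m n k : ℕ} (s : Fin (n + 1) → stdSimplex ℝ (Fin (k + 1)))
    (t : Fin (m + 1) → stdSimplex ℝ (Fin (n + 1))) (w : stdSimplex ℝ (Fin (m + 1))) :
    combo s (combo t w) = combo (combo s ∘ t) w := by
  refine Subtype.ext ?_
  simp only [combo, Function.comp_apply, Finset.smul_sum, Finset.sum_apply, Finset.sum_smul,
    Pi.smul_apply, smul_eq_mul, mul_smul]
  exact Finset.sum_comm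

theorem combo_vertex {n : ℕ} (w : stdSimplex ℝ (Fin (n + 1))) :
    combo (fun i => stdSimplex.vertex i) w = w := by
  refine Subtype.ext (funext fun i => ?_)
  simp [combo, Finset.sum_apply, Pi.single_apply]

theorem combo_apply_vertex {m n : ℕ} (t : Fin (m + 1) → stdSimplex ℝ (Fin (n + 1)))
    (i : Fin (m + 1)) : combo t (stdSimplex.vertex i) = t i := by
  refine Subtype.ext ?_
  simp [combo, Pi.single_apply, ite_smul]

/-- The barycenter of the standard simplex. -/
noncomputable def stdBarycenter (m : ℕ) : stdSimplex ℝ (Fin (m + 1)) :=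
  ⟨fun _ => ((m : ℝ) + 1)⁻¹, fun _ => by positivity, by
    have : (m : ℝ) + 1 ≠ 0 := by positivity
    simp [this]⟩

/-- The barycenter of a tuple of points of a standard simplex. -/
noncomputable def tupleBarycenter {n : ℕ} (m : ℕ)
    (t : Fin (m + 1) → stdSimplex ℝ (Fin (n + 1))) : stdSimplex ℝ (Fin (n + 1)) :=
  combo t (stdBarycenter m)

/-- The distance from the barycenter of `m + 1` points to each of them is at most `m / (m + 1)`
times their diameter. -/
theorem dist_tupleBarycenter_le {m n : ℕ} (t : Fin (m + 1) → stdSimplex ℝ (Fin (n + 1))) {δ : ℝ}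
    (ht : ∀ i j, dist (t i) (t j) ≤ δ) (j : Fin (m + 1)) :
    dist (tupleBarycenter m t).1 (t j).1 ≤ m / (m + 1) * δ := by
  have hm : (m : ℝ) + 1 ≠ 0 := by positivity
  have h1 : (tupleBarycenter m t).1 - (t j).1 =
      ∑ i ∈ Finset.univ.erase j, ((m : ℝ) + 1)⁻¹ • ((t i).1 - (t j).1) := by
    rw [Finset.sum_erase _ (by simp), ← Finset.smul_sum, Finset.sum_sub_distrib]
    simp only [tupleBarycenter, combo, stdBarycenter, ← Finset.smul_sum, smul_sub,
      Finset.sum_const, Finset.card_univ, Fintype.card_fin]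
    rw [← Nat.cast_smul_eq_nsmul ℝ, smul_smul]
    push_cast
    rw [inv_mul_cancel₀ hm, one_smul]
  rw [dist_eq_norm, h1]
  refine (norm_sum_le _ _).trans ?_
  have h2 : ∀ i ∈ Finset.univ.erase j, ‖((m : ℝ) + 1)⁻¹ • ((t i).1 - (t j).1)‖ ≤
      ((m : ℝ) + 1)⁻¹ * δ := by
    intro i _
    rw [norm_smul, Real.norm_of_nonneg (by positivity), ← dist_eq_norm]
    exact mul_le_mul_of_nonneg_left (ht i j) (by positivity)
  refine (Finset.sum_le_card_nsmul _ _ _ h2).trans (le_of_eq ?_)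
  rw [Finset.card_erase_of_mem (Finset.mem_univ j), Finset.card_univ, Fintype.card_fin,
    nsmul_eq_mul]
  simp only [Nat.add_sub_cancel]
  ring

theorem combo_mem_convexHull {m n : ℕ} (t : Fin (m + 1) → stdSimplex ℝ (Fin (n + 1)))
    (w : stdSimplex ℝ (Fin (m + 1))) :
    (combo t w).1 ∈ convexHull ℝ (Set.range fun j => (t j).1) :=
  (convex_convexHull ℝ _).sum_mem (fun j _ => w.2.1 j) w.2.2
    fun j _ => subset_convexHull ℝ _ ⟨j, rfl⟩

/-- The factor by which barycentric subdivision shrinks the diameter of a simplex with `m`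
vertices. -/
noncomputable def meshRatio (m : ℕ) : ℝ := (m - 1) / m

theorem meshRatio_succ (m : ℕ) : meshRatio (m + 1) = m / (m + 1) := by
  simp [meshRatio]

theorem meshRatio_le_succ (m : ℕ) : meshRatio m ≤ meshRatio (m + 1) := by
  cases m with
  | zero => simp [meshRatio]
  | succ m =>
    rw [meshRatio_succ, meshRatio_succ, div_le_div_iff₀ (by positivity) (by positivity)]
    push_cast
    nlinarith

theorem sd_of_mem_supported {n : ℕ} {δ : ℝ} (hδ : 0 ≤ δ) {m : ℕ}
    (t : Fin m → stdSimplex ℝ (Fin (n + 1))) (ht : ∀ i j, dist (t i) (t j) ≤ δ) :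
    TupleChain.sd tupleBarycenter (TupleChain.of t) ∈ Finsupp.supported ℚ ℚ
      {s : Σ m : ℕ, Fin m → stdSimplex ℝ (Fin (n + 1)) | s.1 = m ∧
        (∀ i, (s.2 i).1 ∈ convexHull ℝ (Set.range fun j => (t j).1)) ∧
        ∀ i j, dist (s.2 i) (s.2 j) ≤ meshRatio m * δ} := by
  induction m with
  | zero =>
    rw [TupleChain.sd_of_zero]
    exact Finsupp.single_mem_supported _ _ ⟨rfl, fun i => i.elim0, fun i => i.elim0⟩
  | succ m ih =>
    rw [TupleChain.sd_of_succ, TupleChain.d_of_succ, map_sum, map_sum]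
    refine Submodule.sum_mem _ fun i _ => ?_
    rw [map_smul, map_smul]
    refine Submodule.smul_mem _ _ ?_
    refine TupleChain.supported_induction _ _ ?_ (ih (t ∘ i.succAbove) fun _ _ => ht _ _)
    rintro ⟨k, s⟩ ⟨rfl, h2, h3⟩
    change TupleChain.cone _ (TupleChain.of s) ∈ _
    rw [TupleChain.cone_of]
    have hs : ∀ j, (s j).1 ∈ convexHull ℝ (Set.range fun j => (t j).1) := fun j =>
      convexHull_mono (by rintro _ ⟨j, rfl⟩; exact ⟨_, rfl⟩) (h2 j)
    have hd : ∀ j, dist (tupleBarycenter k t) (s j) ≤ meshRatio (k + 1) * δ := by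
      intro j
      obtain ⟨_, ⟨l, rfl⟩, hl⟩ := convexHull_exists_dist_ge (hs j) (tupleBarycenter k t).1
      rw [dist_comm]
      refine hl.trans ?_
      rw [dist_comm, meshRatio_succ]
      exact dist_tupleBarycenter_le t ht l
    have h0 : 0 ≤ meshRatio (k + 1) * δ := by rw [meshRatio_succ]; positivity
    refine Finsupp.single_mem_supported _ _ ⟨rfl, ?_, ?_⟩
    · refine Fin.cases ?_ fun j => ?_
      · exact combo_mem_convexHull t (stdBarycenter k)
      · simpa using hs j
    · refine Fin.cases ?_ fun j => ?_
      · refine Fin.cases ?_ fun j' => ?_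
        · simpa using h0
        · simpa using hd j'
      · refine Fin.cases ?_ fun j' => ?_
        · simpa [dist_comm] using hd j
        · simpa using (h3 j j').trans (mul_le_mul_of_nonneg_right (meshRatio_le_succ k) hδ)

/-- The chains on tuples of `m` points of a standard simplex with mutual distances at most `δ`. -/
noncomputable abbrev meshChains (n m : ℕ) (δ : ℝ) :
    Submodule ℚ (TupleChain (stdSimplex ℝ (Fin (n + 1)))) :=
  Finsupp.supported ℚ ℚ {s | s.1 = m ∧ ∀ i j, dist (s.2 i) (s.2 j) ≤ δ}

theorem sd_iterate_mem_meshChains {n m : ℕ} {δ : ℝ} (hδ : 0 ≤ δ)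
    {c : TupleChain (stdSimplex ℝ (Fin (n + 1)))} (hc : c ∈ meshChains n (m + 1) δ) (k : ℕ) :
    (TupleChain.sd tupleBarycenter)^[k] c ∈
      meshChains n (m + 1) ((m / (m + 1) : ℝ) ^ k * δ) := by
  induction k with
  | zero => simpa using hc
  | succ k ih =>
    rw [Function.iterate_succ_apply']
    refine TupleChain.supported_induction _ _ ?_ ih
    rintro ⟨l, t⟩ ⟨rfl, ht⟩
    refine Finsupp.supported_mono ?_ (sd_of_mem_supported (by positivity) t ht)
    rintro s ⟨h1, -, h3⟩
    refine ⟨h1, fun i j => (h3 i j).trans (le_of_eq ?_)⟩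
    rw [meshRatio_succ, pow_succ]
    ring

section

variable {X : Type u} [TopologicalSpace X]

/-- The realization of tuples of points of the standard simplex by affine simplices, followed by
the singular simplex `σ`. -/
noncomputable def affineRealization {n : ℕ} (σ : Simplex X n) :
    Realization (stdSimplex ℝ (Fin (n + 1))) X where
  simplex t := σ.comp ⟨combo t, continuous_combo t⟩
  simplex_comp t f := by
    ext x
    simp only [Simplex.pull, ContinuousMap.comp_apply, ContinuousMap.coe_mk, combo_comp]

theorem affineRealization_vertex {n : ℕ} (σ : Simplex X n) :
    (affineRealization σ).chain (TupleChain.of fun i => stdSimplex.vertex i) =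
      SingularChain.of σ := by
  rw [Realization.chain_of_succ]
  exact congrArg SingularChain.of (ContinuousMap.ext fun x => congrArg σ (combo_vertex x))

theorem affineRealization_simplex {m n : ℕ} (σ : Simplex X n)
    (t : Fin (m + 1) → stdSimplex ℝ (Fin (n + 1))) :
    affineRealization ((affineRealization σ).simplex t) =
      (affineRealization σ).comap (combo t) := by
  simp only [affineRealization, Realization.comap]
  congr 1
  funext k s
  ext x
  exact congrArg σ (combo_combo t s x)

/-- A natural operator on chains of tuples of points of standard simplices, transported to
singular chains. -/
noncomputable def transport (Q : ∀ n : ℕ, TupleChain (stdSimplex ℝ (Fin (n + 1))) →ₗ[ℚ]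
    TupleChain (stdSimplex ℝ (Fin (n + 1)))) : SingularChain X →ₗ[ℚ] SingularChain X :=
  SingularChain.lift fun n σ => (affineRealization σ).chain
    (Q n (TupleChain.of fun i => stdSimplex.vertex i))

theorem transport_of (Q : ∀ n : ℕ, TupleChain (stdSimplex ℝ (Fin (n + 1))) →ₗ[ℚ]
    TupleChain (stdSimplex ℝ (Fin (n + 1)))) {n : ℕ} (σ : Simplex X n) :
    transport Q (SingularChain.of σ) = (affineRealization σ).chain
      (Q n (TupleChain.of fun i => stdSimplex.vertex i)) :=
  SingularChain.lift_of (fun n σ => (affineRealization σ).chain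
    (Q n (TupleChain.of fun i => stdSimplex.vertex i))) σ

theorem transport_chain {Q : ∀ n : ℕ, TupleChain (stdSimplex ℝ (Fin (n + 1))) →ₗ[ℚ]
    TupleChain (stdSimplex ℝ (Fin (n + 1)))}
    (hQ : ∀ (m n : ℕ) (t : Fin (m + 1) → stdSimplex ℝ (Fin (n + 1))) c,
      TupleChain.map (combo t) (Q m c) = Q n (TupleChain.map (combo t) c))
    (hQ0 : ∀ (X : Type u) [TopologicalSpace X] (n : ℕ) (σ : Simplex X n)
      (t : Fin 0 → stdSimplex ℝ (Fin (n + 1))),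
      (affineRealization σ).chain (Q n (TupleChain.of t)) = 0)
    {n : ℕ} (σ : Simplex X n) (c : TupleChain (stdSimplex ℝ (Fin (n + 1)))) :
    transport Q ((affineRealization σ).chain c) = (affineRealization σ).chain (Q n c) := by
  suffices h : transport Q ∘ₗ (affineRealization σ).chain = (affineRealization σ).chain ∘ₗ Q n
    from LinearMap.congr_fun h c
  refine TupleChain.hom_ext fun m t => ?_
  simp only [LinearMap.comp_apply]
  cases m with
  | zero => rw [Realization.chain_of_zero, map_zero, hQ0]
  | succ m =>
    rw [Realization.chain_of_succ, transport_of, affineRealization_simplex,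
      ← Realization.chain_map, hQ, TupleChain.map_of]
    have : combo t ∘ (fun i => stdSimplex.vertex i) = t := funext fun i => combo_apply_vertex t i
    rw [this]

/-- Barycentric subdivision of singular chains. -/
noncomputable def subdivision : SingularChain X →ₗ[ℚ] SingularChain X :=
  transport fun _ => TupleChain.sd tupleBarycenter

/-- The natural chain homotopy from barycentric subdivision to the identity. -/
noncomputable def subdivisionHomotopy : SingularChain X →ₗ[ℚ] SingularChain X :=
  transport fun _ => TupleChain.sdHomotopy tupleBarycenter

theorem subdivision_chain {n : ℕ} (σ : Simplex X n)
    (c : TupleChain (stdSimplex ℝ (Fin (n + 1)))) :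
    subdivision ((affineRealization σ).chain c) =
      (affineRealization σ).chain (TupleChain.sd tupleBarycenter c) := by
  refine transport_chain (fun m n t c => ?_) (fun X _ n σ t => ?_) σ c
  · exact TupleChain.map_sd (fun k s => combo_combo t s _) c
  · rw [TupleChain.sd_of_zero, Realization.chain_of_zero]

theorem subdivisionHomotopy_chain {n : ℕ} (σ : Simplex X n)
    (c : TupleChain (stdSimplex ℝ (Fin (n + 1)))) :
    subdivisionHomotopy ((affineRealization σ).chain c) =
      (affineRealization σ).chain (TupleChain.sdHomotopy tupleBarycenter c) := by
  refine transport_chain (fun m n t c => ?_) (fun X _ n σ t => ?_) σ c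
  · exact TupleChain.map_sdHomotopy (fun k s => combo_combo t s _) c
  · rw [TupleChain.sdHomotopy_of_zero, map_zero]

theorem d_subdivision (c : SingularChain X) :
    SingularChain.d (subdivision c) = subdivision (SingularChain.d c) := by
  suffices h : SingularChain.d ∘ₗ subdivision = subdivision ∘ₗ SingularChain.d from
    LinearMap.congr_fun (f := SingularChain.d ∘ₗ subdivision (X := X)) h c
  refine SingularChain.hom_ext fun n σ => ?_
  simp only [LinearMap.comp_apply]
  rw [← affineRealization_vertex, subdivision_chain, ← Realization.chain_d, ← Realization.chain_d,
    subdivision_chain, TupleChain.d_sd]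

theorem d_subdivisionHomotopy (c : SingularChain X) :
    SingularChain.d (subdivisionHomotopy c) + subdivisionHomotopy (SingularChain.d c) =
      c - subdivision c := by
  suffices h : SingularChain.d ∘ₗ subdivisionHomotopy + subdivisionHomotopy ∘ₗ SingularChain.d =
      LinearMap.id - subdivision (X := X) from LinearMap.congr_fun h c
  refine SingularChain.hom_ext fun n σ => ?_
  simp only [LinearMap.comp_apply, LinearMap.add_apply, LinearMap.sub_apply, LinearMap.id_apply]
  rw [← affineRealization_vertex, subdivisionHomotopy_chain, subdivision_chain,
    ← Realization.chain_d, ← Realization.chain_d, subdivisionHomotopy_chain, ← map_add,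
    TupleChain.d_sdHomotopy, map_sub]

theorem range_affineRealization_subset {m n : ℕ} (σ : Simplex X n)
    (t : Fin (m + 1) → stdSimplex ℝ (Fin (n + 1))) :
    Set.range ((affineRealization σ).simplex t) ⊆ Set.range σ := by
  rintro _ ⟨x, rfl⟩
  exact ⟨_, rfl⟩

theorem subdivisionHomotopy_mem_chainsIn {W : Set X} {n : ℤ} {c : SingularChain X}
    (hc : c ∈ SingularChain.chainsIn W n) :
    subdivisionHomotopy c ∈ SingularChain.chainsIn W (n + 1) := by
  refine SingularChain.chainsIn_induction _ _ ?_ hc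
  rintro k σ rfl hσ
  rw [subdivisionHomotopy, transport_of]
  exact Realization.chain_mem_chainsIn _
    (fun m t => (range_affineRealization_subset σ t).trans hσ)
    (TupleChain.sdHomotopy_of_mem_ofLength _ _)

/-- Sufficiently fine subdivisions of a simplex that lies in the union of two open sets are
sums of chains in the two. -/
theorem eventually_subdivision_of_mem {W₁ W₂ : Set X} (h₁ : IsOpen W₁) (h₂ : IsOpen W₂) {n : ℕ}
    (σ : Simplex X n) (hσ : Set.range σ ⊆ W₁ ∪ W₂) :
    ∀ᶠ k : ℕ in Filter.atTop, subdivision^[k] (SingularChain.of σ) ∈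
      SingularChain.chainsIn W₁ n ⊔ SingularChain.chainsIn W₂ n := by
  obtain ⟨δ, hδ, hL⟩ := lebesgue_number_lemma_of_metric (s := Set.univ) (isCompact_univ)
    (c := fun b : Bool => σ ⁻¹' (if b then W₁ else W₂))
    (fun b => by
      refine IsOpen.preimage σ.continuous ?_
      cases b <;> simpa)
    (fun x _ => by
      rcases hσ ⟨x, rfl⟩ with h | h
      · exact Set.mem_iUnion.mpr ⟨true, by simpa using h⟩
      · exact Set.mem_iUnion.mpr ⟨false, by simpa using h⟩)
  have hlim : Filter.Tendsto (fun k : ℕ => (n / (n + 1) : ℝ) ^ k * 1) Filter.atTop (𝓝 0) := by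
    simpa using tendsto_pow_atTop_nhds_zero_of_lt_one (r := (n / (n + 1) : ℝ)) (by positivity)
      (by rw [div_lt_one (by positivity)]; linarith)
  filter_upwards [hlim.eventually (gt_mem_nhds hδ)] with k hk
  have hit : subdivision^[k] (SingularChain.of σ) = (affineRealization σ).chain
      ((TupleChain.sd tupleBarycenter)^[k] (TupleChain.of fun i => stdSimplex.vertex i)) := by
    clear hk
    induction k with
    | zero => exact (affineRealization_vertex σ).symm
    | succ k ih => rw [Function.iterate_succ_apply', ih, subdivision_chain,
        Function.iterate_succ_apply']
  rw [hit]
  have hι : TupleChain.of (fun i : Fin (n + 1) => stdSimplex.vertex (S := ℝ) i) ∈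
      meshChains n (n + 1) 1 := by
    refine Finsupp.single_mem_supported _ _ ⟨rfl, fun i j => ?_⟩
    exact (Metric.dist_le_diam_of_mem (bounded_stdSimplex _) (Subtype.prop _)
      (Subtype.prop _)).trans diam_stdSimplex_le
  refine TupleChain.supported_induction _ _ ?_ (sd_iterate_mem_meshChains zero_le_one hι k)
  rintro ⟨l, t⟩ ⟨rfl, ht⟩
  change (affineRealization σ).chain (TupleChain.of t) ∈ _
  rw [Realization.chain_of_succ]
  obtain ⟨b, hb⟩ := hL (t 0) (Set.mem_univ _)
  have hr : Set.range ((affineRealization σ).simplex t) ⊆ (if b then W₁ else W₂) := by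
    rintro _ ⟨x, rfl⟩
    refine hb (Metric.mem_ball.mpr (lt_of_le_of_lt ?_ hk))
    obtain ⟨_, ⟨l, rfl⟩, hl⟩ := convexHull_exists_dist_ge (combo_mem_convexHull t x) (t 0).1
    exact hl.trans (ht l 0)
  cases b with
  | true => exact Submodule.mem_sup_left (SingularChain.of_mem_chainsIn (by simpa using hr))
  | false => exact Submodule.mem_sup_right (SingularChain.of_mem_chainsIn (by simpa using hr))

theorem eventually_subdivision_mem {W₁ W₂ : Set X} (h₁ : IsOpen W₁) (h₂ : IsOpen W₂) {n : ℤ}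
    {c : SingularChain X} (hc : c ∈ SingularChain.chainsIn (W₁ ∪ W₂) n) :
    ∀ᶠ k : ℕ in Filter.atTop, subdivision^[k] c ∈
      SingularChain.chainsIn W₁ n ⊔ SingularChain.chainsIn W₂ n := by
  let N : Submodule ℚ (SingularChain X) :=
    { carrier := {c | ∀ᶠ k : ℕ in Filter.atTop, subdivision^[k] c ∈
        SingularChain.chainsIn W₁ n ⊔ SingularChain.chainsIn W₂ n}
      add_mem' := fun {a b} ha hb => by
        filter_upwards [ha, hb] with k h1 h2
        rw [iterate_map_add]
        exact Submodule.add_mem _ h1 h2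
      zero_mem' := by
        refine Filter.Eventually.of_forall fun k => ?_
        rw [iterate_map_zero]
        exact Submodule.zero_mem _
      smul_mem' := fun r a ha => by
        filter_upwards [ha] with k h1
        rw [← Module.End.coe_pow, map_smul, Module.End.coe_pow]
        exact Submodule.smul_mem _ _ h1 }
  refine SingularChain.chainsIn_induction LinearMap.id N ?_ hc
  rintro k σ rfl hσ
  exact eventually_subdivision_of_mem h₁ h₂ σ hσ

/-- A chain in the union of two open sets whose boundary is a sum of chains in the two is
homologous to such a sum. -/
theorem exists_small {W₁ W₂ : Set X} (h₁ : IsOpen W₁) (h₂ : IsOpen W₂) {n : ℤ}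
    {c : SingularChain X} (hc : c ∈ SingularChain.chainsIn (W₁ ∪ W₂) n)
    (hd : SingularChain.d c ∈
      SingularChain.chainsIn W₁ (n - 1) ⊔ SingularChain.chainsIn W₂ (n - 1)) :
    ∃ c' ∈ SingularChain.chainsIn W₁ n ⊔ SingularChain.chainsIn W₂ n,
      ∃ e ∈ SingularChain.chainsIn (W₁ ∪ W₂) (n + 1), c = c' + SingularChain.d e := by
  have hT : ∀ a ∈ SingularChain.chainsIn W₁ (n - 1) ⊔ SingularChain.chainsIn W₂ (n - 1),
      subdivisionHomotopy a ∈ SingularChain.chainsIn W₁ n ⊔ SingularChain.chainsIn W₂ n := by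
    intro a ha
    obtain ⟨a₁, ha₁, a₂, ha₂, rfl⟩ := Submodule.mem_sup.mp ha
    rw [map_add]
    have e1 := subdivisionHomotopy_mem_chainsIn ha₁
    have e2 := subdivisionHomotopy_mem_chainsIn ha₂
    rw [sub_add_cancel] at e1 e2
    exact Submodule.add_mem_sup e1 e2
  have hS : ∀ (m : ℤ) (W : Set X), ∀ a ∈ SingularChain.chainsIn W m,
      subdivision a ∈ SingularChain.chainsIn W m := by
    intro m W a ha
    have e : subdivision a = a - (SingularChain.d (subdivisionHomotopy a) +
        subdivisionHomotopy (SingularChain.d a)) := by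
      rw [d_subdivisionHomotopy, sub_sub_cancel]
    rw [e]
    refine Submodule.sub_mem _ ha (Submodule.add_mem _ ?_ ?_)
    · simpa using SingularChain.d_mem_chainsIn (subdivisionHomotopy_mem_chainsIn ha)
    · simpa using subdivisionHomotopy_mem_chainsIn (SingularChain.d_mem_chainsIn ha)
  have hS' : ∀ a ∈ SingularChain.chainsIn W₁ (n - 1) ⊔ SingularChain.chainsIn W₂ (n - 1),
      subdivision a ∈
        SingularChain.chainsIn W₁ (n - 1) ⊔ SingularChain.chainsIn W₂ (n - 1) := by
    intro a ha
    obtain ⟨a₁, ha₁, a₂, ha₂, rfl⟩ := Submodule.mem_sup.mp ha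
    rw [map_add]
    exact Submodule.add_mem_sup (hS _ _ _ ha₁) (hS _ _ _ ha₂)
  have key : ∀ k : ℕ, subdivision^[k] c ∈ SingularChain.chainsIn (W₁ ∪ W₂) n ∧
      SingularChain.d (subdivision^[k] c) ∈
        SingularChain.chainsIn W₁ (n - 1) ⊔ SingularChain.chainsIn W₂ (n - 1) ∧
      ∃ c' ∈ SingularChain.chainsIn W₁ n ⊔ SingularChain.chainsIn W₂ n,
        ∃ e ∈ SingularChain.chainsIn (W₁ ∪ W₂) (n + 1),
          c = subdivision^[k] c + c' + SingularChain.d e := by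
    intro k
    induction k with
    | zero => exact ⟨hc, hd, 0, Submodule.zero_mem _, 0, Submodule.zero_mem _, by simp⟩
    | succ k ih =>
      obtain ⟨i1, i2, c', hc', e, he, hce⟩ := ih
      rw [Function.iterate_succ_apply']
      refine ⟨hS _ _ _ i1, ?_, c' + subdivisionHomotopy (SingularChain.d (subdivision^[k] c)),
        Submodule.add_mem _ hc' (hT _ i2), e + subdivisionHomotopy (subdivision^[k] c),
        Submodule.add_mem _ he (subdivisionHomotopy_mem_chainsIn i1), ?_⟩
      · rw [d_subdivision]
        exact hS' _ i2
      · have h := d_subdivisionHomotopy (subdivision^[k] c)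
        refine hce.trans ?_
        rw [map_add]
        linear_combination (norm := module) (-1 : ℚ) • h
  obtain ⟨k, hk⟩ := (eventually_subdivision_mem h₁ h₂ hc).exists
  obtain ⟨-, -, c', hc', e, he, hce⟩ := key k
  exact ⟨_, Submodule.add_mem _ hk hc', e, he, hce⟩

end

end SingularCohomology

open TopologicalSpace (Opens)

/-! ### Complexes with supports in open sets -/

/-- A rational chain complex (all degrees together) with a notion of support: a submodule of
chains of degree `n` in every open set `W`, such that chains are compactly supported and a chain
in `W₁ ⊔ W₂` can be replaced, up to homology, by a sum of chains in `W₁` and in `W₂`. The last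
property is what makes Mayer-Vietoris arguments possible. -/
structure LocalComplex (X : Type*) [TopologicalSpace X] (A : Type*) [AddCommGroup A]
    [Module ℚ A] where
  /-- The boundary operator. -/
  d : A →ₗ[ℚ] A
  d_d : ∀ c, d (d c) = 0
  /-- The chains of a given degree in an open set. -/
  chains : Opens X → ℤ → Submodule ℚ A
  d_mem : ∀ {W n c}, c ∈ chains W n → d c ∈ chains W (n - 1)
  mono : ∀ {W W' n c}, W ≤ W' → c ∈ chains W n → c ∈ chains W' n
  inf : ∀ {W W' n c}, c ∈ chains W n → c ∈ chains W' n → c ∈ chains (W ⊓ W') n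
  neg : ∀ {W n c}, n < 0 → c ∈ chains W n → c = 0
  bot : ∀ {n c}, c ∈ chains ⊥ n → c = 0
  compact : ∀ {𝒰 : Set (Opens X)} {n c}, c ∈ chains (sSup 𝒰) n →
    ∃ t : Finset (Opens X), (t : Set (Opens X)) ⊆ 𝒰 ∧ c ∈ chains (t.sup id) n
  small : ∀ {W₁ W₂ n c}, c ∈ chains (W₁ ⊔ W₂) n →
    d c ∈ chains W₁ (n - 1) ⊔ chains W₂ (n - 1) →
    ∃ c' ∈ chains W₁ n ⊔ chains W₂ n, ∃ e ∈ chains (W₁ ⊔ W₂) (n + 1), c = c' + d e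

namespace LocalComplex

variable {X : Type*} [TopologicalSpace X] {A A' : Type*} [AddCommGroup A] [Module ℚ A]
  [AddCommGroup A'] [Module ℚ A']

/-- If every point has arbitrarily small neighbourhoods `V ≤ W` such that the cycles in `V` bound
in `W`, then all cycles bound. By induction on the degree, Mayer-Vietoris shows that the
homology in degree `n` of a finite union of open sets is generated by that of the members, since
the homology of their intersections vanishes in degree `n - 1`. No point-set hypothesis on the
space is needed, because a cycle lives in a finite union of given neighbourhoods. -/
theorem acyclic (K : LocalComplex X A) (Ω : Opens X)
    (h : ∀ (n : ℤ) (W : Opens X), W ≤ Ω → ∀ x ∈ W, ∃ V ≤ W, x ∈ V ∧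
      ∀ z ∈ K.chains V n, K.d z = 0 → ∃ e ∈ K.chains W (n + 1), K.d e = z)
    (n : ℤ) (W : Opens X) (hW : W ≤ Ω) (z : A) (hz : z ∈ K.chains W n) (hdz : K.d z = 0) :
    ∃ e ∈ K.chains W (n + 1), K.d e = z := by
  classical
  suffices H : ∀ (k : ℕ) (n : ℤ), n < k → ∀ W ≤ Ω, ∀ z ∈ K.chains W n, K.d z = 0 →
      ∃ e ∈ K.chains W (n + 1), K.d e = z by
    exact H (n.toNat + 1) n (by omega) W hW z hz hdz
  clear hdz hz z hW W n
  intro k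
  induction k with
  | zero =>
    intro n hn W _ z hz _
    exact ⟨0, Submodule.zero_mem _, by rw [map_zero, K.neg (by exact_mod_cast hn) hz]⟩
  | succ k ih =>
    intro n hn W hW z hz hdz
    have ih' := ih (n - 1) (by push_cast at hn; omega)
    rw [sub_add_cancel] at ih'
    let 𝒰 : Set (Opens X) := {V | V ≤ W ∧
      ∀ z ∈ K.chains V n, K.d z = 0 → ∃ e ∈ K.chains W (n + 1), K.d e = z}
    have hsup : sSup 𝒰 = W := by
      refine le_antisymm (sSup_le fun V hV => hV.1) fun x hx => ?_
      obtain ⟨V, hVW, hxV, hV⟩ := h n W hW x hx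
      exact Opens.mem_sSup.mpr ⟨V, ⟨hVW, hV⟩, hxV⟩
    have hz' := hz
    rw [← hsup] at hz'
    obtain ⟨t, ht, hzt⟩ := K.compact hz'
    clear hz hz'
    induction t using Finset.induction generalizing z with
    | empty =>
      exact ⟨0, Submodule.zero_mem _, by
        rw [map_zero, K.bot (c := z) (by simpa using hzt)]⟩
    | insert V t _ iht =>
      have hV : V ∈ 𝒰 := ht (by simp)
      have htU : (t : Set (Opens X)) ⊆ 𝒰 := fun x hx => ht (by simp [Finset.mem_coe.mp hx])
      have htW : t.sup id ≤ W := Finset.sup_le fun x hx => (htU hx).1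
      rw [Finset.sup_insert, id_eq] at hzt
      obtain ⟨z', hz', e, he, rfl⟩ := K.small hzt (by rw [hdz]; exact Submodule.zero_mem _)
      obtain ⟨z₁, hz₁, z₂, hz₂, rfl⟩ := Submodule.mem_sup.mp hz'
      rw [map_add, K.d_d, add_zero, map_add] at hdz
      have hdz' : K.d z₁ = - K.d z₂ := eq_neg_of_add_eq_zero_left hdz
      obtain ⟨y, hy, hdy⟩ := ih' (V ⊓ t.sup id) (inf_le_left.trans (hV.1.trans hW)) (K.d z₁)
        (K.inf (K.d_mem hz₁) (by rw [hdz']; exact Submodule.neg_mem _ (K.d_mem hz₂))) (K.d_d _)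
      obtain ⟨e₁, he₁, hde₁⟩ := hV.2 (z₁ - y)
        (Submodule.sub_mem _ hz₁ (K.mono inf_le_left hy)) (by rw [map_sub, hdy, sub_self])
      obtain ⟨e₂, he₂, hde₂⟩ := iht (z₂ + y) (by rw [map_add, hdy, hdz', add_neg_cancel]) htU
        (Submodule.add_mem _ hz₂ (K.mono inf_le_right hy))
      refine ⟨e₁ + e₂ + e, Submodule.add_mem _ (Submodule.add_mem _ he₁ he₂)
        (K.mono (sup_le hV.1 htW) he), ?_⟩
      rw [map_add, map_add, hde₁, hde₂]
      abel

/-- A chain map that preserves supports. -/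
structure Hom (K : LocalComplex X A) (L : LocalComplex X A') where
  /-- The underlying linear map. -/
  toFun : A →ₗ[ℚ] A'
  comm : ∀ c, toFun (K.d c) = L.d (toFun c)
  mem : ∀ {W n c}, c ∈ K.chains W n → toFun c ∈ L.chains W n

/-- The mapping cone. -/
def cone {K : LocalComplex X A} {L : LocalComplex X A'} (f : Hom K L) :
    LocalComplex X (A' × A) where
  d := LinearMap.prod (L.d ∘ₗ LinearMap.fst ℚ A' A + f.toFun ∘ₗ LinearMap.snd ℚ A' A)
    (-(K.d ∘ₗ LinearMap.snd ℚ A' A))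
  d_d c := by
    refine Prod.ext ?_ ?_
    · simp [L.d_d, f.comm]
    · simp [K.d_d]
  chains W n := (L.chains W n).prod (K.chains W (n - 1))
  d_mem hc := ⟨Submodule.add_mem _ (L.d_mem hc.1) (f.mem hc.2),
    Submodule.neg_mem _ (K.d_mem hc.2)⟩
  mono h hc := ⟨L.mono h hc.1, K.mono h hc.2⟩
  inf h h' := ⟨L.inf h.1 h'.1, K.inf h.2 h'.2⟩
  neg hn hc := Prod.ext (L.neg hn hc.1) (K.neg (by omega) hc.2)
  bot hc := Prod.ext (L.bot hc.1) (K.bot hc.2)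
  compact {𝒰 n c} hc := by
    classical
    obtain ⟨t₁, h₁, m₁⟩ := L.compact hc.1
    obtain ⟨t₂, h₂, m₂⟩ := K.compact hc.2
    refine ⟨t₁ ∪ t₂, ?_, L.mono (Finset.sup_mono Finset.subset_union_left) m₁,
      K.mono (Finset.sup_mono Finset.subset_union_right) m₂⟩
    rw [Finset.coe_union]
    exact Set.union_subset h₁ h₂
  small {W₁ W₂ n c} hc hdc := by
    obtain ⟨y, x⟩ := c
    obtain ⟨hy, hx⟩ := hc
    change y ∈ L.chains _ _ at hy
    change x ∈ K.chains _ _ at hx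
    obtain ⟨⟨y₁, x₁⟩, ⟨hy₁, hx₁⟩, ⟨y₂, x₂⟩, ⟨hy₂, hx₂⟩, hsum⟩ := Submodule.mem_sup.mp hdc
    obtain ⟨h1, h2⟩ := Prod.ext_iff.mp hsum
    change y₁ + y₂ = L.d y + f.toFun x at h1
    change x₁ + x₂ = - K.d x at h2
    obtain ⟨x', hx', e, he, hxe⟩ := K.small hx (by
      rw [← neg_neg (K.d x), ← h2]
      exact Submodule.neg_mem _ (Submodule.add_mem_sup hx₁ hx₂))
    rw [sub_add_cancel] at he
    have hfx' : f.toFun x' ∈ L.chains W₁ (n - 1) ⊔ L.chains W₂ (n - 1) := by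
      obtain ⟨a, ha, b, hb, rfl⟩ := Submodule.mem_sup.mp hx'
      rw [map_add]
      exact Submodule.add_mem_sup (f.mem ha) (f.mem hb)
    obtain ⟨y', hy', e', he', hye⟩ := L.small (c := y + f.toFun e)
      (Submodule.add_mem _ hy (f.mem he)) (by
        have : L.d (y + f.toFun e) = (y₁ + y₂) - f.toFun x' := by
          rw [h1, hxe, map_add, map_add, f.comm]; abel
        rw [this]
        exact Submodule.sub_mem _ (Submodule.add_mem_sup hy₁ hy₂) hfx')
    obtain ⟨a, ha, b, hb, rfl⟩ := Submodule.mem_sup.mp hx'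
    obtain ⟨a', ha', b', hb', rfl⟩ := Submodule.mem_sup.mp hy'
    refine ⟨(a' + b', a + b), ?_, (e', -e), ⟨he', ?_⟩, Prod.ext ?_ ?_⟩
    · exact Submodule.mem_sup.mpr ⟨(a', a), ⟨ha', ha⟩, (b', b), ⟨hb', hb⟩, rfl⟩
    · rw [add_sub_cancel_right]
      exact Submodule.neg_mem _ he
    · change y = a' + b' + (L.d e' + f.toFun (-e))
      rw [map_neg, ← add_assoc, ← hye, add_neg_cancel_right]
    · change x = a + b + -K.d (-e)
      rw [map_neg, neg_neg, hxe]

section Cone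

variable {K : LocalComplex X A} {L : LocalComplex X A'} (f : Hom K L)

theorem cone_d (y : A') (x : A) : (cone f).d (y, x) = (L.d y + f.toFun x, -K.d x) := rfl

/-- A chain map that is, near every point, injective and surjective in homology after shrinking
of neighbourhoods has an acyclic mapping cone. -/
theorem cone_acyclic (Ω : Opens X)
    (hinj : ∀ (n : ℤ) (W : Opens X), W ≤ Ω → ∀ x ∈ W, ∃ V ≤ W, x ∈ V ∧
      ∀ z ∈ K.chains V n, K.d z = 0 → (∃ e ∈ L.chains V (n + 1), L.d e = f.toFun z) →
        ∃ e ∈ K.chains W (n + 1), K.d e = z)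
    (hsurj : ∀ (n : ℤ) (W : Opens X), W ≤ Ω → ∀ x ∈ W, ∃ V ≤ W, x ∈ V ∧
      ∀ y ∈ L.chains V n, L.d y = 0 → ∃ z ∈ K.chains W n, K.d z = 0 ∧
        ∃ e ∈ L.chains W (n + 1), y = f.toFun z + L.d e)
    (n : ℤ) (W : Opens X) (hW : W ≤ Ω) (z : A' × A) (hz : z ∈ (cone f).chains W n)
    (hdz : (cone f).d z = 0) : ∃ e ∈ (cone f).chains W (n + 1), (cone f).d e = z := by
  refine acyclic (cone f) Ω (fun n W hW x hx => ?_) n W hW z hz hdz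
  obtain ⟨V₁, hV₁W, hx₁, h₁⟩ := hsurj n W hW x hx
  obtain ⟨V₂, hV₂, hx₂, h₂⟩ := hinj (n - 1) V₁ (hV₁W.trans hW) x hx₁
  refine ⟨V₂, hV₂.trans hV₁W, hx₂, ?_⟩
  rintro ⟨y, x⟩ ⟨hy, hx⟩ hd
  rw [cone_d] at hd
  obtain ⟨hd1, hd2⟩ := Prod.ext_iff.mp hd
  simp only [Prod.fst_zero, Prod.snd_zero, neg_eq_zero] at hd1 hd2 hy hx
  obtain ⟨x', hx', hdx'⟩ := h₂ x hx hd2 ⟨-y, Submodule.neg_mem _ (by simpa using hy), by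
    rw [map_neg, eq_comm, eq_neg_iff_add_eq_zero, add_comm, hd1]⟩
  rw [sub_add_cancel] at hx'
  obtain ⟨z, hz, hdz, e, he, hye⟩ := h₁ (y + f.toFun x')
    (Submodule.add_mem _ (L.mono hV₂ hy) (f.mem hx'))
    (by rw [map_add, ← f.comm, hdx', hd1])
  refine ⟨(e, z - x'), ⟨he, ?_⟩, ?_⟩
  · rw [add_sub_cancel_right]
    exact Submodule.sub_mem _ hz (K.mono hV₁W hx')
  · rw [cone_d, map_sub, map_sub, hdz, hdx', zero_sub, neg_neg]
    refine Prod.ext ?_ rfl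
    rw [← add_sub_assoc, add_comm (L.d e), ← hye, add_sub_cancel_right]

/-- A map with acyclic mapping cone is surjective in homology. -/
theorem exists_of_cone_acyclic {n : ℤ} {W : Opens X}
    (h : ∀ z ∈ (cone f).chains W n, (cone f).d z = 0 →
      ∃ e ∈ (cone f).chains W (n + 1), (cone f).d e = z)
    {y : A'} (hy : y ∈ L.chains W n) (hdy : L.d y = 0) :
    ∃ z ∈ K.chains W n, K.d z = 0 ∧ ∃ e ∈ L.chains W (n + 1), y = f.toFun z + L.d e := by
  obtain ⟨⟨e, z⟩, ⟨he, hz⟩, hd⟩ := h (y, 0) ⟨hy, Submodule.zero_mem _⟩ (by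
    rw [cone_d, hdy, map_zero, map_zero, add_zero, neg_zero]; rfl)
  rw [cone_d] at hd
  obtain ⟨hd1, hd2⟩ := Prod.ext_iff.mp hd
  refine ⟨z, by simpa using hz, by simpa using hd2, e, he, ?_⟩
  rw [add_comm]
  exact hd1.symm

end Cone

/-! ### Invariants and direct sums of shifts -/

section Average

variable (K : LocalComplex X A) {G : Type*} [Group G] [Fintype G] [Invertible (Fintype.card G : ℚ)]
  (ρ : Representation ℚ G A)

theorem averageMap_mem (hρ : ∀ g {W n c}, c ∈ K.chains W n → ρ g c ∈ K.chains W n) {W n c}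
    (hc : c ∈ K.chains W n) : ρ.averageMap c ∈ K.chains W n ⊓ ρ.invariants := by
  refine ⟨?_, ρ.averageMap_invariant c⟩
  rw [Representation.averageMap, GroupAlgebra.average, map_smul, map_sum,
    LinearMap.smul_apply, LinearMap.sum_apply]
  refine Submodule.smul_mem _ _ (Submodule.sum_mem _ fun g _ => ?_)
  simpa using hρ g hc

theorem averageMap_d (hd : ∀ g c, ρ g (K.d c) = K.d (ρ g c)) (c : A) :
    ρ.averageMap (K.d c) = K.d (ρ.averageMap c) := by
  simp [Representation.averageMap, GroupAlgebra.average, hd]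

end Average

theorem invertible_card (G : Type*) [Group G] [Fintype G] :
    Nonempty (Invertible (Fintype.card G : ℚ)) :=
  ⟨invertibleOfNonzero (by exact_mod_cast Fintype.card_ne_zero)⟩

/-- The subcomplex of invariants under a finite group. -/
noncomputable def invariants (K : LocalComplex X A) {G : Type*} [Group G] [Fintype G]
    (ρ : Representation ℚ G A) (hd : ∀ g c, ρ g (K.d c) = K.d (ρ g c))
    (hρ : ∀ g {W n c}, c ∈ K.chains W n → ρ g c ∈ K.chains W n) : LocalComplex X A where
  d := K.d
  d_d := K.d_d
  chains W n := K.chains W n ⊓ ρ.invariants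
  d_mem hc := ⟨K.d_mem hc.1, fun g => by rw [hd, hc.2 g]⟩
  mono h hc := ⟨K.mono h hc.1, hc.2⟩
  inf h h' := ⟨K.inf h.1 h'.1, h.2⟩
  neg hn hc := K.neg hn hc.1
  bot hc := K.bot hc.1
  compact hc := by
    obtain ⟨t, ht, m⟩ := K.compact hc.1
    exact ⟨t, ht, m, hc.2⟩
  small {W₁ W₂ n c} hc hdc := by
    obtain ⟨_⟩ := invertible_card G
    have hav := fun {W n c} => K.averageMap_mem ρ hρ (W := W) (n := n) (c := c)
    have hle : K.chains W₁ (n - 1) ⊓ ρ.invariants ⊔ K.chains W₂ (n - 1) ⊓ ρ.invariants ≤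
        K.chains W₁ (n - 1) ⊔ K.chains W₂ (n - 1) := sup_le_sup inf_le_left inf_le_left
    obtain ⟨c', hc', e, he, hce⟩ := K.small hc.1 (hle hdc)
    refine ⟨ρ.averageMap c', ?_, ρ.averageMap e, hav he, ?_⟩
    · obtain ⟨a, ha, b, hb, rfl⟩ := Submodule.mem_sup.mp hc'
      rw [map_add]
      exact Submodule.add_mem_sup (hav ha) (hav hb)
    · rw [← K.averageMap_d ρ hd, ← map_add, ← hce, ρ.averageMap_id c hc.2]

/-- The chains of degree `n` in `W` of a direct sum of shifts of a complex. -/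
def shiftChains (K : LocalComplex X A) {ι : Type*} (q : ι → ℕ) (W : Opens X) (n : ℤ) :
    Submodule ℚ (ι →₀ A) where
  carrier := {c | ∀ i, c i ∈ K.chains W (n - q i)}
  add_mem' := fun ha hb i => Submodule.add_mem _ (ha i) (hb i)
  zero_mem' := fun _ => Submodule.zero_mem _
  smul_mem' := fun r _ ha i => Submodule.smul_mem _ r (ha i)

theorem mem_shiftChains {K : LocalComplex X A} {ι : Type*} {q : ι → ℕ} {W : Opens X} {n : ℤ}
    {c : ι →₀ A} : c ∈ shiftChains K q W n ↔ ∀ i, c i ∈ K.chains W (n - q i) := Iff.rfl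

theorem exists_small_shiftChains (K : LocalComplex X A) {ι : Type*} (q : ι → ℕ) {W₁ W₂ : Opens X}
    {n : ℤ} {c : ι →₀ A} (hc : c ∈ shiftChains K q (W₁ ⊔ W₂) n)
    (hdc : Finsupp.mapRange.linearMap K.d c ∈
      shiftChains K q W₁ (n - 1) ⊔ shiftChains K q W₂ (n - 1)) :
    ∃ c' ∈ shiftChains K q W₁ n ⊔ shiftChains K q W₂ n,
      ∃ e ∈ shiftChains K q (W₁ ⊔ W₂) (n + 1), c = c' + Finsupp.mapRange.linearMap K.d e := by
  have key : ∀ i, ∃ a ∈ K.chains W₁ (n - q i), ∃ b ∈ K.chains W₂ (n - q i),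
      ∃ e ∈ K.chains (W₁ ⊔ W₂) (n - q i + 1), c i = a + b + K.d e ∧
        (c i = 0 → a = 0 ∧ b = 0 ∧ e = 0) := by
    intro i
    by_cases hi : c i = 0
    · exact ⟨0, Submodule.zero_mem _, 0, Submodule.zero_mem _, 0, Submodule.zero_mem _,
        by simp [hi]⟩
    · obtain ⟨a, ha, b, hb, hab⟩ := Submodule.mem_sup.mp hdc
      have hai := ha i
      have hbi := hb i
      have hi' : a i + b i = K.d (c i) := by
        have := DFunLike.congr_fun hab i
        simpa using this
      rw [sub_right_comm] at hai hbi
      obtain ⟨c', hc', e, he, hce⟩ := K.small (hc i)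
        (by rw [← hi']; exact Submodule.add_mem_sup hai hbi)
      obtain ⟨a', ha', b', hb', rfl⟩ := Submodule.mem_sup.mp hc'
      exact ⟨a', ha', b', hb', e, he, hce, fun h => absurd h hi⟩
  choose a ha b hb e he hce h0 using key
  have hs : ∀ i, c i ≠ 0 → i ∈ c.support := fun i hi => Finsupp.mem_support_iff.mpr hi
  refine ⟨Finsupp.onFinset c.support a (fun i hi => hs i fun h => hi (h0 i h).1) +
      Finsupp.onFinset c.support b (fun i hi => hs i fun h => hi (h0 i h).2.1),
    Submodule.add_mem_sup (mem_shiftChains.mpr fun i => ha i) (mem_shiftChains.mpr fun i => hb i),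
    Finsupp.onFinset c.support e fun i hi => hs i fun h => hi (h0 i h).2.2, fun i => ?_, ?_⟩
  · have := he i
    rw [sub_add_eq_add_sub] at this
    exact this
  · ext i
    simpa using hce i

/-- The direct sum of copies of a complex, the copy with index `i` being shifted by `q i`. -/
noncomputable def shiftSum (K : LocalComplex X A) {ι : Type*} (q : ι → ℕ) :
    LocalComplex X (ι →₀ A) where
  d := Finsupp.mapRange.linearMap K.d
  d_d c := by ext i; simp [K.d_d]
  chains := shiftChains K q
  d_mem {W n c} hc i := by
    have := K.d_mem (hc i)
    rw [sub_right_comm] at this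
    simpa using this
  mono h hc i := K.mono h (hc i)
  inf h h' i := K.inf (h i) (h' i)
  neg hn hc := Finsupp.ext fun i => K.neg (by omega) (hc i)
  bot hc := Finsupp.ext fun i => K.bot (hc i)
  compact {𝒰 n c} hc := by
    classical
    choose t ht m using fun i => K.compact (hc i)
    refine ⟨c.support.biUnion t, ?_, fun i => ?_⟩
    · rw [Finset.coe_biUnion]
      exact Set.iUnion₂_subset fun i _ => ht i
    · by_cases hi : i ∈ c.support
      · exact K.mono (Finset.sup_mono (Finset.subset_biUnion_of_mem t hi)) (m i)
      · rw [Finsupp.notMem_support_iff.mp hi]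
        exact Submodule.zero_mem _
  small hc hdc := exists_small_shiftChains K q hc hdc

/-- Primitives in a shifted sum can be chosen in each component separately. -/
theorem exists_d_eq_shiftSum (K : LocalComplex X A) {ι : Type*} (q : ι → ℕ) {W : Opens X} {n : ℤ}
    {c : ι →₀ A} (h : ∀ i, ∃ e ∈ K.chains W (n + 1 - q i), K.d e = c i) :
    ∃ e ∈ (K.shiftSum q).chains W (n + 1), (K.shiftSum q).d e = c := by
  have key : ∀ i, ∃ e ∈ K.chains W (n + 1 - q i), K.d e = c i ∧ (c i = 0 → e = 0) := by
    intro i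
    by_cases hc : c i = 0
    · exact ⟨0, Submodule.zero_mem _, by rw [hc, map_zero], fun _ => rfl⟩
    · obtain ⟨e, he, hde⟩ := h i
      exact ⟨e, he, hde, fun h => absurd h hc⟩
  choose e he hde h0 using key
  refine ⟨Finsupp.onFinset c.support e fun i hi => Finsupp.mem_support_iff.mpr fun hc =>
    hi (h0 i hc), fun i => he i, Finsupp.ext fun i => ?_⟩
  exact hde i

end LocalComplex

namespace SingularCohomology

universe u v

theorem exists_finset_mem_chainsIn {E : Type u} {X : Type v} [TopologicalSpace E]
    [TopologicalSpace X] (π : C(E, X)) {𝒰 : Set (Opens X)} {n : ℤ} {c : SingularChain E}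
    (hc : c ∈ SingularChain.chainsIn (π ⁻¹' ((sSup 𝒰 : Opens X) : Set X)) n) :
    ∃ t : Finset (Opens X), (t : Set (Opens X)) ⊆ 𝒰 ∧
      c ∈ SingularChain.chainsIn (π ⁻¹' ((t.sup id : Opens X) : Set X)) n := by
  classical
  have key : ∀ s : Σ n : ℕ, Simplex E n, s ∈ c.support → ∃ t : Finset (Opens X),
      (t : Set (Opens X)) ⊆ 𝒰 ∧ Set.range s.2 ⊆ π ⁻¹' ((t.sup id : Opens X) : Set X) := by
    rintro ⟨k, σ⟩ hs
    have hσ := ((Finsupp.mem_supported ℚ c).mp hc hs).2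
    have hK : IsCompact (Set.range (π ∘ σ)) :=
      isCompact_range (π.continuous.comp σ.continuous)
    obtain ⟨t, ht⟩ := hK.elim_finite_subcover (fun U : 𝒰 => ((U : Opens X) : Set X))
      (fun U => U.1.isOpen) (by
        rintro _ ⟨x, rfl⟩
        have : π (σ x) ∈ sSup 𝒰 := hσ ⟨x, rfl⟩
        obtain ⟨U, hU, hx⟩ := Opens.mem_sSup.mp this
        exact Set.mem_iUnion.mpr ⟨⟨U, hU⟩, hx⟩)
    refine ⟨t.image Subtype.val, ?_, ?_⟩
    · intro U hU
      obtain ⟨U', -, rfl⟩ := Finset.mem_image.mp (Finset.mem_coe.mp hU)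
      exact U'.2
    · rintro _ ⟨x, rfl⟩
      obtain ⟨U, hUt, hxU⟩ := Set.mem_iUnion₂.mp (ht ⟨x, rfl⟩)
      have hle : (U : Opens X) ≤ (t.image Subtype.val).sup id :=
        Finset.le_sup (f := id) (Finset.mem_image_of_mem _ hUt)
      exact hle hxU
  choose! t ht htr using key
  refine ⟨c.support.biUnion t, ?_, (Finsupp.mem_supported ℚ c).mpr fun s hs =>
    ⟨((Finsupp.mem_supported ℚ c).mp hc hs).1, (htr s hs).trans ?_⟩⟩
  · rw [Finset.coe_biUnion]
    exact Set.iUnion₂_subset ht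
  · have h : (t s).sup id ≤ (c.support.biUnion t).sup id :=
      Finset.sup_mono (Finset.subset_biUnion_of_mem t hs)
    exact Set.preimage_mono h

/-- The singular chains of a space `E` over `X`, with the supports given by the preimages of the
open sets of `X`. -/
noncomputable def singularComplex {E : Type u} {X : Type v} [TopologicalSpace E]
    [TopologicalSpace X] (π : C(E, X)) : LocalComplex X (SingularChain E) where
  d := SingularChain.d
  d_d := SingularChain.d_d
  chains W n := SingularChain.chainsIn (π ⁻¹' W) n
  d_mem hc := SingularChain.d_mem_chainsIn hc
  mono h hc := SingularChain.chainsIn_mono (Set.preimage_mono h) _ hc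
  inf {W W' n c} h h' := by
    have h₁ : c ∈ SingularChain.chainsIn (π ⁻¹' (W : Set X)) n := h
    have h₂ : c ∈ SingularChain.chainsIn (π ⁻¹' (W' : Set X)) n := h'
    rw [SingularChain.chainsIn, Finsupp.mem_supported] at h₁ h₂
    exact (Finsupp.mem_supported ℚ c).mpr fun s hs =>
      ⟨(h₁ hs).1, Set.subset_inter (h₁ hs).2 (h₂ hs).2⟩
  neg {W n c} hn hc := by
    have : c ∈ Finsupp.supported ℚ ℚ (∅ : Set (Σ n : ℕ, Simplex E n)) := by
      refine Finsupp.supported_mono (fun s hs => ?_) hc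
      have := hs.1
      omega
    simpa using this
  bot {n c} hc := by
    have : c ∈ Finsupp.supported ℚ ℚ (∅ : Set (Σ n : ℕ, Simplex E n)) := by
      refine Finsupp.supported_mono (fun s hs => ?_) hc
      exact hs.2 ⟨stdSimplex.vertex 0, rfl⟩
    simpa using this
  compact {𝒰 n c} hc := by
    exact exists_finset_mem_chainsIn π hc
  small {W₁ W₂ n c} hc hdc :=
    exists_small (W₁.isOpen.preimage π.continuous) (W₂.isOpen.preimage π.continuous) hc hdc

/-! ### Null-homotopies and chains -/

section

variable {X : Type u} {Y : Type v} [TopologicalSpace X] [TopologicalSpace Y]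

/-- The constant simplex. -/
abbrev constSimplex (x : X) (n : ℕ) : Simplex X n := ContinuousMap.const _ x

theorem constSimplex_pull (x : X) {m n : ℕ} (f : Fin (m + 1) → Fin (n + 1)) :
    (constSimplex x n).pull f = constSimplex x m := rfl

/-- The operator that raises the degree of constant simplices by one. -/
noncomputable def raise : SingularChain X →ₗ[ℚ] SingularChain X :=
  SingularChain.lift fun n σ => SingularChain.of (constSimplex (σ (stdSimplex.vertex 0)) (n + 1))

theorem raise_of {n : ℕ} (σ : Simplex X n) : raise (SingularChain.of σ) =
    SingularChain.of (constSimplex (σ (stdSimplex.vertex 0)) (n + 1)) :=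
  SingularChain.lift_of (fun n (σ : Simplex X n) =>
    SingularChain.of (constSimplex (σ (stdSimplex.vertex 0)) (n + 1))) σ

theorem d_raise_const (x : X) (n : ℕ) :
    SingularChain.d (raise (SingularChain.of (constSimplex x (n + 1)))) +
      raise (SingularChain.d (SingularChain.of (constSimplex x (n + 1)))) =
        SingularChain.of (constSimplex x (n + 1)) := by
  rw [raise_of, SingularChain.d_of_succ, SingularChain.d_of_succ, map_sum, Fin.sum_univ_succ]
  simp only [map_smul, raise_of, constSimplex_pull]
  rw [add_assoc]
  simp only [ContinuousMap.const_apply, Fin.val_zero, pow_zero, one_smul]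
  rw [← Finset.sum_add_distrib, Finset.sum_eq_zero, add_zero]
  intro i _
  rw [Fin.val_succ, pow_succ, mul_neg_one, neg_smul]
  exact neg_add_cancel _

/-- Cycles of positive degree that are composed of constant simplices are boundaries. -/
theorem exists_d_eq_of_const {D : Set X} {n : ℤ} (hn : n ≠ 0) {c : SingularChain X}
    (hc : c ∈ Finsupp.supported ℚ ℚ {s : Σ n : ℕ, Simplex X n | (s.1 : ℤ) = n ∧
      ∃ x ∈ D, s.2 = constSimplex x s.1}) (hdc : SingularChain.d c = 0) :
    ∃ e ∈ SingularChain.chainsIn D (n + 1), SingularChain.d e = c := by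
  refine ⟨raise c, ?_, ?_⟩
  · refine TupleChain.supported_induction _ _ ?_ hc
    rintro ⟨k, σ⟩ ⟨rfl, x, hx, hσ⟩
    obtain rfl : σ = constSimplex x k := hσ
    change raise (SingularChain.of (constSimplex x k)) ∈ _
    rw [raise_of]
    have := SingularChain.of_mem_chainsIn (W := D) (σ := constSimplex x (k + 1))
      (by rintro _ ⟨y, rfl⟩; exact hx)
    exact_mod_cast this
  · have h : (SingularChain.d ∘ₗ raise + raise ∘ₗ SingularChain.d - LinearMap.id :
        SingularChain X →ₗ[ℚ] SingularChain X) c ∈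
        (⊥ : Submodule ℚ (SingularChain X)) := by
      refine TupleChain.supported_induction _ _ ?_ hc
      rintro ⟨k, σ⟩ ⟨rfl, x, hx, hσ⟩
      obtain rfl : σ = constSimplex x k := hσ
      rw [Submodule.mem_bot, LinearMap.sub_apply, sub_eq_zero]
      obtain ⟨k, rfl⟩ : ∃ k', k = k' + 1 := ⟨k - 1, by simp at hn; omega⟩
      exact d_raise_const x k
    rw [Submodule.mem_bot, LinearMap.sub_apply, sub_eq_zero] at h
    simpa [hdc] using h

/-- The augmentation: the sum of the coefficients of the simplices of degree zero. -/
noncomputable def augmentation : SingularChain X →ₗ[ℚ] ℚ :=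
  SingularChain.lift fun n _ => if n = 0 then 1 else 0

theorem augmentation_of_zero (σ : Simplex X 0) : augmentation (SingularChain.of σ) = 1 := by
  rw [augmentation, SingularChain.lift_of, if_pos rfl]

theorem augmentation_d (c : SingularChain X) : augmentation (SingularChain.d c) = 0 := by
  suffices h : augmentation ∘ₗ SingularChain.d = (0 : SingularChain X →ₗ[ℚ] ℚ) from
    LinearMap.congr_fun h c
  refine SingularChain.hom_ext fun n σ => ?_
  rw [LinearMap.comp_apply, LinearMap.zero_apply]
  match n, σ with
  | 0, σ => rw [SingularChain.d_of_zero, map_zero]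
  | 1, σ =>
    rw [SingularChain.d_of_succ, map_sum, Fin.sum_univ_two]
    simp only [map_smul, augmentation_of_zero]
    simp
  | n + 2, σ =>
    rw [SingularChain.d_of_succ, map_sum]
    refine Finset.sum_eq_zero fun i _ => ?_
    rw [map_smul, augmentation, SingularChain.lift_of, if_neg (by omega), smul_zero]

theorem augmentation_map (f : C(X, Y)) (c : SingularChain X) :
    augmentation (SingularChain.map f c) = augmentation c := by
  suffices h : augmentation ∘ₗ SingularChain.map f = augmentation from LinearMap.congr_fun h c
  refine SingularChain.hom_ext fun n σ => ?_
  rw [LinearMap.comp_apply, SingularChain.map_of, augmentation, SingularChain.lift_of,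
    augmentation, SingularChain.lift_of]

theorem simplex_zero_eq_const (σ : Simplex X 0) :
    σ = constSimplex (σ (stdSimplex.vertex 0)) 0 :=
  ContinuousMap.ext fun x => congrArg σ (by
    refine Subtype.ext (funext fun i => ?_)
    have h1 := x.2.2
    have h2 : i = 0 := Fin.fin_one_eq_zero i
    subst h2
    simpa using h1)

/-! Chains of a subspace -/

theorem map_val_injective (S : Set X) : Function.Injective
    (SingularChain.map (⟨Subtype.val, continuous_subtype_val⟩ : C(S, X))) := by
  have h : SingularChain.map (⟨Subtype.val, continuous_subtype_val⟩ : C(S, X)) =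
      Finsupp.lmapDomain ℚ ℚ (fun s : Σ n : ℕ, Simplex S n => (⟨s.1,
        (⟨Subtype.val, continuous_subtype_val⟩ : C(S, X)).comp s.2⟩ : Σ n : ℕ, Simplex X n)) := by
    refine SingularChain.hom_ext fun n σ => ?_
    rw [SingularChain.map_of, Finsupp.lmapDomain_apply, Finsupp.mapDomain_single]
  rw [h]
  refine Finsupp.mapDomain_injective ?_
  rintro ⟨m, σ⟩ ⟨n, τ⟩ hst
  obtain ⟨h1, h2⟩ := Sigma.mk.inj_iff.mp hst
  simp only at h1
  subst h1
  congr 1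
  exact ContinuousMap.ext fun x => Subtype.ext (ContinuousMap.congr_fun (eq_of_heq h2) x)

theorem exists_map_val_eq {S : Set X} {n : ℤ} {c : SingularChain X}
    (hc : c ∈ SingularChain.chainsIn S n) :
    ∃ c' ∈ SingularChain.chainsIn (Set.univ : Set S) n,
      SingularChain.map (⟨Subtype.val, continuous_subtype_val⟩ : C(S, X)) c' = c := by
  refine SingularChain.chainsIn_induction LinearMap.id ((SingularChain.chainsIn
    (Set.univ : Set S) n).map (SingularChain.map ⟨Subtype.val, continuous_subtype_val⟩)) ?_ hc
  rintro k σ rfl hσ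
  refine ⟨SingularChain.of (⟨fun x => ⟨σ x, hσ ⟨x, rfl⟩⟩, by fun_prop⟩ : Simplex S k),
    SingularChain.of_mem_chainsIn (Set.subset_univ _), ?_⟩
  rw [SingularChain.map_of]
  rfl

/-- A homotopy inside `P` from the inclusion of `S` to a map `f` moves cycles in `S` to homologous
cycles. -/
theorem exists_homologous {S P : Set X} {f : C(S, X)}
    (H : ContinuousMap.Homotopy (⟨Subtype.val, continuous_subtype_val⟩ : C(S, X)) f)
    (hP : ∀ s x, H (s, x) ∈ P) {n : ℤ} {z : SingularChain X}
    (hz : z ∈ SingularChain.chainsIn S n) (hdz : SingularChain.d z = 0) :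
    ∃ z' ∈ SingularChain.chainsIn (Set.univ : Set S) n, SingularChain.d z' = 0 ∧
      SingularChain.map (⟨Subtype.val, continuous_subtype_val⟩ : C(S, X)) z' = z ∧
      ∃ e ∈ SingularChain.chainsIn P (n + 1),
        z = SingularChain.map f z' + SingularChain.d e := by
  obtain ⟨z', hz', rfl⟩ := exists_map_val_eq hz
  have hdz' : SingularChain.d z' = 0 := by
    refine map_val_injective S ?_
    rw [SingularChain.map_d, hdz, map_zero]
  refine ⟨z', hz', hdz', rfl, -chainHomotopy H z',
    Submodule.neg_mem _ (chainHomotopy_mem_chainsIn H hP hz'), ?_⟩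
  have h := d_chainHomotopy H z'
  rw [hdz', map_zero, add_zero] at h
  rw [map_neg, h]
  abel

theorem exists_open_homotopic_const (hX : LocallyContractibleSpace X) {W : Set X}
    (hW : IsOpen W) {x : X} (hx : x ∈ W) :
    ∃ V : Set X, IsOpen V ∧ x ∈ V ∧ V ⊆ W ∧ ∃ H : ContinuousMap.Homotopy
      (⟨Subtype.val, continuous_subtype_val⟩ : C(V, X)) (ContinuousMap.const V x),
        ∀ s v, H (s, v) ∈ W := by
  obtain ⟨V', hVW, hV', y, ⟨H⟩⟩ := hX x W (hW.mem_nhds hx)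
  obtain ⟨V, hVV', hV, hxV⟩ := mem_nhds_iff.mp hV'
  -- Transport the given null-homotopy to one that ends at `x`, along the track of `x`.
  let x' : V' := ⟨x, hVV' hxV⟩
  let H₁ : ContinuousMap.Homotopy (⟨Subtype.val, continuous_subtype_val⟩ : C(V, X))
      (ContinuousMap.const V y.1) :=
    { toFun := fun p => (H (p.1, ⟨p.2.1, hVV' p.2.2⟩)).1
      continuous_toFun := by fun_prop
      map_zero_left := fun v => by rw [H.apply_zero]; rfl
      map_one_left := fun v => by rw [H.apply_one]; rfl }
  let H₂ : ContinuousMap.Homotopy (ContinuousMap.const V y.1) (ContinuousMap.const V x) :=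
    { toFun := fun p => (H.symm (p.1, x')).1
      continuous_toFun := by fun_prop
      map_zero_left := fun v => by rw [H.symm.apply_zero]; rfl
      map_one_left := fun v => by rw [H.symm.apply_one]; rfl }
  refine ⟨V, hV, hxV, hVV'.trans hVW, H₁.trans H₂, fun s v => ?_⟩
  rw [ContinuousMap.Homotopy.trans_apply]
  split_ifs
  · exact (H _).2
  · exact (H.symm _).2

/-- Cycles of nonzero degree bound where they can be contracted. -/
theorem exists_d_eq_of_homotopy_const {V W : Set X} {x : X}
    (H : ContinuousMap.Homotopy (⟨Subtype.val, continuous_subtype_val⟩ : C(V, X))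
      (ContinuousMap.const V x)) (hW : ∀ s v, H (s, v) ∈ W) (hx : x ∈ W)
    {n : ℤ} (hn : n ≠ 0) {z : SingularChain X}
    (hz : z ∈ SingularChain.chainsIn V n) (hdz : SingularChain.d z = 0) :
    ∃ e ∈ SingularChain.chainsIn W (n + 1), SingularChain.d e = z := by
  obtain ⟨z', hz', hdz', -, e, he, hze⟩ := exists_homologous H hW hz hdz
  obtain ⟨e', he', hde'⟩ := exists_d_eq_of_const (D := {x}) hn
    (c := SingularChain.map (ContinuousMap.const V x) z') (by
      refine SingularChain.chainsIn_induction _ _ ?_ hz'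
      rintro k σ rfl -
      rw [SingularChain.map_of]
      exact Finsupp.single_mem_supported _ _ ⟨rfl, x, rfl, rfl⟩)
    (by rw [← SingularChain.map_d, hdz', map_zero])
  refine ⟨e' + e, Submodule.add_mem _ (SingularChain.chainsIn_mono (by simpa) _ he') he, ?_⟩
  rw [map_add, hde', ← hze]

/-- Zero-chains can be moved to a point where they can be contracted. -/
theorem exists_eq_augmentation_smul_of_homotopy_const {V W : Set X} {x : X}
    (H : ContinuousMap.Homotopy (⟨Subtype.val, continuous_subtype_val⟩ : C(V, X))
      (ContinuousMap.const V x)) (hW : ∀ s v, H (s, v) ∈ W)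
    {z : SingularChain X}
    (hz : z ∈ SingularChain.chainsIn V 0) :
    ∃ e ∈ SingularChain.chainsIn W 1,
      z = augmentation z • SingularChain.of (constSimplex x 0) + SingularChain.d e := by
  have hz0 : ∀ (k : ℕ) (σ : Simplex X k), (k : ℤ) = 0 →
      SingularChain.d (SingularChain.of σ) = 0 := by
    intro k σ hk
    obtain rfl : k = 0 := by exact_mod_cast hk
    exact SingularChain.d_of_zero σ
  have hdz : SingularChain.d z ∈ (⊥ : Submodule ℚ (SingularChain X)) :=
    SingularChain.chainsIn_induction _ _ (fun k σ hk _ => hz0 k σ hk) hz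
  obtain ⟨z', hz', hdz', hzz', e, he, hze⟩ := exists_homologous H hW hz hdz
  refine ⟨e, by simpa using he, ?_⟩
  have h : (SingularChain.map (ContinuousMap.const V x) -
      (LinearMap.toSpanSingleton ℚ _ (SingularChain.of (constSimplex x 0))) ∘ₗ augmentation :
        SingularChain V →ₗ[ℚ] SingularChain X) z' ∈
        (⊥ : Submodule ℚ (SingularChain X)) := by
    refine SingularChain.chainsIn_induction _ _ ?_ hz'
    intro k σ hk _
    obtain rfl : k = 0 := by exact_mod_cast hk
    rw [Submodule.mem_bot, LinearMap.sub_apply, LinearMap.comp_apply, augmentation_of_zero,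
      SingularChain.map_of, LinearMap.toSpanSingleton_apply, one_smul]
    exact sub_self _
  rw [Submodule.mem_bot, LinearMap.sub_apply, sub_eq_zero, LinearMap.comp_apply,
    LinearMap.toSpanSingleton_apply] at h
  rw [h] at hze
  rwa [← hzz', augmentation_map, hzz']

end

/-! ### Chains of the quotient by a finite group -/

/-- Homotopies on disjoint open sets that contract them to points can be glued. -/
theorem exists_homotopy_iUnion {X : Type u} [TopologicalSpace X] {D P : Set X} {O : X → Set X}
    (hO : ∀ x ∈ D, IsOpen (O x)) (hdisj : D.PairwiseDisjoint O)
    (H : ∀ x ∈ D, ContinuousMap.Homotopy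
      (⟨Subtype.val, continuous_subtype_val⟩ : C(O x, X)) (ContinuousMap.const (O x) x))
    (hP : ∀ (x) (hx : x ∈ D) (s v), H x hx (s, v) ∈ P) :
    ∃ f : C((⋃ x ∈ D, O x : Set X), X), (∀ s, f s ∈ D) ∧ ∃ H' : ContinuousMap.Homotopy
      (⟨Subtype.val, continuous_subtype_val⟩ : C((⋃ x ∈ D, O x : Set X), X)) f,
        ∀ s v, H' (s, v) ∈ P := by
  have hmem : ∀ s : (⋃ x ∈ D, O x : Set X), ∃ x, ∃ _ : x ∈ D, s.1 ∈ O x := fun s =>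
    Set.mem_iUnion₂.mp s.2
  choose k hkD hkO using hmem
  have hk : ∀ x ∈ D, ∀ s : (⋃ x ∈ D, O x : Set X), s.1 ∈ O x → k s = x := by
    intro x hx s hs
    by_contra hne
    exact Set.disjoint_left.mp (hdisj (hkD s) hx hne) (hkO s) hs
  let F : unitInterval × (⋃ x ∈ D, O x : Set X) → X :=
    fun p => H (k p.2) (hkD p.2) (p.1, ⟨p.2.1, hkO p.2⟩)
  have hF : ∀ (x) (hx : x ∈ D) (p) (hp : p.2.1 ∈ O x), F p = H x hx (p.1, ⟨p.2.1, hp⟩) := by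
    intro x hx p hp
    have : ∀ (y) (hy : y ∈ D) (hpy : p.2.1 ∈ O y), y = x →
        H y hy (p.1, ⟨p.2.1, hpy⟩) = H x hx (p.1, ⟨p.2.1, hp⟩) := by
      rintro y hy hpy rfl
      rfl
    exact this _ _ _ (hk x hx p.2 hp)
  have hFc : Continuous F := by
    refine continuous_iff_continuousAt.mpr fun p => ?_
    let T : Set (unitInterval × (⋃ x ∈ D, O x : Set X)) := {q | q.2.1 ∈ O (k p.2)}
    have hT : IsOpen T := (hO _ (hkD p.2)).preimage (by fun_prop)
    have hTF : ContinuousOn F T := by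
      rw [continuousOn_iff_continuous_domRestrict]
      have : T.domRestrict F = fun q => H (k p.2) (hkD p.2) (q.1.1, ⟨q.1.2.1, q.2⟩) :=
        funext fun q => hF _ _ _ q.2
      rw [this]
      fun_prop
    exact hTF.continuousAt (hT.mem_nhds (hkO p.2))
  refine ⟨⟨fun s => F (1, s), by fun_prop⟩, fun s => ?_,
    { toFun := F, continuous_toFun := hFc, map_zero_left := fun s => ?_,
      map_one_left := fun s => rfl }, fun s v => hP _ _ _ _⟩
  · change H (k s) (hkD s) (1, ⟨s.1, hkO s⟩) ∈ D
    rw [(H (k s) (hkD s)).apply_one]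
    exact hkD s
  · change H (k s) (hkD s) (0, ⟨s.1, hkO s⟩) = _
    rw [(H (k s) (hkD s)).apply_zero]
    rfl

section Quotient

variable {X : Type u} {Y : Type v} [TopologicalSpace X] [TopologicalSpace Y] (G : Type*) [Group G]
  [MulAction G X] [ContinuousConstSMul G X]

/-- The action of a group on the singular chains of a space on which it acts. -/
noncomputable def chainRep (X : Type u) [TopologicalSpace X] [MulAction G X]
    [ContinuousConstSMul G X] : Representation ℚ G (SingularChain X) where
  toFun g := SingularChain.map ⟨fun x => g • x, continuous_const_smul g⟩
  map_one' := by
    refine LinearMap.ext fun c => Eq.trans ?_ (SingularChain.map_id c)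
    congr 2
    exact ContinuousMap.ext fun x => one_smul G x
  map_mul' g h := by
    refine LinearMap.ext fun c => Eq.trans ?_ (SingularChain.map_map _ _ c).symm
    congr 2
    exact ContinuousMap.ext fun x => mul_smul g h x

theorem chainRep_apply (g : G) (c : SingularChain X) :
    chainRep G X g c = SingularChain.map ⟨fun x => g • x, continuous_const_smul g⟩ c := rfl

variable {G}

theorem chainRep_mem {π : C(X, Y)} (hπ : ∀ (g : G) (x : X), π (g • x) = π x) (g : G)
    {W : Opens Y} {n : ℤ} {c : SingularChain X} (hc : c ∈ (singularComplex π).chains W n) :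
    chainRep G X g c ∈ (singularComplex π).chains W n := by
  refine SingularChain.map_mem_chainsIn (fun x hx => ?_) hc
  change π (g • x) ∈ W
  rw [hπ]
  exact hx

theorem map_chainRep {π : C(X, Y)} (hπ : ∀ (g : G) (x : X), π (g • x) = π x) (g : G)
    (c : SingularChain X) : SingularChain.map π (chainRep G X g c) = SingularChain.map π c := by
  rw [chainRep_apply, SingularChain.map_map]
  congr 2
  exact ContinuousMap.ext fun x => hπ g x

theorem map_averageMap [Fintype G] [Invertible (Fintype.card G : ℚ)] {π : C(X, Y)}
    (hπ : ∀ (g : G) (x : X), π (g • x) = π x) (c : SingularChain X) :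
    SingularChain.map π ((chainRep G X).averageMap c) = SingularChain.map π c := by
  simp only [Representation.averageMap, GroupAlgebra.average, map_smul, map_sum,
    LinearMap.smul_apply, LinearMap.sum_apply, MonoidAlgebra.of_apply,
    Representation.asAlgebraHom_single_one, map_chainRep hπ, Finset.sum_const, Finset.card_univ]
  rw [← Nat.cast_smul_eq_nsmul ℚ, smul_smul, invOf_mul_self, one_smul]

variable (G)

/-- The invariant chains of a space with an action of a finite group, with the supports given by
the open sets of a space under it. -/
noncomputable def invariantComplex [Fintype G] {π : C(X, Y)}
    (hπ : ∀ (g : G) (x : X), π (g • x) = π x) : LocalComplex Y (SingularChain X) :=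
  (singularComplex π).invariants (chainRep G X) (fun _ c => SingularChain.map_d _ c)
    (fun g _ _ _ hc => chainRep_mem hπ g hc)

/-- The map from the invariant chains of a space to the chains of the quotient. -/
noncomputable def invariantMap [Fintype G] {π : C(X, Y)}
    (hπ : ∀ (g : G) (x : X), π (g • x) = π x) :
    LocalComplex.Hom (invariantComplex G hπ) (singularComplex (ContinuousMap.id Y)) where
  toFun := SingularChain.map π
  comm c := SingularChain.map_d π c
  mem hc := SingularChain.map_mem_chainsIn (fun _ hx => hx) hc.1

/-- Near the fibre over `y`, an invariant cycle whose image bounds is the boundary of an invariant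
chain: it can be moved to the fibre, which is a finite set, and the homotopy that does so can be
averaged. In degree `0`, where constant simplices need not bound, averaging identifies the points
of the fibre, since they form one orbit. -/
theorem exists_nhds_invariantMap_injective [T2Space X] [Fintype G]
    (hX : LocallyContractibleSpace X) {π : C(X, Y)}
    (hπ : ∀ x x' : X, π x = π x' ↔ ∃ g : G, g • x' = x)
    (hπ' : ∀ (g : G) (x : X), π (g • x) = π x) (Ω : Opens Y)
    (hΩ : (Ω : Set Y) ⊆ Set.range π)
    (hopen : ∀ O : Set X, IsOpen O → O ⊆ π ⁻¹' Ω → IsOpen (π '' O))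
    (n : ℤ) (W : Opens Y) (hW : W ≤ Ω) (y : Y) (hy : y ∈ W) : ∃ V ≤ W, y ∈ V ∧
      ∀ z ∈ (invariantComplex G hπ').chains V n, SingularChain.d z = 0 →
        (∃ e ∈ (singularComplex (ContinuousMap.id Y)).chains V (n + 1),
          SingularChain.d e = SingularChain.map π z) →
        ∃ e ∈ (invariantComplex G hπ').chains W (n + 1), SingularChain.d e = z := by
  obtain ⟨_⟩ := LocalComplex.invertible_card G
  obtain ⟨x₀, hx₀⟩ := hΩ (hW hy)
  let D : Set X := π ⁻¹' {y}
  have hD : D = Set.range fun g : G => g • x₀ := by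
    ext x
    change π x = y ↔ _
    rw [← hx₀, hπ]
    rfl
  have hDf : D.Finite := hD ▸ Set.finite_range _
  obtain ⟨U, hU, hUd⟩ := hDf.t2_separation
  have hloc : ∀ x ∈ D, ∃ O : Set X, IsOpen O ∧ x ∈ O ∧ O ⊆ U x ∩ π ⁻¹' W ∧
      ∃ H : ContinuousMap.Homotopy (⟨Subtype.val, continuous_subtype_val⟩ : C(O, X))
        (ContinuousMap.const O x), ∀ s v, H (s, v) ∈ U x ∩ π ⁻¹' W := by
    intro x hx
    refine exists_open_homotopic_const hX ((hU x).2.inter (W.isOpen.preimage π.continuous))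
      ⟨(hU x).1, ?_⟩
    change π x ∈ W
    rw [show π x = y from hx]
    exact hy
  choose! O hOo hxO hOs hOH using hloc
  choose H hH using hOH
  obtain ⟨f, hfD, H', hH'⟩ := exists_homotopy_iUnion (P := π ⁻¹' W) hOo
    (hUd.mono_on fun x hx => (hOs x hx).trans Set.inter_subset_left) H
    (fun x hx s v => (hH x hx s v).2)
  let S₀ : Set X := ⋃ x ∈ D, O x
  have hS₀ : IsOpen S₀ := isOpen_biUnion hOo
  have hS₀W : S₀ ⊆ π ⁻¹' W := Set.iUnion₂_subset fun x hx => (hOs x hx).trans Set.inter_subset_right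
  -- An invariant neighbourhood of the fibre, so that its image determines it.
  let S : Set X := ⋂ g : G, (fun x => g • x) ⁻¹' S₀
  have hS : IsOpen S := isOpen_iInter_of_finite fun g => hS₀.preimage (continuous_const_smul g)
  have hSS₀ : S ⊆ S₀ := fun x hx => by simpa using Set.mem_iInter.mp hx 1
  let V : Opens Y := ⟨π '' S, hopen S hS ((hSS₀.trans hS₀W).trans (Set.preimage_mono hW))⟩
  have hVS₀ : π ⁻¹' V ⊆ S₀ := by
    rintro x ⟨s, hs, hsx⟩
    obtain ⟨g, rfl⟩ := (hπ x s).mp hsx.symm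
    exact Set.mem_iInter.mp hs g
  refine ⟨V, ?_, ⟨x₀, Set.mem_iInter.mpr fun g => ?_, hx₀⟩, ?_⟩
  · rintro _ ⟨s, hs, rfl⟩
    exact hS₀W (hSS₀ hs)
  · have hg : g • x₀ ∈ D := hD ▸ ⟨g, rfl⟩
    exact Set.mem_biUnion hg (hxO _ hg)
  rintro z ⟨hz, hzi⟩ hdz ⟨e', -, he'⟩
  obtain ⟨z', hz', hdz', hzz', e, he, hze⟩ :=
    exists_homologous H' hH' (SingularChain.chainsIn_mono hVS₀ n hz) hdz
  have hav : (chainRep G X).averageMap z = z := (chainRep G X).averageMap_id z hzi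
  -- Since the fibre is finite, the simplices of the moved cycle are constant.
  have hconst : SingularChain.map f z' ∈ Finsupp.supported ℚ ℚ
      {s : Σ n : ℕ, Simplex X n | (s.1 : ℤ) = n ∧ ∃ x ∈ D, s.2 = constSimplex x s.1} := by
    refine SingularChain.chainsIn_induction _ _ ?_ hz'
    rintro k σ rfl -
    rw [SingularChain.map_of]
    refine Finsupp.single_mem_supported _ _ ⟨rfl, f (σ (stdSimplex.vertex 0)), hfD _, ?_⟩
    refine ContinuousMap.ext fun t => ?_
    have hsub : (Set.range (f.comp σ)).Subsingleton := by
      by_contra hns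
      refine (isPreconnected_range (f.comp σ).continuous).infinite_of_nontrivial
        (Set.not_subsingleton_iff.mp hns) (hDf.subset ?_)
      rintro _ ⟨t, rfl⟩
      exact hfD _
    exact hsub ⟨t, rfl⟩ ⟨stdSimplex.vertex 0, rfl⟩
  have key : ∃ e₁ ∈ SingularChain.chainsIn (π ⁻¹' (W : Set Y)) (n + 1),
      (chainRep G X).averageMap (SingularChain.map f z') =
        (chainRep G X).averageMap (SingularChain.d e₁) := by
    by_cases hn : n = 0
    · subst hn
      refine ⟨0, Submodule.zero_mem _, ?_⟩
      rw [map_zero, map_zero]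
      have hmul : ∀ c ∈ Finsupp.supported ℚ ℚ {s : Σ n : ℕ, Simplex X n | (s.1 : ℤ) = 0 ∧
          ∃ x ∈ D, s.2 = constSimplex x s.1}, (chainRep G X).averageMap c =
          augmentation c • (chainRep G X).averageMap (SingularChain.of (constSimplex x₀ 0)) := by
        intro c hc
        rw [← sub_eq_zero, ← LinearMap.toSpanSingleton_apply, ← LinearMap.comp_apply,
          ← LinearMap.sub_apply, ← Submodule.mem_bot ℚ]
        refine TupleChain.supported_induction _ _ ?_ hc
        rintro ⟨k, σ⟩ ⟨hk, x, hx, hσ⟩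
        obtain rfl : k = 0 := by exact_mod_cast hk
        obtain rfl : σ = constSimplex x 0 := hσ
        rw [hD] at hx
        obtain ⟨g, rfl⟩ := hx
        rw [Submodule.mem_bot, LinearMap.sub_apply, LinearMap.comp_apply, augmentation_of_zero,
          LinearMap.toSpanSingleton_apply, one_smul, sub_eq_zero]
        have : SingularChain.of (constSimplex (g • x₀) 0) =
            chainRep G X g (SingularChain.of (constSimplex x₀ 0)) := by
          rw [chainRep_apply, SingularChain.map_of]
          rfl
        change (chainRep G X).averageMap (SingularChain.of (constSimplex (g • x₀) 0)) = _
        rw [this, Representation.averageMap, ← Representation.asAlgebraHom_single_one,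
          ← Module.End.mul_apply, ← map_mul, GroupAlgebra.mul_average_right]
      rw [hmul _ hconst]
      have : augmentation (SingularChain.map f z') = 0 := by
        rw [augmentation_map, ← augmentation_map ⟨Subtype.val, continuous_subtype_val⟩, hzz',
          ← augmentation_map π, ← he', augmentation_d]
      rw [this, zero_smul]
    · obtain ⟨e₁, he₁, hde₁⟩ := exists_d_eq_of_const hn hconst
        (by rw [← SingularChain.map_d, hdz', map_zero])
      refine ⟨e₁, SingularChain.chainsIn_mono ?_ _ he₁, by rw [hde₁]⟩
      intro x hx
      change π x ∈ W
      rw [show π x = y from hx]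
      exact hy
  obtain ⟨e₁, he₁, hav₁⟩ := key
  refine ⟨(chainRep G X).averageMap (e₁ + e),
    (singularComplex π).averageMap_mem (chainRep G X) (fun g _ _ _ hc => chainRep_mem hπ' g hc)
      (Submodule.add_mem _ he₁ he), ?_⟩
  have hd := (singularComplex π).averageMap_d (chainRep G X)
    (fun _ c => SingularChain.map_d _ c) (e₁ + e)
  refine hd.symm.trans ?_
  change (chainRep G X).averageMap (SingularChain.d (e₁ + e)) = z
  rw [map_add, map_add, ← hav₁, ← map_add, ← hze, hav]

/-- Near `y`, a cycle is homologous to the image of an invariant cycle: in positive degrees it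
bounds, and in degree `0` its points can be lifted and averaged. -/
theorem exists_nhds_invariantMap_surjective [Fintype G]
    (hY : LocallyContractibleSpace Y) {π : C(X, Y)}
    (hπ' : ∀ (g : G) (x : X), π (g • x) = π x) (Ω : Opens Y)
    (hΩ : (Ω : Set Y) ⊆ Set.range π)
    (n : ℤ) (W : Opens Y) (hW : W ≤ Ω) (y : Y) (hy : y ∈ W) : ∃ V ≤ W, y ∈ V ∧
      ∀ c ∈ (singularComplex (ContinuousMap.id Y)).chains V n, SingularChain.d c = 0 →
        ∃ z ∈ (invariantComplex G hπ').chains W n, SingularChain.d z = 0 ∧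
          ∃ e ∈ (singularComplex (ContinuousMap.id Y)).chains W (n + 1),
            c = SingularChain.map π z + SingularChain.d e := by
  obtain ⟨_⟩ := LocalComplex.invertible_card G
  obtain ⟨V, hV, hyV, hVW, H, hH⟩ := exists_open_homotopic_const hY W.isOpen hy
  refine ⟨⟨V, hV⟩, hVW, hyV, fun c hc hdc => ?_⟩
  by_cases hn : n = 0
  · subst hn
    have hcW := SingularChain.chainsIn_mono hVW 0 hc
    obtain ⟨z, hz, rfl⟩ : c ∈ ((invariantComplex G hπ').chains W 0).map (SingularChain.map π) := by
      refine SingularChain.chainsIn_induction LinearMap.id _ ?_ hcW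
      intro k σ hk hσ
      obtain rfl : k = 0 := by exact_mod_cast hk
      obtain ⟨x, hx⟩ := hΩ (hW (hσ ⟨stdSimplex.vertex 0, rfl⟩))
      refine ⟨(chainRep G X).averageMap (SingularChain.of (constSimplex x 0)),
        (singularComplex π).averageMap_mem (chainRep G X)
          (fun g _ _ _ hc => chainRep_mem hπ' g hc) (SingularChain.of_mem_chainsIn ?_), ?_⟩
      · rintro _ ⟨t, rfl⟩
        change π x ∈ W
        rw [hx]
        exact hσ ⟨_, rfl⟩
      · rw [map_averageMap hπ', SingularChain.map_of, LinearMap.id_apply, simplex_zero_eq_const σ,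
          ← hx]
        rfl
    refine ⟨z, hz, ?_, 0, Submodule.zero_mem _, by rw [map_zero, add_zero]⟩
    exact (invariantComplex G hπ').neg (by norm_num) ((invariantComplex G hπ').d_mem hz)
  · obtain ⟨e, he, hde⟩ := exists_d_eq_of_homotopy_const H hH hy hn hc hdc
    exact ⟨0, Submodule.zero_mem _, map_zero _, e, he, by rw [map_zero, zero_add, hde]⟩

/-- Rationally, every cycle of the quotient of a Hausdorff locally contractible space by a finite
group is, up to homology, the image of a cycle. In fact, the homology of the quotient is that of
the invariant chains. -/
theorem exists_cycle_lift [T2Space X] [Finite G] (hX : LocallyContractibleSpace X)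
    (hY : LocallyContractibleSpace Y) {π : C(X, Y)}
    (hπ : ∀ x x' : X, π x = π x' ↔ ∃ g : G, g • x' = x) {Ω : Opens Y}
    (hΩ : (Ω : Set Y) ⊆ Set.range π)
    (hopen : ∀ O : Set X, IsOpen O → O ⊆ π ⁻¹' Ω → IsOpen (π '' O))
    {n : ℤ} {W : Opens Y} (hW : W ≤ Ω) {c : SingularChain Y}
    (hc : c ∈ SingularChain.chainsIn (W : Set Y) n) (hdc : SingularChain.d c = 0) :
    ∃ z ∈ SingularChain.chainsIn (π ⁻¹' (W : Set Y)) n, SingularChain.d z = 0 ∧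
      ∃ e ∈ SingularChain.chainsIn (W : Set Y) (n + 1),
        c = SingularChain.map π z + SingularChain.d e := by
  have := Fintype.ofFinite G
  have hπ' : ∀ (g : G) (x : X), π (g • x) = π x := fun g x => (hπ _ _).mpr ⟨g, rfl⟩
  obtain ⟨z, hz, hdz, e, he, hce⟩ := LocalComplex.exists_of_cone_acyclic (invariantMap G hπ')
    (fun z hz hdz => LocalComplex.cone_acyclic (invariantMap G hπ') Ω
      (exists_nhds_invariantMap_injective G hX hπ hπ' Ω hΩ hopen)
      (exists_nhds_invariantMap_surjective G hY hπ' Ω hΩ) n W hW z hz hdz) hc hdc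
  exact ⟨z, hz.1, hdz, e, he, hce⟩

end Quotient

/-! ### Evaluation of cochains and the cap product -/

section Evaluation

variable {X : Type u} {Y : Type v} [TopologicalSpace X] [TopologicalSpace Y]

/-- Evaluation of a cochain of degree `n` on chains; it is zero on chains of other degrees. -/
noncomputable def ev {n : ℕ} : Cochain X n →ₗ[ℚ] SingularChain X →ₗ[ℚ] ℚ where
  toFun c := SingularChain.lift fun m σ => if h : m = n then c (h ▸ σ) else 0
  map_add' c c' := SingularChain.hom_ext fun m σ => by
    simp only [LinearMap.add_apply, SingularChain.lift_of]
    split_ifs <;> simp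
  map_smul' r c := SingularChain.hom_ext fun m σ => by
    simp only [LinearMap.smul_apply, SingularChain.lift_of]
    split_ifs <;> simp

theorem ev_of {n : ℕ} (c : Cochain X n) (σ : Simplex X n) : ev c (SingularChain.of σ) = c σ := by
  simp [ev]

theorem ev_of_ne {m n : ℕ} (h : m ≠ n) (c : Cochain X n) (σ : Simplex X m) :
    ev c (SingularChain.of σ) = 0 := by
  simp [ev, h]

theorem ev_eq_zero_of_ne {n : ℕ} {m : ℤ} (h : m ≠ n) (c : Cochain X n) {W : Set X}
    {x : SingularChain X} (hx : x ∈ SingularChain.chainsIn W m) : ev c x = 0 := by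
  rw [← Submodule.mem_bot ℚ]
  refine SingularChain.chainsIn_induction _ _ ?_ hx
  rintro k σ rfl -
  exact ev_of_ne (by exact_mod_cast h) c σ

theorem ev_coboundary {n : ℕ} (c : Cochain X n) (x : SingularChain X) :
    ev (coboundary X n c) x = ev c (SingularChain.d x) := by
  suffices h : ev (coboundary X n c) = ev c ∘ₗ SingularChain.d from LinearMap.congr_fun h x
  refine SingularChain.hom_ext fun m σ => ?_
  rw [LinearMap.comp_apply]
  cases m with
  | zero => rw [SingularChain.d_of_zero, map_zero, ev_of_ne (by omega)]
  | succ m =>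
    rw [SingularChain.d_of_succ, map_sum]
    by_cases h : m = n
    · subst h
      rw [ev_of]
      simp only [map_smul, ev_of, smul_eq_mul]
      rfl
    · rw [ev_of_ne (by omega)]
      exact (Finset.sum_eq_zero fun i _ => by rw [map_smul, ev_of_ne h, smul_zero]).symm

theorem ev_cochainMap (f : C(X, Y)) {n : ℕ} (c : Cochain Y n) (x : SingularChain X) :
    ev (cochainMap f n c) x = ev c (SingularChain.map f x) := by
  suffices h : ev (cochainMap f n c) = ev c ∘ₗ SingularChain.map f from LinearMap.congr_fun h x
  refine SingularChain.hom_ext fun m σ => ?_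
  rw [LinearMap.comp_apply, SingularChain.map_of]
  by_cases h : m = n
  · subst h
    rw [ev_of, ev_of]
    rfl
  · rw [ev_of_ne h, ev_of_ne h]

theorem ev_d_of_mem_cocycles {n : ℕ} {c : Cochain X n} (hc : c ∈ cocycles X n)
    (x : SingularChain X) : ev c (SingularChain.d x) = 0 := by
  have hc' : coboundary X n c = 0 := hc
  rw [← ev_coboundary, hc', map_zero, LinearMap.zero_apply]

theorem ev_of_mem_coboundaries {n : ℕ} {c : Cochain X n} (hc : c ∈ coboundaries X n)
    {x : SingularChain X} (hx : SingularChain.d x = 0) : ev c x = 0 := by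
  cases n with
  | zero =>
    obtain rfl : c = 0 := hc
    rw [map_zero, LinearMap.zero_apply]
  | succ n =>
    obtain ⟨w, rfl⟩ := hc
    rw [ev_coboundary, hx, map_zero]

/-- The cochain given by a linear form on chains. -/
noncomputable def toCochain (φ : SingularChain X →ₗ[ℚ] ℚ) (n : ℕ) : Cochain X n :=
  fun σ => φ (SingularChain.of σ)

theorem ev_toCochain (φ : SingularChain X →ₗ[ℚ] ℚ) (n : ℕ) {W : Set X} {x : SingularChain X}
    (hx : x ∈ SingularChain.chainsIn W n) : ev (toCochain φ n) x = φ x := by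
  rw [← sub_eq_zero, ← LinearMap.sub_apply, ← Submodule.mem_bot ℚ]
  refine SingularChain.chainsIn_induction _ _ ?_ hx
  intro k σ hk _
  obtain rfl : k = n := by exact_mod_cast hk
  rw [Submodule.mem_bot, LinearMap.sub_apply, ev_of, toCochain, sub_self]

theorem coboundary_toCochain (φ : SingularChain X →ₗ[ℚ] ℚ) (n : ℕ) (σ : Simplex X (n + 1)) :
    coboundary X n (toCochain φ n) σ = φ (SingularChain.d (SingularChain.of σ)) := by
  rw [SingularChain.d_of_succ, map_sum]
  simp only [map_smul, smul_eq_mul]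
  rfl

theorem eq_of_forall_ev_eq {x y : SingularChain X}
    (h : ∀ (n : ℕ) (a : Cochain X n), ev a x = ev a y) : x = y := by
  refine Finsupp.ext ?_
  rintro ⟨n, σ⟩
  have key : ev (toCochain (Finsupp.lapply (R := ℚ) (M := ℚ) ⟨n, σ⟩) n) =
      Finsupp.lapply (R := ℚ) (M := ℚ) (⟨n, σ⟩ : Σ n : ℕ, Simplex X n) := by
    refine SingularChain.hom_ext fun m τ => ?_
    by_cases hm : m = n
    · subst hm
      rw [ev_of]
      rfl
    · rw [ev_of_ne hm, Finsupp.lapply_apply, Finsupp.single_eq_of_ne]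
      intro he
      exact hm (Sigma.mk.inj_iff.mp he).1.symm
  have := h n (toCochain (Finsupp.lapply (R := ℚ) (M := ℚ) ⟨n, σ⟩) n)
  rwa [key] at this

/-- A linear form on a submodule `S` that vanishes on the kernel of `d` factors through `d`. -/
theorem exists_factor_through {V V' : Type*} [AddCommGroup V] [Module ℚ V] [AddCommGroup V']
    [Module ℚ V'] (d : V →ₗ[ℚ] V') (S : Submodule ℚ V) (φ : V →ₗ[ℚ] ℚ)
    (h : ∀ z ∈ S, d z = 0 → φ z = 0) : ∃ ψ : V' →ₗ[ℚ] ℚ, ∀ z ∈ S, φ z = ψ (d z) := by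
  have hmem : φ ∘ₗ S.subtype ∈ LinearMap.range (d ∘ₗ S.subtype).dualMap := by
    rw [LinearMap.range_dualMap_eq_dualAnnihilator_ker, Submodule.mem_dualAnnihilator]
    intro z hz
    exact h z.1 z.2 hz
  obtain ⟨ψ, hψ⟩ := hmem
  exact ⟨ψ, fun z hz => (LinearMap.congr_fun hψ ⟨z, hz⟩).symm⟩

/-- A cochain that vanishes on cycles is a coboundary. -/
theorem mem_coboundaries_of_ev_eq_zero {n : ℕ} {c : Cochain X n}
    (h : ∀ x ∈ SingularChain.chainsIn (Set.univ : Set X) n, SingularChain.d x = 0 → ev c x = 0) :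
    c ∈ coboundaries X n := by
  obtain ⟨ψ, hψ⟩ := exists_factor_through SingularChain.d _ (ev c) h
  cases n with
  | zero =>
    change c = 0
    ext σ
    rw [← ev_of c, hψ _ (SingularChain.of_mem_chainsIn (Set.subset_univ _)),
      SingularChain.d_of_zero, map_zero]
    rfl
  | succ n =>
    refine ⟨toCochain ψ n, ?_⟩
    ext σ
    rw [coboundary_toCochain, ← hψ _ (SingularChain.of_mem_chainsIn (Set.subset_univ _)), ev_of]

theorem mk_eq_zero_iff {n : ℕ} {a : cocycles X n} :
    (Submodule.Quotient.mk a : H X n) = 0 ↔ a.1 ∈ coboundaries X n :=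
  Submodule.Quotient.mk_eq_zero _

theorem mk_eq_mk_iff {n : ℕ} {a b : cocycles X n} :
    (Submodule.Quotient.mk a : H X n) = Submodule.Quotient.mk b ↔
      a.1 - b.1 ∈ coboundaries X n :=
  Submodule.Quotient.eq _

/-- A cycle on which classes that span the cohomology vanish is a boundary. -/
theorem exists_d_eq_of_span {k : ℕ} {ι : Type*} (c : ι → cocycles X k)
    (hspan : Submodule.span ℚ (Set.range fun i => (Submodule.Quotient.mk (c i) : H X k)) = ⊤)
    {x : SingularChain X} (hx : x ∈ SingularChain.chainsIn (Set.univ : Set X) k)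
    (hdx : SingularChain.d x = 0) (h : ∀ i, ev (c i).1 x = 0) :
    ∃ e ∈ SingularChain.chainsIn (Set.univ : Set X) (k + 1), SingularChain.d e = x := by
  by_contra hcon
  have hx' : x ∉ (SingularChain.chainsIn (Set.univ : Set X) (k + 1)).map SingularChain.d := by
    rintro ⟨e, he, rfl⟩
    exact hcon ⟨e, he, rfl⟩
  obtain ⟨f, hfx, hf⟩ := Submodule.exists_le_ker_of_notMem hx'
  have hcoc : toCochain f k ∈ cocycles X k := by
    change coboundary X k _ = 0
    ext σ
    rw [coboundary_toCochain]
    refine hf ⟨_, ?_, rfl⟩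
    exact_mod_cast SingularChain.of_mem_chainsIn (Set.subset_univ (Set.range σ))
  have key : ∀ α ∈ Submodule.span ℚ (Set.range fun i => (Submodule.Quotient.mk (c i) : H X k)),
      ∀ a : cocycles X k, Submodule.Quotient.mk a = α → ev a.1 x = 0 := by
    intro α hα
    induction hα using Submodule.span_induction with
    | mem α hα =>
      obtain ⟨i, rfl⟩ := hα
      intro a ha
      have h1 := ev_of_mem_coboundaries (mk_eq_mk_iff.mp ha) hdx
      change ev (a.1 - (c i).1) x = 0 at h1
      rw [map_sub, LinearMap.sub_apply, h i, sub_zero] at h1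
      exact h1
    | zero =>
      intro a ha
      exact ev_of_mem_coboundaries (mk_eq_zero_iff.mp ha) hdx
    | add α β _ _ hα hβ =>
      intro a ha
      obtain ⟨a', rfl⟩ := Submodule.Quotient.mk_surjective _ α
      have h1 := hα a' rfl
      have h2 := hβ (a - a') (by rw [Submodule.Quotient.mk_sub, ha, add_sub_cancel_left])
      change ev (a.1 - a'.1) x = 0 at h2
      rwa [map_sub, LinearMap.sub_apply, h1, sub_zero] at h2
    | smul r α _ hα =>
      intro a ha
      obtain ⟨a', rfl⟩ := Submodule.Quotient.mk_surjective _ α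
      rw [← Submodule.Quotient.mk_smul] at ha
      have h1 := ev_of_mem_coboundaries (mk_eq_mk_iff.mp ha) hdx
      change ev (a.1 - r • a'.1) x = 0 at h1
      rwa [map_sub, LinearMap.sub_apply, map_smul, LinearMap.smul_apply, hα a' rfl, smul_zero,
        sub_zero] at h1
  have h0 := key (Submodule.Quotient.mk ⟨_, hcoc⟩) (hspan ▸ Submodule.mem_top) _ rfl
  rw [ev_toCochain f k hx] at h0
  exact hfx h0

/-- Linearly independent classes take prescribed values on some cycle. -/
theorem exists_cycle_of_linearIndependent {k m : ℕ} (c : Fin m → cocycles X k)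
    (hli : LinearIndependent ℚ fun i => (Submodule.Quotient.mk (c i) : H X k)) (ε : Fin m → ℚ) :
    ∃ x ∈ SingularChain.chainsIn (Set.univ : Set X) k, SingularChain.d x = 0 ∧
      ∀ i, ev (c i).1 x = ε i := by
  let E : SingularChain X →ₗ[ℚ] Fin m → ℚ := LinearMap.pi fun i => ev (c i).1
  let R : Submodule ℚ (Fin m → ℚ) :=
    (SingularChain.chainsIn (Set.univ : Set X) k ⊓ LinearMap.ker SingularChain.d).map E
  by_cases hR : R = ⊤
  · obtain ⟨x, ⟨hx, hdx⟩, hxε⟩ : ε ∈ R := hR ▸ Submodule.mem_top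
    exact ⟨x, hx, hdx, fun i => congrFun hxε i⟩
  · exfalso
    obtain ⟨f, hf0, hf⟩ := Submodule.exists_le_ker_of_lt_top R (lt_top_iff_ne_top.mpr hR)
    let a : cocycles X k := ∑ i, f (Pi.single i 1) • c i
    have ha : ∀ x, ev a.1 x = f (E x) := by
      intro x
      have h1 : a.1 = ∑ i, f (Pi.single i 1) • (c i).1 := by simp [a]
      rw [h1, map_sum, LinearMap.sum_apply]
      conv_rhs => rw [LinearMap.pi_apply_eq_sum_univ f (E x)]
      refine Finset.sum_congr rfl fun i _ => ?_
      rw [map_smul, LinearMap.smul_apply, smul_eq_mul, smul_eq_mul, mul_comm]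
      congr 2
      ext j
      simp [Pi.single_apply, eq_comm]
    have hcob : a.1 ∈ coboundaries X k := by
      refine mem_coboundaries_of_ev_eq_zero fun x hx hdx => ?_
      rw [ha]
      exact hf ⟨x, ⟨hx, hdx⟩, rfl⟩
    have h0 : ∑ i, f (Pi.single i 1) • (Submodule.Quotient.mk (c i) : H X k) = 0 := by
      have : (Submodule.Quotient.mk a : H X k) = 0 := mk_eq_zero_iff.mpr hcob
      rw [← this]
      change _ = Submodule.mkQ _ a
      simp only [a, map_sum, map_smul]
      rfl
    have h1 := Fintype.linearIndependent_iff.mp hli _ h0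
    refine hf0 (LinearMap.pi_ext' fun i => LinearMap.ext_ring ?_)
    exact h1 i

/-- The cap product with a cochain of degree `q`, dual to the cup product with it from the
right: `σ` goes to `e (back q-face of σ)` times the front face of `σ`. -/
noncomputable def cap {q : ℕ} (e : Cochain X q) : SingularChain X →ₗ[ℚ] SingularChain X :=
  SingularChain.lift fun N σ => ∑ m ∈ Finset.range (N + 1), if h : m + q = N then
    e (σ.pull (back h)) • SingularChain.of (σ.pull (front (h ▸ Nat.le_add_right m q))) else 0

theorem cap_of {q m : ℕ} (e : Cochain X q) (σ : Simplex X (m + q)) :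
    cap e (SingularChain.of σ) =
      e (σ.pull (back rfl)) • SingularChain.of (σ.pull (front (Nat.le_add_right m q))) := by
  rw [cap, SingularChain.lift_of, Finset.sum_eq_single m]
  · rw [dif_pos rfl]
  · intro m' _ hm'
    rw [dif_neg (by omega)]
  · intro hm
    exact absurd (Finset.mem_range.mpr (by omega)) hm

theorem cap_of_lt {q N : ℕ} (e : Cochain X q) (σ : Simplex X N) (h : N < q) :
    cap e (SingularChain.of σ) = 0 := by
  rw [cap, SingularChain.lift_of]
  exact Finset.sum_eq_zero fun m _ => dif_neg (by omega)

theorem cap_mem_chainsIn {q : ℕ} (e : Cochain X q) {W : Set X} {n : ℤ} {x : SingularChain X}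
    (hx : x ∈ SingularChain.chainsIn W n) : cap e x ∈ SingularChain.chainsIn W (n - q) := by
  refine SingularChain.chainsIn_induction _ _ ?_ hx
  rintro N σ rfl hσ
  rcases lt_or_ge N q with h | h
  · rw [cap_of_lt e σ h]
    exact Submodule.zero_mem _
  · obtain ⟨m, rfl⟩ : ∃ m, N = m + q := ⟨N - q, by omega⟩
    rw [cap_of]
    refine Submodule.smul_mem _ _ ?_
    have := SingularChain.of_mem_chainsIn
      ((SingularChain.range_pull_subset σ (front (Nat.le_add_right m q))).trans hσ)
    convert this using 2
    push_cast
    ring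

theorem ev_cochainCup_of {m q N : ℕ} (h : m + q = N) (a : Cochain X m) (e : Cochain X q)
    (σ : Simplex X N) : ev (cochainCup a e) (SingularChain.of σ) =
      a (σ.pull (front (h ▸ Nat.le_add_right m q))) * e (σ.pull (back h)) := by
  subst h
  rw [ev_of]
  rfl

theorem ev_cap {m q : ℕ} (a : Cochain X m) (e : Cochain X q) (x : SingularChain X) :
    ev a (cap e x) = ev (cochainCup a e) x := by
  suffices h : ev a ∘ₗ cap e = ev (cochainCup a e) from LinearMap.congr_fun h x
  refine SingularChain.hom_ext fun N σ => ?_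
  rw [LinearMap.comp_apply]
  rcases lt_or_ge N q with h | h
  · rw [cap_of_lt e σ h, map_zero, ev_of_ne (by omega)]
  · obtain ⟨m', rfl⟩ : ∃ m', N = m' + q := ⟨N - q, by omega⟩
    rw [cap_of, map_smul]
    by_cases hm : m' = m
    · subst hm
      rw [ev_of, ev_of, smul_eq_mul, mul_comm]
      rfl
    · rw [ev_of_ne hm, smul_zero, ev_of_ne (by omega)]

theorem d_cap {q : ℕ} {e : Cochain X q} (he : e ∈ cocycles X q) (x : SingularChain X) :
    SingularChain.d (cap e x) = cap e (SingularChain.d x) := by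
  have he' : coboundary X q e = 0 := he
  refine eq_of_forall_ev_eq fun m a => ?_
  rw [← ev_coboundary, ev_cap, ev_cap, ← ev_coboundary]
  suffices h : ev (cochainCup (coboundary X m a) e) = ev (coboundary X (m + q) (cochainCup a e))
    from LinearMap.congr_fun h x
  refine SingularChain.hom_ext fun N σ => ?_
  by_cases hN : N = m + q + 1
  · subst hN
    rw [ev_cochainCup_of (by omega), ev_of, coboundary_cochainCup, he']
    simp
  · rw [ev_of_ne (by omega), ev_of_ne hN]

theorem augmentation_cap {q : ℕ} (e : Cochain X q) (x : SingularChain X) :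
    augmentation (cap e x) = ev e x := by
  suffices h : augmentation ∘ₗ cap e = ev e from LinearMap.congr_fun h x
  refine SingularChain.hom_ext fun N σ => ?_
  rw [LinearMap.comp_apply]
  rcases lt_or_ge N q with h | h
  · rw [cap_of_lt e σ h, map_zero, ev_of_ne (by omega)]
  · obtain ⟨m, rfl⟩ : ∃ m, N = m + q := ⟨N - q, by omega⟩
    rw [cap_of, map_smul]
    cases m with
    | zero =>
      rw [augmentation_of_zero, smul_eq_mul, mul_one]
      have : ∀ (N : ℕ) (h : 0 + q = N) (σ : Simplex X N),
          e (σ.pull (back h)) = ev e (SingularChain.of σ) := by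
        intro N h σ
        obtain rfl : q = N := by omega
        rw [ev_of]
        have hb : back (m := 0) h = id := by
          ext i
          simp [back]
        rw [hb, Realization.pull_id]
      exact this _ rfl σ
    | succ m =>
      rw [augmentation, SingularChain.lift_of, if_neg (by omega), smul_zero, ev_of_ne (by omega)]

end Evaluation

/-! ### Local structure of a fibration in the orbifold sense -/

theorem locallyContractibleSpace_prod {X : Type u} {Y : Type v} [TopologicalSpace X]
    [TopologicalSpace Y] (hX : LocallyContractibleSpace X) (hY : LocallyContractibleSpace Y) :
    LocallyContractibleSpace (X × Y) := by
  rintro ⟨x, y⟩ N hN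
  obtain ⟨A, hA, A', hA', hAA'⟩ := mem_nhds_prod_iff.mp hN
  obtain ⟨V, hVA, hV, a, ⟨H⟩⟩ := hX x A hA
  obtain ⟨V', hVA', hV', a', ⟨H'⟩⟩ := hY y A' hA'
  have hsub : ∀ (p : A × A'), ((p.1 : X), (p.2 : Y)) ∈ N := fun p => hAA' ⟨p.1.2, p.2.2⟩
  refine ⟨V ×ˢ V', (Set.prod_mono hVA hVA').trans hAA', prod_mem_nhds hV hV',
    ⟨(a, a'), hsub (a, a')⟩, ⟨?_⟩⟩
  exact
    { toFun := fun p => ⟨((H (p.1, ⟨p.2.1.1, p.2.2.1⟩)).1, (H' (p.1, ⟨p.2.1.2, p.2.2.2⟩)).1),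
        hsub (_, _)⟩
      continuous_toFun := by fun_prop
      map_zero_left := fun p => by
        refine Subtype.ext (Prod.ext ?_ ?_)
        · change (H (0, _)).1 = _
          rw [H.apply_zero]; rfl
        · change (H' (0, _)).1 = _
          rw [H'.apply_zero]; rfl
      map_one_left := fun p => by
        refine Subtype.ext (Prod.ext ?_ ?_)
        · change (H (1, _)).1 = _
          rw [H.apply_one]; rfl
        · change (H' (1, _)).1 = _
          rw [H'.apply_one]; rfl }

/-- If a quotient by a group is identified with a subset `A` of `Y`, then the resulting map to `Y`
is open over the interior of `A`. -/
theorem isOpen_image_of_homeomorph {X : Type u} {Y : Type v} [TopologicalSpace X]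
    [TopologicalSpace Y] {G : Type*} [Group G] [MulAction G X] [ContinuousConstSMul G X]
    {A : Set Y} (φ : MulAction.orbitRel.Quotient G X ≃ₜ A) {Ω : Set Y} (hΩ : IsOpen Ω)
    (hΩA : Ω ⊆ A) {O : Set X} (hO : IsOpen O)
    (hOΩ : ∀ x ∈ O, (φ (Quotient.mk _ x)).1 ∈ Ω) :
    IsOpen ((fun x => (φ (Quotient.mk _ x)).1) '' O) := by
  have h1 : IsOpen ((Quotient.mk (MulAction.orbitRel G X)) '' O) :=
    isOpenMap_quotient_mk'_mul O hO
  have h2 := φ.isOpenMap _ h1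
  obtain ⟨A', hA', hAA'⟩ := isOpen_induced_iff.mp h2
  have : (fun x => (φ (Quotient.mk _ x)).1) '' O = A' ∩ Ω := by
    ext y
    constructor
    · rintro ⟨x, hx, rfl⟩
      refine ⟨?_, hOΩ x hx⟩
      have : φ (Quotient.mk _ x) ∈ Subtype.val ⁻¹' A' := by
        rw [hAA']
        exact ⟨_, ⟨x, hx, rfl⟩, rfl⟩
      exact this
    · rintro ⟨hy, hyΩ⟩
      have : (⟨y, hΩA hyΩ⟩ : A) ∈ Subtype.val ⁻¹' A' := hy
      rw [hAA'] at this
      obtain ⟨_, ⟨x, hx, rfl⟩, hxy⟩ := this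
      exact ⟨x, hx, congrArg Subtype.val hxy⟩
  rw [this]
  exact hA'.inter hΩ

variable {M : Type uM} {B : Type uB} {F : Type uF} [TopologicalSpace M] [TopologicalSpace B]
  [TopologicalSpace F]

/-- Near the fibre over `b`, every cycle comes from the fibre `F` up to homology: it lifts to
`U × F`, and there the contraction of `U` to the center moves it to the fibre. -/
theorem exists_nhds_cycle_from_fibre [T2Space F] (hM : LocallyContractibleSpace M)
    (hF : LocallyContractibleSpace F) {p : C(M, B)} {b : B}
    (T : OrbifoldTrivialization.{uM, uB, uF, uU, uG} p F b) (W : Opens B) (hb : b ∈ W) :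
    ∃ V ≤ W, b ∈ V ∧ ∀ (n : ℤ), ∀ z ∈ SingularChain.chainsIn (p ⁻¹' (V : Set B)) n,
      SingularChain.d z = 0 →
        ∃ x ∈ SingularChain.chainsIn (Set.univ : Set F) n, SingularChain.d x = 0 ∧
          ∃ e ∈ SingularChain.chainsIn (p ⁻¹' (W : Set B)) (n + 1),
            z = SingularChain.map T.fibreInclusion x + SingularChain.d e := by
  let πU : C(T.U, B) := ⟨fun u => (T.baseHomeo (Quotient.mk _ u)).1,
    continuous_subtype_val.comp (T.baseHomeo.continuous.comp continuous_quotient_mk')⟩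
  let π : C(T.U × F, M) := ⟨fun u => (T.totalHomeo (Quotient.mk _ u)).1,
    continuous_subtype_val.comp (T.totalHomeo.continuous.comp continuous_quotient_mk')⟩
  have hpπ : ∀ u, p (π u) = πU u.1 := fun u => T.compatible u.1 u.2
  have hπU : ∀ u u', πU u = πU u' → ∃ g : T.G, g • u' = u := fun u u' h =>
    Quotient.exact (T.baseHomeo.injective (Subtype.ext h))
  have hπ : ∀ u u', π u = π u' ↔ ∃ g : T.G, g • u' = u := fun u u' =>
    ⟨fun h => Quotient.exact (T.totalHomeo.injective (Subtype.ext h)),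
      fun h => congrArg (fun q => (T.totalHomeo q).1) (Quotient.sound h)⟩
  let Ω : Set B := interior T.V
  have hΩ : IsOpen Ω := isOpen_interior
  have hbΩ : b ∈ Ω := mem_interior_iff_mem_nhds.mpr T.V_mem_nhds
  have hcen : πU T.center = b := T.baseHomeo_center
  let Ut : Set T.U := πU ⁻¹' ((W : Set B) ∩ Ω)
  have hUt : IsOpen Ut := (W.isOpen.inter hΩ).preimage πU.continuous
  have hcUt : T.center ∈ Ut := by
    change πU T.center ∈ (W : Set B) ∩ Ω
    rw [hcen]
    exact ⟨hb, hbΩ⟩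
  obtain ⟨O, hO, hcO, hOUt, H, hH⟩ :=
    exists_open_homotopic_const T.locallyContractible hUt hcUt
  -- A neighbourhood of the center that is invariant under the group.
  let S : Set T.U := ⋂ g : T.G, (fun x => g • x) ⁻¹' O
  have hS : IsOpen S := isOpen_iInter_of_finite fun g => hO.preimage (continuous_const_smul g)
  have hSO : S ⊆ O := fun x hx => by simpa using Set.mem_iInter.mp hx 1
  let V : Opens B := ⟨πU '' S, isOpen_image_of_homeomorph T.baseHomeo hΩ interior_subset hS
    fun x hx => (hOUt (hSO hx)).2⟩
  have hVΩ : ∀ y ∈ V, y ∈ W ∧ y ∈ Ω := by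
    rintro _ ⟨s, hs, rfl⟩
    exact hOUt (hSO hs)
  have hVO : ∀ u, πU u ∈ V → u ∈ O := by
    rintro u ⟨s, hs, hsu⟩
    obtain ⟨g, rfl⟩ := hπU u s hsu.symm
    exact Set.mem_iInter.mp hs g
  refine ⟨V, fun y hy => (hVΩ y hy).1, ⟨T.center, Set.mem_iInter.mpr fun g => ?_, hcen⟩, ?_⟩
  · change g • T.center ∈ O
    rw [T.smul_center]
    exact hcO
  intro n z hz hdz
  let ΩM : Opens M := ⟨p ⁻¹' Ω, hΩ.preimage p.continuous⟩
  let VM : Opens M := ⟨p ⁻¹' (V : Set B), V.isOpen.preimage p.continuous⟩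
  have hΩπ : (ΩM : Set M) ⊆ Set.range π := by
    intro y hy
    obtain ⟨q, hq⟩ := T.totalHomeo.surjective ⟨y, interior_subset (s := T.V) hy⟩
    obtain ⟨u, rfl⟩ := Quotient.exists_rep q
    exact ⟨u, congrArg Subtype.val hq⟩
  obtain ⟨z₁, hz₁, hdz₁, e₁, he₁, hze₁⟩ := exists_cycle_lift (π := π) T.G
    (locallyContractibleSpace_prod T.locallyContractible hF) hM hπ (Ω := ΩM) hΩπ
    (fun O hO hOΩ => isOpen_image_of_homeomorph T.totalHomeo ΩM.isOpen
      (Set.preimage_mono interior_subset) hO fun x hx => hOΩ hx)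
    (W := VM) (fun y hy => (hVΩ _ hy).2) hz hdz
  -- The cycle upstairs lies over `O` and is moved to the fibre over the center.
  let f : C((O ×ˢ Set.univ : Set (T.U × F)), T.U × F) := ⟨fun q => (T.center, q.1.2), by fun_prop⟩
  let H' : ContinuousMap.Homotopy
      (⟨Subtype.val, continuous_subtype_val⟩ : C((O ×ˢ Set.univ : Set (T.U × F)), T.U × F)) f :=
    { toFun := fun q => (H (q.1, ⟨q.2.1.1, q.2.2.1⟩), q.2.1.2)
      continuous_toFun := by fun_prop
      map_zero_left := fun q => Prod.ext (H.apply_zero _) rfl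
      map_one_left := fun q => Prod.ext (H.apply_one _) rfl }
  have hsub : π ⁻¹' (VM : Set M) ⊆ O ×ˢ Set.univ := by
    intro u hu
    refine ⟨hVO _ ?_, Set.mem_univ _⟩
    rw [← hpπ]
    exact hu
  obtain ⟨z₂, hz₂, hdz₂, -, e₂, he₂, hze₂⟩ := exists_homologous H' (P := Ut ×ˢ Set.univ)
    (fun s q => ⟨hH _ _, Set.mem_univ _⟩) (SingularChain.chainsIn_mono hsub n hz₁) hdz₁
  let s : C((O ×ˢ Set.univ : Set (T.U × F)), F) := ⟨fun q => q.1.2, by fun_prop⟩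
  have hs : π.comp f = T.fibreInclusion.comp s := rfl
  refine ⟨SingularChain.map s z₂, SingularChain.map_mem_chainsIn (Set.mapsTo_univ _ _) hz₂,
    by rw [← SingularChain.map_d, hdz₂, map_zero], e₁ + SingularChain.map π e₂,
    Submodule.add_mem _ (SingularChain.chainsIn_mono
      (show p ⁻¹' (V : Set B) ⊆ p ⁻¹' (W : Set B) from fun y hy => (hVΩ _ hy).1) _ he₁)
      (SingularChain.map_mem_chainsIn (fun q hq => ?_) he₂), ?_⟩
  · change p (π q) ∈ W
    rw [hpπ]
    exact hq.1.1
  · rw [hze₁, hze₂, map_add, SingularChain.map_map, hs, ← SingularChain.map_map, map_add,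
      SingularChain.map_d π e₂]
    abel

/-! ### The Leray–Hirsch map on chains -/

section Theta

variable {M : Type u} {B : Type v} [TopologicalSpace M] [TopologicalSpace B] {n : ℕ → ℕ}

/-- The chain level transpose of the Leray–Hirsch map: its component at the cocycle `e` sends `x`
to `p_* (x ∩ e)`. -/
noncomputable def theta (p : C(M, B)) (e : ∀ i : Σ q, Fin (n q), cocycles M i.1) :
    SingularChain M →ₗ[ℚ] (Σ q, Fin (n q)) →₀ SingularChain B :=
  SingularChain.lift fun N σ => ∑ i ∈ (Finset.range (N + 1)).sigma fun _ => Finset.univ,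
    Finsupp.single i (SingularChain.map p (cap (e i).1 (SingularChain.of σ)))

theorem theta_apply (p : C(M, B)) (e : ∀ i : Σ q, Fin (n q), cocycles M i.1)
    (x : SingularChain M) (i : Σ q, Fin (n q)) :
    theta p e x i = SingularChain.map p (cap (e i).1 x) := by
  suffices h : Finsupp.lapply i ∘ₗ theta p e = SingularChain.map p ∘ₗ cap (e i).1 from
    LinearMap.congr_fun h x
  refine SingularChain.hom_ext fun N σ => ?_
  rw [LinearMap.comp_apply, LinearMap.comp_apply, theta, SingularChain.lift_of, map_sum]
  by_cases hi : i ∈ (Finset.range (N + 1)).sigma fun q => (Finset.univ : Finset (Fin (n q)))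
  · rw [Finset.sum_eq_single_of_mem i hi]
    · rw [Finsupp.lapply_apply, Finsupp.single_eq_same]
    · intro j _ hj
      rw [Finsupp.lapply_apply, Finsupp.single_eq_of_ne' hj]
  · have hlt : N < i.1 := by simpa using hi
    rw [cap_of_lt _ _ hlt, map_zero]
    refine Finset.sum_eq_zero fun j hj => ?_
    rw [Finsupp.lapply_apply, Finsupp.single_eq_of_ne']
    rintro rfl
    exact hi hj

/-- `theta` as a map of complexes over the base. -/
noncomputable def thetaHom (p : C(M, B)) (e : ∀ i : Σ q, Fin (n q), cocycles M i.1) :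
    LocalComplex.Hom (singularComplex p)
      ((singularComplex (ContinuousMap.id B)).shiftSum fun i : Σ q, Fin (n q) => i.1) where
  toFun := theta p e
  comm c := Finsupp.ext fun i => by
    change theta p e (SingularChain.d c) i = SingularChain.d (theta p e c i)
    rw [theta_apply, theta_apply, ← d_cap (e i).2, SingularChain.map_d]
  mem {W k c} hc i := by
    rw [theta_apply]
    exact SingularChain.map_mem_chainsIn (fun _ h => h) (cap_mem_chainsIn _ hc)

theorem augmentation_theta (p : C(M, B)) (e : ∀ i : Σ q, Fin (n q), cocycles M i.1)
    (x : SingularChain M) (i : Σ q, Fin (n q)) :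
    augmentation (theta p e x i) = ev (e i).1 x := by
  rw [theta_apply, augmentation_map, augmentation_cap]

end Theta

theorem eq_zero_of_mem_chainsIn_of_neg {X : Type u} [TopologicalSpace X] {W : Set X} {n : ℤ}
    (hn : n < 0) {c : SingularChain X} (hc : c ∈ SingularChain.chainsIn W n) : c = 0 := by
  rw [← Submodule.mem_bot ℚ]
  refine SingularChain.chainsIn_induction LinearMap.id _ ?_ hc
  rintro k σ rfl
  omega

variable {M : Type uM} {B : Type uB} {F : Type uF} [TopologicalSpace M] [TopologicalSpace B]
  [TopologicalSpace F] {p : C(M, B)} {n : ℕ → ℕ}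

/-- Injectivity of `theta` in the homology near a fibre: a cycle comes from a cycle of `F`, on
which the given classes vanish if its image bounds. -/
theorem exists_nhds_theta_injective [T2Space F] (hM : LocallyContractibleSpace M)
    (hF : LocallyContractibleSpace F) {b : B}
    (T : OrbifoldTrivialization.{uM, uB, uF, uU, uG} p F b)
    (e : ∀ i : Σ q, Fin (n q), cocycles M i.1)
    (he : ∀ q, Submodule.span ℚ (Set.range fun j : Fin (n q) =>
      pullback T.fibreInclusion q (Submodule.Quotient.mk (e ⟨q, j⟩))) = ⊤)
    (W : Opens B) (hb : b ∈ W) :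
    ∃ V ≤ W, b ∈ V ∧ ∀ (k : ℤ), ∀ z ∈ SingularChain.chainsIn (p ⁻¹' (V : Set B)) k,
      SingularChain.d z = 0 →
      (∀ i, ∃ c, SingularChain.d c = theta p e z i) →
        ∃ c ∈ SingularChain.chainsIn (p ⁻¹' (W : Set B)) (k + 1), SingularChain.d c = z := by
  obtain ⟨V, hVW, hbV, hV⟩ := exists_nhds_cycle_from_fibre hM hF T W hb
  refine ⟨V, hVW, hbV, fun k z hz hdz h => ?_⟩
  rcases lt_or_ge k 0 with hk | hk
  · exact ⟨0, Submodule.zero_mem _, by rw [eq_zero_of_mem_chainsIn_of_neg hk hz, map_zero]⟩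
  lift k to ℕ using hk
  obtain ⟨x, hx, hdx, c, hc, hzc⟩ := hV k z hz hdz
  let r := T.fibreInclusion
  obtain ⟨x', hx', rfl⟩ := exists_d_eq_of_span
    (fun j : Fin (n k) => ⟨cochainMap r k (e ⟨k, j⟩).1,
      cochainMap_mem_cocycles r k _ (e ⟨k, j⟩).2⟩) (he k) hx hdx fun j => by
      obtain ⟨c', hc'⟩ := h ⟨k, j⟩
      rw [ev_cochainMap, eq_sub_of_add_eq hzc.symm, map_sub, ev_d_of_mem_cocycles (e ⟨k, j⟩).2,
        sub_zero, ← augmentation_theta p e z ⟨k, j⟩, ← hc', augmentation_d]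
  refine ⟨SingularChain.map r x' + c, Submodule.add_mem _
    (SingularChain.map_mem_chainsIn (fun y _ => ?_) hx') hc, ?_⟩
  · have hy : r y ∈ p ⁻¹' {b} := by
      rw [← T.range_fibreInclusion]
      exact ⟨y, rfl⟩
    have hy' : p (r y) = b := hy
    change p (r y) ∈ W
    rw [hy']
    exact hb
  · rw [map_add, ← SingularChain.map_d, hzc]

/-- Surjectivity of `theta` in the homology near a fibre: near `b` a family of cycles is determined
up to homology by the augmentations of its members of degree `0`; for a chain of degree `k` they
belong to the classes of degree `k`, whose values can be prescribed on a suitable cycle of `F`. -/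
theorem exists_nhds_theta_surjective (hB : LocallyContractibleSpace B) {b : B}
    (T : OrbifoldTrivialization.{uM, uB, uF, uU, uG} p F b)
    (e : ∀ i : Σ q, Fin (n q), cocycles M i.1)
    (he : ∀ q, LinearIndependent ℚ fun j : Fin (n q) =>
      pullback T.fibreInclusion q (Submodule.Quotient.mk (e ⟨q, j⟩)))
    (W : Opens B) (hb : b ∈ W) :
    ∃ V ≤ W, b ∈ V ∧ ∀ (k : ℤ) (y : (Σ q, Fin (n q)) →₀ SingularChain B),
      (∀ i, y i ∈ SingularChain.chainsIn (V : Set B) (k - i.1)) →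
      (∀ i, SingularChain.d (y i) = 0) →
        ∃ z ∈ SingularChain.chainsIn (p ⁻¹' (W : Set B)) k, SingularChain.d z = 0 ∧
          ∀ i, ∃ c ∈ SingularChain.chainsIn (W : Set B) (k + 1 - i.1),
            SingularChain.d c = y i - theta p e z i := by
  obtain ⟨V, hVo, hbV, hVW, H, hH⟩ := exists_open_homotopic_const hB W.isOpen hb
  refine ⟨⟨V, hVo⟩, hVW, hbV, fun k y hy hdy => ?_⟩
  rcases lt_or_ge k 0 with hk | hk
  · refine ⟨0, Submodule.zero_mem _, map_zero _, fun i => ⟨0, Submodule.zero_mem _, ?_⟩⟩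
    rw [eq_zero_of_mem_chainsIn_of_neg (by omega) (hy i), map_zero, map_zero, Finsupp.coe_zero,
      Pi.zero_apply, sub_zero]
  lift k to ℕ using hk
  let r := T.fibreInclusion
  have hr : ∀ y, p (r y) = b := fun y => by
    have hy : r y ∈ p ⁻¹' {b} := by
      rw [← T.range_fibreInclusion]
      exact ⟨y, rfl⟩
    exact hy
  -- Only the components of `y` at the classes of degree `k` have degree `0`.
  obtain ⟨x, hx, hdx, hxy⟩ := exists_cycle_of_linearIndependent
    (fun j : Fin (n k) => ⟨cochainMap r k (e ⟨k, j⟩).1,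
      cochainMap_mem_cocycles r k _ (e ⟨k, j⟩).2⟩) (he k) fun j => augmentation (y ⟨k, j⟩)
  have hz : SingularChain.map r x ∈ SingularChain.chainsIn (p ⁻¹' {b}) k :=
    SingularChain.map_mem_chainsIn (fun y _ => hr y) hx
  refine ⟨SingularChain.map r x, SingularChain.chainsIn_mono
    (Set.preimage_mono (Set.singleton_subset_iff.mpr hb)) _ hz,
    by rw [← SingularChain.map_d, hdx, map_zero], fun i => ?_⟩
  have hθ : theta p e (SingularChain.map r x) i ∈ SingularChain.chainsIn V (k - i.1) := by
    rw [theta_apply]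
    exact SingularChain.chainsIn_mono (Set.singleton_subset_iff.mpr hbV) _
      (SingularChain.map_mem_chainsIn (fun _ h => h) (cap_mem_chainsIn _ hz))
  have hdθ : SingularChain.d (theta p e (SingularChain.map r x) i) = 0 := by
    rw [theta_apply, ← SingularChain.map_d, d_cap (e i).2, ← SingularChain.map_d, hdx, map_zero,
      map_zero, map_zero]
  have hu := Submodule.sub_mem _ (hy i) hθ
  have hdu : SingularChain.d (y i - theta p e (SingularChain.map r x) i) = 0 := by
    rw [map_sub, hdy, hdθ, sub_zero]
  have hdeg : (k : ℤ) + 1 - i.1 = k - i.1 + 1 := by ring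
  rw [hdeg]
  by_cases hki : (k : ℤ) - i.1 = 0
  · obtain ⟨q, j⟩ := i
    obtain rfl : q = k := by
      have : (k : ℤ) - q = 0 := hki
      omega
    rw [hki] at hu
    obtain ⟨c, hc, hcu⟩ := exists_eq_augmentation_smul_of_homotopy_const H hH hu
    rw [map_sub, augmentation_theta, ← ev_cochainMap, hxy j, sub_self, zero_smul, zero_add] at hcu
    refine ⟨c, ?_, hcu.symm⟩
    rw [hki]
    exact hc
  · exact exists_d_eq_of_homotopy_const H hH hb hki hu hdu

/-- Under the hypotheses of the Leray–Hirsch theorem the mapping cone of `theta` is acyclic. -/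
theorem cone_theta_acyclic [T2Space F] (hM : LocallyContractibleSpace M)
    (hB : LocallyContractibleSpace B) (hF : LocallyContractibleSpace F)
    (T : ∀ b : B, OrbifoldTrivialization.{uM, uB, uF, uU, uG} p F b)
    (e : ∀ i : Σ q, Fin (n q), cocycles M i.1)
    (he : ∀ (b : B) (q : ℕ), (LinearIndependent ℚ fun j : Fin (n q) =>
        pullback (T b).fibreInclusion q (Submodule.Quotient.mk (e ⟨q, j⟩))) ∧
      Submodule.span ℚ (Set.range fun j : Fin (n q) =>
        pullback (T b).fibreInclusion q (Submodule.Quotient.mk (e ⟨q, j⟩))) = ⊤)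
    (k : ℤ) (z : ((Σ q, Fin (n q)) →₀ SingularChain B) × SingularChain M)
    (hz : z ∈ (LocalComplex.cone (thetaHom p e)).chains ⊤ k)
    (hdz : (LocalComplex.cone (thetaHom p e)).d z = 0) :
    ∃ c ∈ (LocalComplex.cone (thetaHom p e)).chains ⊤ (k + 1),
      (LocalComplex.cone (thetaHom p e)).d c = z := by
  refine LocalComplex.cone_acyclic (thetaHom p e) ⊤ ?_ ?_ k ⊤ le_rfl z hz hdz
  · intro k W _ b hb
    obtain ⟨V, hVW, hbV, hV⟩ := exists_nhds_theta_injective hM hF (T b) e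
      (fun q => (he b q).2) W hb
    refine ⟨V, hVW, hbV, fun z hz hdz h => hV k z hz hdz fun i => ?_⟩
    obtain ⟨c, -, hc⟩ := h
    exact ⟨c i, DFunLike.congr_fun hc i⟩
  · intro k W _ b hb
    obtain ⟨V, hVW, hbV, hV⟩ := exists_nhds_theta_surjective hB (T b) e
      (fun q => (he b q).1) W hb
    refine ⟨V, hVW, hbV, fun y hy hdy => ?_⟩
    obtain ⟨z, hz, hdz, h⟩ := hV k y hy fun i => DFunLike.congr_fun hdy i
    obtain ⟨c, hc, hdc⟩ := LocalComplex.exists_d_eq_shiftSum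
      (singularComplex (ContinuousMap.id B)) (fun i : Σ q, Fin (n q) => i.1)
      (c := y - theta p e z) h
    exact ⟨z, hz, hdz, c, hc, by rw [hdc]; exact (add_sub_cancel _ _).symm⟩

/-! ### The pairing of cohomology with cycles -/

section Pairing

variable {X : Type u} [TopologicalSpace X]

/-- The evaluation of cohomology classes on a cycle. -/
noncomputable def pairing (x : LinearMap.ker (SingularChain.d (X := X))) : HTotal X →ₗ[ℚ] ℚ :=
  DirectSum.toModule ℚ ℕ ℚ fun k => Submodule.liftQ _
    ((ev (n := k)).flip x.1 ∘ₗ (cocycles X k).subtype) fun _ hc => ev_of_mem_coboundaries hc x.2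

theorem pairing_lof_mk (x : LinearMap.ker (SingularChain.d (X := X))) (k : ℕ)
    (c : cocycles X k) :
    pairing x (DirectSum.lof ℚ ℕ (H X) k (Submodule.Quotient.mk c)) = ev c.1 x.1 := by
  rw [pairing, DirectSum.toModule_lof]
  rfl

theorem pairing_eq_of_eq_add_d {x y : LinearMap.ker (SingularChain.d (X := X))}
    {c : SingularChain X} (h : x.1 = y.1 + SingularChain.d c) : pairing x = pairing y := by
  refine DirectSum.linearMap_ext _ fun k => LinearMap.ext fun a => ?_
  obtain ⟨a, rfl⟩ := Submodule.Quotient.mk_surjective _ a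
  rw [LinearMap.comp_apply, LinearMap.comp_apply, pairing_lof_mk, pairing_lof_mk, h, map_add,
    ev_d_of_mem_cocycles a.2, add_zero]

theorem pairing_zero : pairing (0 : LinearMap.ker (SingularChain.d (X := X))) = 0 := by
  refine DirectSum.linearMap_ext _ fun k => LinearMap.ext fun a => ?_
  obtain ⟨a, rfl⟩ := Submodule.Quotient.mk_surjective _ a
  rw [LinearMap.comp_apply, pairing_lof_mk]
  exact map_zero _

theorem pairing_lof_mk_of_ne {x : LinearMap.ker (SingularChain.d (X := X))} {m : ℤ} {k : ℕ}
    (h : m ≠ k) (hx : x.1 ∈ SingularChain.chainsIn (Set.univ : Set X) m) (a : H X k) :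
    pairing x (DirectSum.lof ℚ ℕ (H X) k a) = 0 := by
  obtain ⟨a, rfl⟩ := Submodule.Quotient.mk_surjective _ a
  rw [pairing_lof_mk, ev_eq_zero_of_ne h _ hx]

theorem pairing_eq_component {x : LinearMap.ker (SingularChain.d (X := X))} {k : ℕ}
    (hx : x.1 ∈ SingularChain.chainsIn (Set.univ : Set X) k) (v : HTotal X) :
    pairing x v = pairing x (DirectSum.lof ℚ ℕ (H X) k (v k)) := by
  suffices h : pairing x = pairing x ∘ₗ DirectSum.lof ℚ ℕ (H X) k ∘ₗ DirectSum.component ℚ ℕ _ k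
    from LinearMap.congr_fun h v
  refine DirectSum.linearMap_ext _ fun j => LinearMap.ext fun a => ?_
  simp only [LinearMap.comp_apply]
  by_cases hj : j = k
  · subst hj
    rw [DirectSum.component.lof_self]
  · rw [pairing_lof_mk_of_ne (by exact_mod_cast Ne.symm hj) hx, DirectSum.component.of,
      dif_neg hj, map_zero, map_zero]

/-- Over a field, a cohomology class is determined by its values on cycles. -/
theorem eq_of_forall_pairing {v w : HTotal X} (h : ∀ (k : ℕ)
    (x : LinearMap.ker (SingularChain.d (X := X))),
      x.1 ∈ SingularChain.chainsIn (Set.univ : Set X) k → pairing x v = pairing x w) : v = w := by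
  refine DFinsupp.ext fun k => ?_
  obtain ⟨c, hc⟩ := Submodule.Quotient.mk_surjective _ (v k)
  obtain ⟨c', hc'⟩ := Submodule.Quotient.mk_surjective _ (w k)
  rw [← hc, ← hc']
  refine mk_eq_mk_iff.mpr (mem_coboundaries_of_ev_eq_zero fun x hx hdx => ?_)
  have := h k ⟨x, hdx⟩ hx
  rw [pairing_eq_component hx v, pairing_eq_component hx w, ← hc, ← hc', pairing_lof_mk,
    pairing_lof_mk] at this
  rw [map_sub, LinearMap.sub_apply, this, sub_self]

end Pairing

/-! ### The Leray–Hirsch map in cohomology -/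

section LerayHirsch

variable {M : Type u} {B : Type v} [TopologicalSpace M] [TopologicalSpace B] {n : ℕ → ℕ}
  (p : C(M, B)) (e : ∀ i : Σ q, Fin (n q), cocycles M i.1)

/-- The map that sends `a` in the component of the cocycle `e` to `p^* a ∪ [e]`. -/
noncomputable def lerayHirsch : ((Σ q, Fin (n q)) →₀ HTotal B) →ₗ[ℚ] HTotal M :=
  Finsupp.lsum ℚ fun i => DirectSum.toModule ℚ ℕ (HTotal M) fun k =>
    DirectSum.lof ℚ ℕ (H M) (k + i.1) ∘ₗ
      (cup M k i.1).flip (Submodule.Quotient.mk (e i)) ∘ₗ pullback p k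

theorem lerayHirsch_single_lof (i : Σ q, Fin (n q)) (k : ℕ) (a : H B k) :
    lerayHirsch p e (Finsupp.single i (DirectSum.lof ℚ ℕ (H B) k a)) =
      DirectSum.lof ℚ ℕ (H M) (k + i.1)
        (cup M k i.1 (pullback p k a) (Submodule.Quotient.mk (e i))) := by
  rw [lerayHirsch, Finsupp.lsum_single, DirectSum.toModule_lof]
  rfl

/-- The components of `theta` on cycles. -/
noncomputable def thetaCycle (x : LinearMap.ker (SingularChain.d (X := M)))
    (i : Σ q, Fin (n q)) : LinearMap.ker (SingularChain.d (X := B)) :=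
  ⟨theta p e x.1 i, by
    have hx : SingularChain.d x.1 = 0 := x.2
    rw [LinearMap.mem_ker, theta_apply, ← SingularChain.map_d, d_cap (e i).2, hx, map_zero,
      map_zero]⟩

/-- `theta` is the transpose of `lerayHirsch`. -/
theorem pairing_lerayHirsch_single (x : LinearMap.ker (SingularChain.d (X := M)))
    (i : Σ q, Fin (n q)) (v : HTotal B) :
    pairing x (lerayHirsch p e (Finsupp.single i v)) = pairing (thetaCycle p e x i) v := by
  suffices h : pairing x ∘ₗ lerayHirsch p e ∘ₗ Finsupp.lsingle i = pairing (thetaCycle p e x i)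
    from LinearMap.congr_fun h v
  refine DirectSum.linearMap_ext _ fun k => LinearMap.ext fun a => ?_
  obtain ⟨a, rfl⟩ := Submodule.Quotient.mk_surjective _ a
  rw [LinearMap.comp_apply, LinearMap.comp_apply, LinearMap.comp_apply, LinearMap.comp_apply,
    Finsupp.lsingle_apply, lerayHirsch_single_lof, pairing_lof_mk]
  change pairing x (DirectSum.lof ℚ ℕ (H M) (k + i.1) (Submodule.Quotient.mk
    ⟨cochainCup (cochainMap p k a.1) (e i).1, _⟩)) = _
  rw [pairing_lof_mk, ← ev_cap, ev_cochainMap]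
  exact congrArg (ev a.1) (theta_apply p e x.1 i).symm

theorem pairing_lerayHirsch (x : LinearMap.ker (SingularChain.d (X := M)))
    (u : (Σ q, Fin (n q)) →₀ HTotal B) :
    pairing x (lerayHirsch p e u) = u.sum fun i v => pairing (thetaCycle p e x i) v := by
  conv_lhs => rw [← u.sum_single]
  rw [Finsupp.sum, map_sum, map_sum]
  exact Finset.sum_congr rfl fun i _ => pairing_lerayHirsch_single p e x i (u i)

variable {p e}

/-- Each cycle of the base, placed in any one component, is homologous to the image of a cycle
under `theta`, so that the values of a class in the kernel on it vanish. -/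
theorem lerayHirsch_injective
    (h : ∀ (k : ℤ) (z : ((Σ q, Fin (n q)) →₀ SingularChain B) × SingularChain M),
      z ∈ (LocalComplex.cone (thetaHom p e)).chains ⊤ k →
        (LocalComplex.cone (thetaHom p e)).d z = 0 →
          ∃ c ∈ (LocalComplex.cone (thetaHom p e)).chains ⊤ (k + 1),
            (LocalComplex.cone (thetaHom p e)).d c = z) :
     Function.Injective (lerayHirsch p e) := by
  classical
  intro u u' hu
  refine Finsupp.ext fun i₀ => eq_of_forall_pairing fun k y hy => ?_
  have hsingle : Finsupp.single i₀ y.1 ∈ LocalComplex.shiftChains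
      (singularComplex (ContinuousMap.id B)) (fun i : Σ q, Fin (n q) => i.1) ⊤
      ((k : ℤ) + i₀.1) := by
    intro i
    by_cases hi : i = i₀
    · subst hi
      rw [Finsupp.single_eq_same, add_sub_cancel_right]
      exact hy
    · rw [Finsupp.single_eq_of_ne hi]
      exact Submodule.zero_mem _
  obtain ⟨x, hx, hdx, c, -, hc⟩ := LocalComplex.exists_of_cone_acyclic (thetaHom p e)
    (h ((k : ℤ) + i₀.1)) hsingle (by
      change Finsupp.mapRange.linearMap SingularChain.d (Finsupp.single i₀ y.1) = 0
      have hdy : SingularChain.d y.1 = 0 := y.2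
      rw [Finsupp.mapRange.linearMap_apply, Finsupp.mapRange_single, hdy, Finsupp.single_zero])
  have hci : ∀ i, Finsupp.single i₀ y.1 i = theta p e x i + SingularChain.d (c i) :=
    fun i => DFunLike.congr_fun hc i
  have key : ∀ w : (Σ q, Fin (n q)) →₀ HTotal B,
      pairing ⟨x, hdx⟩ (lerayHirsch p e w) = pairing y (w i₀) := by
    intro w
    rw [pairing_lerayHirsch, Finsupp.sum_eq_single i₀]
    · refine (LinearMap.congr_fun (pairing_eq_of_eq_add_d (c := c i₀) ?_) _).symm
      have := hci i₀
      rwa [Finsupp.single_eq_same] at this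
    · intro i _ hi
      have h1 := hci i
      rw [Finsupp.single_eq_of_ne hi] at h1
      rw [← pairing_eq_of_eq_add_d (x := 0) (y := thetaCycle p e ⟨x, hdx⟩ i) (c := c i) h1,
        pairing_zero, LinearMap.zero_apply]
    · exact fun _ => map_zero _
  rw [← key, ← key, hu]

/-- A cocycle of the total space, viewed as a functional on the mapping cone that vanishes on
boundaries, factors through the boundary operator; the factorization provides the components of a
preimage of its class. -/
theorem lof_mem_range_lerayHirsch
    (h : ∀ (k : ℤ) (z : ((Σ q, Fin (n q)) →₀ SingularChain B) × SingularChain M),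
      z ∈ (LocalComplex.cone (thetaHom p e)).chains ⊤ k →
        (LocalComplex.cone (thetaHom p e)).d z = 0 →
          ∃ c ∈ (LocalComplex.cone (thetaHom p e)).chains ⊤ (k + 1),
            (LocalComplex.cone (thetaHom p e)).d c = z)
    (k : ℕ) (c : cocycles M k) :
    DirectSum.lof ℚ ℕ (H M) k (Submodule.Quotient.mk c) ∈ LinearMap.range (lerayHirsch p e) := by
  classical
  obtain ⟨Ψ, hΨ⟩ := exists_factor_through (LocalComplex.cone (thetaHom p e)).d
    ((LocalComplex.cone (thetaHom p e)).chains ⊤ (k + 1)) (ev c.1 ∘ₗ LinearMap.snd ℚ _ _) (by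
      intro z hz hdz
      obtain ⟨⟨y', x'⟩, -, rfl⟩ := h (k + 1) z hz hdz
      change ev c.1 (-SingularChain.d x') = 0
      rw [map_neg, ev_d_of_mem_cocycles c.2, neg_zero])
  let ψ := Ψ ∘ₗ LinearMap.inl ℚ _ _
  have hψ : ∀ x ∈ SingularChain.chainsIn (Set.univ : Set M) k, SingularChain.d x = 0 →
      ev c.1 x = ψ (theta p e x) := by
    intro x hx hdx
    have := hΨ (0, x) ⟨Submodule.zero_mem _, by rw [add_sub_cancel_right]; exact hx⟩
    rw [LocalComplex.cone_d, map_zero, zero_add] at this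
    refine this.trans (congrArg Ψ (Prod.ext rfl ?_))
    change -SingularChain.d x = 0
    rw [hdx, neg_zero]
  have hψd : ∀ y ∈ LocalComplex.shiftChains (singularComplex (ContinuousMap.id B))
      (fun i : Σ q, Fin (n q) => i.1) ⊤ ((k : ℤ) + 1),
        ψ (Finsupp.mapRange.linearMap SingularChain.d y) = 0 := by
    intro y hy
    have := hΨ (y, 0) ⟨hy, Submodule.zero_mem _⟩
    rw [LocalComplex.cone_d, map_zero, map_zero, neg_zero, add_zero] at this
    refine this.symm.trans ?_
    exact map_zero (ev c.1)
  -- The component of `ψ` at `i` is a cocycle of degree `k - i.1`, or zero if that is negative.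
  have key : ∀ i : Σ q, Fin (n q), ∃ v : HTotal B, ∀ (m : ℤ)
      (y : LinearMap.ker (SingularChain.d (X := B))),
      y.1 ∈ SingularChain.chainsIn (Set.univ : Set B) (m - i.1) →
        pairing y v = if m = k then ψ (Finsupp.single i y.1) else 0 := by
    intro i
    rcases lt_or_ge k i.1 with hk | hk
    · refine ⟨0, fun m y hy => ?_⟩
      rw [map_zero]
      split_ifs with hm
      · rw [eq_zero_of_mem_chainsIn_of_neg (by omega) hy, Finsupp.single_zero, map_zero]
      · rfl
    · have ha : toCochain (ψ ∘ₗ Finsupp.lsingle i) (k - i.1) ∈ cocycles B (k - i.1) := by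
        refine LinearMap.mem_ker.mpr (funext fun σ => ?_)
        rw [coboundary_toCochain]
        have := hψd (Finsupp.single i (SingularChain.of σ)) fun j => by
          by_cases hj : j = i
          · subst hj
            rw [Finsupp.single_eq_same]
            have hdeg : (k : ℤ) + 1 - j.1 = (k - j.1 + 1 : ℕ) := by omega
            rw [hdeg]
            exact SingularChain.of_mem_chainsIn (Set.subset_univ _)
          · rw [Finsupp.single_eq_of_ne hj]
            exact Submodule.zero_mem _
        rw [Finsupp.mapRange.linearMap_apply, Finsupp.mapRange_single] at this
        exact this
      refine ⟨DirectSum.lof ℚ ℕ (H B) (k - i.1) (Submodule.Quotient.mk ⟨_, ha⟩),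
        fun m y hy => ?_⟩
      split_ifs with hm
      · have hdeg : m - i.1 = (k - i.1 : ℕ) := by omega
        rw [hdeg] at hy
        rw [pairing_lof_mk, ev_toCochain _ _ hy]
        rfl
      · exact pairing_lof_mk_of_ne (by omega) hy _
  choose v hv using key
  let S : Finset (Σ q, Fin (n q)) := (Finset.range (k + 1)).sigma fun _ => Finset.univ
  refine ⟨∑ i ∈ S, Finsupp.single i (v i), ?_⟩
  refine eq_of_forall_pairing fun m x hx => ?_
  have hθ : ∀ i, theta p e x.1 i ∈ SingularChain.chainsIn (Set.univ : Set B) ((m : ℤ) - i.1) :=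
    fun i => by
      rw [theta_apply]
      exact SingularChain.map_mem_chainsIn (Set.mapsTo_univ _ _) (cap_mem_chainsIn _ hx)
  rw [map_sum, map_sum]
  simp only [pairing_lerayHirsch_single]
  rw [Finset.sum_congr rfl fun i _ => hv i m (thetaCycle p e x i) (hθ i)]
  by_cases hm : (m : ℤ) = k
  · obtain rfl : m = k := by exact_mod_cast hm
    simp only [if_true]
    rw [pairing_lof_mk, hψ x.1 hx x.2, ← map_sum]
    refine congrArg ψ (Finsupp.ext fun i => ?_)
    rw [Finsupp.finsetSum_apply]
    by_cases hi : i ∈ S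
    · rw [Finset.sum_eq_single_of_mem i hi fun j _ hj => Finsupp.single_eq_of_ne' hj,
        Finsupp.single_eq_same]
      rfl
    · have hlt : m < i.1 := by simpa [S] using hi
      rw [eq_zero_of_mem_chainsIn_of_neg (by omega) (hθ i)]
      refine Finset.sum_eq_zero fun j hj => Finsupp.single_eq_of_ne' ?_
      rintro rfl
      exact hi hj
  · simp only [if_neg hm, Finset.sum_const_zero]
    exact (pairing_lof_mk_of_ne hm hx _).symm

theorem lerayHirsch_bijective
    (h : ∀ (k : ℤ) (z : ((Σ q, Fin (n q)) →₀ SingularChain B) × SingularChain M),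
      z ∈ (LocalComplex.cone (thetaHom p e)).chains ⊤ k →
        (LocalComplex.cone (thetaHom p e)).d z = 0 →
          ∃ c ∈ (LocalComplex.cone (thetaHom p e)).chains ⊤ (k + 1),
            (LocalComplex.cone (thetaHom p e)).d c = z) :
     Function.Bijective (lerayHirsch p e) := by
  refine ⟨lerayHirsch_injective h, LinearMap.range_eq_top.mp (Submodule.eq_top_iff'.mpr ?_)⟩
  intro v
  induction v using DirectSum.induction_on with
  | zero => exact Submodule.zero_mem _
  | of k a =>
    obtain ⟨a, rfl⟩ := Submodule.Quotient.mk_surjective _ a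
    exact lof_mem_range_lerayHirsch h k a
  | add v w hv hw => exact Submodule.add_mem _ hv hw

end LerayHirsch

end SingularCohomology

/-! ### The Leray–Hirsch theorem -/

theorem mainTheorem3 {M : Type uM} {B : Type uB} {F : Type uF}
    [TopologicalSpace M] [TopologicalSpace B] [TopologicalSpace F] [T2Space F]
    (hM : LocallyContractibleSpace M) (hB : LocallyContractibleSpace B)
    (hF : LocallyContractibleSpace F)
    (p : C(M, B)) (T : ∀ b : B, OrbifoldTrivialization.{uM, uB, uF, uU, uG} p F b)
    (n : ℕ → ℕ) (e : ∀ q : ℕ, Fin (n q) → SingularCohomology.H M q)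
    (he : ∀ (b : B) (q : ℕ),
      LinearIndependent ℚ
          (fun i => SingularCohomology.pullback (T b).fibreInclusion q (e q i)) ∧
        Submodule.span ℚ
          (Set.range fun i => SingularCohomology.pullback (T b).fibreInclusion q (e q i)) = ⊤)
    (b : B) :
    ∃ Φ : (SingularCohomology.HTotal B ⊗[ℚ] SingularCohomology.HTotal F) ≃ₗ[ℚ]
        SingularCohomology.HTotal M,
      (∀ (k q : ℕ) (a : SingularCohomology.H B k) (i : Fin (n q)),
        Φ (DirectSum.lof ℚ ℕ (SingularCohomology.H B) k a ⊗ₜ[ℚ]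
            DirectSum.lof ℚ ℕ (SingularCohomology.H F) q
              (SingularCohomology.pullback (T b).fibreInclusion q (e q i))) =
          DirectSum.lof ℚ ℕ (SingularCohomology.H M) (k + q)
            (SingularCohomology.cup M k q (SingularCohomology.pullback p k a) (e q i))) ∧
      (∀ (k q : ℕ) (a : SingularCohomology.H B k) (x : SingularCohomology.H F q),
        Φ (DirectSum.lof ℚ ℕ (SingularCohomology.H B) k a ⊗ₜ[ℚ]
            DirectSum.lof ℚ ℕ (SingularCohomology.H F) q x) ∈
          LinearMap.range (DirectSum.lof ℚ ℕ (SingularCohomology.H M) (k + q))) := by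
  classical
  choose c hc using fun i : Σ q, Fin (n q) =>
    Submodule.Quotient.mk_surjective
      ((SingularCohomology.coboundaries M i.1).submoduleOf (SingularCohomology.cocycles M i.1))
      (e i.1 i.2)
  have hc' : ∀ (q : ℕ) (j : Fin (n q)), Submodule.Quotient.mk (c ⟨q, j⟩) = e q j :=
    fun q j => hc ⟨q, j⟩
  have hbij := SingularCohomology.lerayHirsch_bijective
    (SingularCohomology.cone_theta_acyclic hM hB hF T c fun b q => by
      simp only [hc']
      exact he b q)
  -- The classes at `b`, in all degrees together, are a basis of the total cohomology of `F`.
  let 𝒞 : Module.Basis (Σ q, Fin (n q)) ℚ (SingularCohomology.HTotal F) :=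
    DFinsupp.basis fun q => Module.Basis.mk (he b q).1 (he b q).2.ge
  have h𝒞 : ∀ (q : ℕ) (i : Fin (n q)), 𝒞 ⟨q, i⟩ =
      DirectSum.lof ℚ ℕ (SingularCohomology.H F) q
        (SingularCohomology.pullback (T b).fibreInclusion q (e q i)) := by
    intro q i
    rw [Module.Basis.apply_eq_iff]
    ext ⟨j, l⟩
    change (Module.Basis.mk (he b j).1 (he b j).2.ge).repr
      (DirectSum.lof ℚ ℕ (SingularCohomology.H F) q _ j) l = _
    by_cases hj : q = j
    · subst hj
      rw [DirectSum.lof_apply, Module.Basis.mk_repr, LinearIndependent.repr_eq_single _ i _ rfl]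
      by_cases hl : i = l
      · subst hl
        rw [Finsupp.single_eq_same, Finsupp.single_eq_same]
      · rw [Finsupp.single_eq_of_ne' hl, Finsupp.single_eq_of_ne']
        rintro ⟨⟩
        exact hl rfl
    · have h0 : DirectSum.lof ℚ ℕ (SingularCohomology.H F) q
          (SingularCohomology.pullback (T b).fibreInclusion q (e q i)) j = 0 :=
        DirectSum.of_eq_of_ne _ _ _ (Ne.symm hj)
      rw [h0, map_zero, Finsupp.single_eq_of_ne']
      · rfl
      · rintro ⟨⟩
        exact hj rfl
  let Φ := TensorProduct.equivFinsuppOfBasisRight (M := SingularCohomology.HTotal B) 𝒞 ≪≫ₗ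
    LinearEquiv.ofBijective (SingularCohomology.lerayHirsch p c) hbij
  have hΦ : ∀ (k q : ℕ) (a : SingularCohomology.H B k) (i : Fin (n q)),
      Φ (DirectSum.lof ℚ ℕ (SingularCohomology.H B) k a ⊗ₜ[ℚ]
          DirectSum.lof ℚ ℕ (SingularCohomology.H F) q
            (SingularCohomology.pullback (T b).fibreInclusion q (e q i))) =
        DirectSum.lof ℚ ℕ (SingularCohomology.H M) (k + q)
          (SingularCohomology.cup M k q (SingularCohomology.pullback p k a) (e q i)) := by
    intro k q a i
    rw [← h𝒞, LinearEquiv.trans_apply, TensorProduct.equivFinsuppOfBasisRight_apply_tmul,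
      Module.Basis.repr_self, Finsupp.mapRange_single, one_smul, LinearEquiv.ofBijective_apply,
      SingularCohomology.lerayHirsch_single_lof, hc']
  refine ⟨Φ, hΦ, fun k q a x => ?_⟩
  have hle : ⊤ ≤ (LinearMap.range (DirectSum.lof ℚ ℕ (SingularCohomology.H M) (k + q))).comap
      (Φ.toLinearMap ∘ₗ TensorProduct.mk ℚ _ _ (DirectSum.lof ℚ ℕ (SingularCohomology.H B) k a) ∘ₗ
        DirectSum.lof ℚ ℕ (SingularCohomology.H F) q) := by
    rw [← (he b q).2, Submodule.span_le]
    rintro _ ⟨i, rfl⟩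
    exact ⟨_, (hΦ k q a i).symm⟩
  exact hle Submodule.mem_top
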